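/- **Counting and inverse counting lemma II.** Let $\mathcal H$ be a separable real Hilbert space and let $\mathcal B$ be a real Banach space with a compact injective linear embedding $\mathcal B\hookrightarrow\mathcal H$. Let $\boldsymbol w_n$ ($n\in\mathbb N$) and $\boldsymbol w$ be $\mathcal B$-valued kernels on $[0,1]^2$, strongly measurable as maps into $\mathcal H$ up to null sets (in particular this holds for all elements of the Bochner space $L^\infty([0,1]^2;\mathcal B)$), which are uniformly bounded: for some $C<\infty$ one has $\|\boldsymbol w_n(\xi,\zeta)\|_{\mathcal B}\le C$ for all $n$ and $\|\boldsymbol w(\xi,\zeta)\|_{\mathcal B}\le C$, for a.e. $(\xi,\zeta)$. No symmetry is assumed. An *oriented tree* $T$ consists of a finite vertex set $\mathsf v(T)$ and a set of directed edges $\mathsf e(T)\subset \mathsf v(T)\times\mathsf v(T)$ such that $(i,j)\in\mathsf e(T)$ implies $(j,i)\notin\mathsf e(T)$ and such that the underlying undirected graph is a tree. The tensorized homomorphism density of $T$ is $$\boldsymbol t(T,\boldsymbol w)=\int_{[0,1]^{\mathsf v(T)}}\ \bigotimes_{(i,j)\in\mathsf e(T)}\boldsymbol w(\xi_i,\xi_j)\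 \prod_{i\in\mathsf v(T)}\mathrm d\xi_i\ \in\ \mathcal H^{\otimes\mathsf e(T)},$$ where $\mathcal H^{\otimes \mathsf e(T)}$ is the Hilbert tensor power. For an $\mathcal H$-valued kernel $\boldsymbol u$ on $[0,1]^2$ let $$\|\boldsymbol u\|_{\square;\mathcal H}=\sup_{\|\boldsymbol e\|_{\mathcal H}\le1,\ S,S'\subset[0,1]\text{ measurable}}\Big\langle\boldsymbol e,\int_{S\times S'}\boldsymbol u(\xi,\zeta)\,\mathrm d\xi\,\mathrm d\zeta\Big\rangle_{\mathcal H}.$$ Let $\Pi$ be the set of probability measures $\gamma$ on $[0,1]^2$ both of whose marginals are the Lebesgue measure, and let $\gamma^T$ be the image of $\gamma$ under $(\xi,\zeta)\mapsto(\zeta,\xi)$. Write $\gamma(\mathrm d\xi,\mathrm d\zeta)=\mathrm d\xi\,\gamma_\xi(\mathrm d\zeta)=\gamma^\zeta(\mathrm d\xi)\,\mathrm d\zeta$ for its disintegrations, put $$(\boldsymbol w\gamma)(\xi,\zeta)=\int\boldsymbol w(\xi,\iota)\,\gamma^\zeta(\mathrm d\iota),\qquad(\gamma\boldsymbol w)(\xi,\zeta)=\int\boldsymbol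 w(\iota,\zeta)\,\gamma_\xi(\mathrm d\iota),$$ and define the coupling distance $$\gamma_{\square;\mathcal H}(\boldsymbol w_1,\boldsymbol w_2)=\inf_{\gamma\in\Pi}\Big(\|\boldsymbol w_1\gamma-\gamma\boldsymbol w_2\|_{\square;\mathcal H}+\|\gamma^T\boldsymbol w_1-\boldsymbol w_2\gamma^T\|_{\square;\mathcal H}\Big).$$ Then the following are equivalent: 1. for every oriented tree $T$, $\ \lim_{n\to\infty}\|\boldsymbol t(T,\boldsymbol w_n)-\boldsymbol t(T,\boldsymbol w)\|_{\mathcal H^{\otimes\mathsf e(T)}}=0$; 2. $\ \lim_{n\to\infty}\gamma_{\square;\mathcal H}(\boldsymbol w_n,\boldsymbol w)=0$. -/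

import Mathlib

open MeasureTheory ProbabilityTheory Filter Topology
open scoped ENNReal unitInterval

noncomputable section

/-! ### Finite Hilbert tensor powers -/

/-- The algebraic tensor power `H^{⊗ι}` of a real inner product space over a finite index set `ι`,
as a type of its own, so that it can carry the norm which comes from the inner product. -/
def AlgTensorPower (ι : Type*) (H : Type*) [NormedAddCommGroup H] [InnerProductSpace ℝ H] :
    Type _ :=
  PiTensorProduct ℝ (fun _ : ι => H)

namespace AlgTensorPower

variable {ι : Type*} {H : Type*} [NormedAddCommGroup H] [InnerProductSpace ℝ H]

instance : AddCommGroup (AlgTensorPower ι H) :=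
  inferInstanceAs (AddCommGroup (PiTensorProduct ℝ (fun _ : ι => H)))

instance : Module ℝ (AlgTensorPower ι H) :=
  inferInstanceAs (Module ℝ (PiTensorProduct ℝ (fun _ : ι => H)))

/-- The pure tensor `⨂ i, x i`, as a multilinear function of `x`. -/
def tprod (ι H : Type*) [NormedAddCommGroup H] [InnerProductSpace ℝ H] :
    MultilinearMap ℝ (fun _ : ι => H) (AlgTensorPower ι H) :=
  PiTensorProduct.tprod ℝ

theorem exists_eq_sum (z : AlgTensorPower ι H) :
    ∃ c : (ι → H) →₀ ℝ, z = c.sum fun x a => a • tprod ι H x := by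
  have hz : z ∈ Submodule.span ℝ (Set.range (tprod ι H)) := by
    have : Submodule.span ℝ (Set.range (tprod ι H)) = ⊤ :=
      PiTensorProduct.span_tprod_eq_top (R := ℝ) (s := fun _ : ι => H)
    rw [this]
    trivial
  obtain ⟨c, hc⟩ := Finsupp.mem_span_range_iff_exists_finsupp.1 hz
  exact ⟨c, hc.symm⟩

variable [Fintype ι]

/-- The bilinear form on the algebraic tensor power which is determined by
`⟪⨂ i, x i, ⨂ i, y i⟫ = ∏ i, ⟪x i, y i⟫`. -/
def form (ι H : Type*) [Fintype ι] [NormedAddCommGroup H] [InnerProductSpace ℝ H] :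
    AlgTensorPower ι H →ₗ[ℝ] AlgTensorPower ι H →ₗ[ℝ] ℝ :=
  (PiTensorProduct.dualDistrib (R := ℝ) (M := fun _ : ι => H)) ∘ₗ
    (PiTensorProduct.map (fun _ : ι => innerₗ H))

theorem form_tprod (x y : ι → H) :
    form ι H (tprod ι H x) (tprod ι H y) = ∏ i, inner ℝ (x i) (y i) := by
  have h : PiTensorProduct.dualDistrib (R := ℝ) (M := fun _ : ι => H)
      (PiTensorProduct.map (fun _ : ι => innerₗ H) (PiTensorProduct.tprod ℝ x))
      (PiTensorProduct.tprod ℝ y) = ∏ i, inner ℝ (x i) (y i) := by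
    rw [PiTensorProduct.map_tprod, PiTensorProduct.dualDistrib_apply]
    simp
  exact h

theorem form_symm (z z' : AlgTensorPower ι H) : form ι H z z' = form ι H z' z := by
  obtain ⟨c, rfl⟩ := exists_eq_sum z
  obtain ⟨c', rfl⟩ := exists_eq_sum z'
  simp only [Finsupp.sum, map_sum, map_smul, LinearMap.sum_apply, LinearMap.smul_apply, form_tprod,
    Finset.smul_sum]
  rw [Finset.sum_comm]
  refine Finset.sum_congr rfl fun x _ => Finset.sum_congr rfl fun y _ => ?_
  rw [smul_comm, Finset.prod_congr rfl fun i _ => real_inner_comm (x i) (y i)]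

theorem posSemidef_prod_gram {m : Type*} [Finite m] (x : m → ι → H) :
    (Matrix.of fun k l : m => ∏ i, (inner ℝ (x k i) (x l i) : ℝ)).PosSemidef := by
  classical
  have key : ∀ s : Finset ι,
      (Matrix.of fun k l : m => ∏ i ∈ s, (inner ℝ (x k i) (x l i) : ℝ)).PosSemidef := by
    intro s
    induction s using Finset.induction_on with
    | empty =>
      have h := Matrix.posSemidef_gram ℝ (fun _ : m => (1 : ℝ))
      have he : (Matrix.of fun k l : m => ∏ i ∈ (∅ : Finset ι), (inner ℝ (x k i) (x l i) : ℝ)) =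
          Matrix.gram ℝ (fun _ : m => (1 : ℝ)) := by
        ext k l
        simp [Matrix.gram]
      rw [he]
      exact h
    | insert i s hi ih =>
      have h := (Matrix.posSemidef_gram ℝ (fun k : m => x k i)).hadamard ih
      have he : (Matrix.of fun k l : m => ∏ i ∈ insert i s, (inner ℝ (x k i) (x l i) : ℝ)) =
          (Matrix.gram ℝ fun k : m => x k i).hadamard
            (Matrix.of fun k l : m => ∏ i ∈ s, (inner ℝ (x k i) (x l i) : ℝ)) := by
        ext k l
        simp [Matrix.gram, Matrix.hadamard, Finset.prod_insert hi]
      rw [he]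
      exact h
  exact key Finset.univ

theorem form_self_nonneg (z : AlgTensorPower ι H) : 0 ≤ form ι H z z := by
  obtain ⟨c, rfl⟩ := exists_eq_sum z
  have h := (posSemidef_prod_gram (fun x : c.support => (x : ι → H))).dotProduct_mulVec_nonneg
    (fun x => c x)
  simp only [Finsupp.sum, map_sum, map_smul, LinearMap.sum_apply, LinearMap.smul_apply, form_tprod]
  rw [← Finset.sum_coe_sort c.support]
  refine h.trans_eq ?_
  simp only [dotProduct, Matrix.mulVec, Matrix.of_apply, Pi.star_apply, star_trivial]
  refine Finset.sum_congr rfl fun x _ => ?_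
  rw [← Finset.sum_coe_sort c.support, smul_eq_mul, Finset.mul_sum, Finset.mul_sum]
  refine Finset.sum_congr rfl fun y _ => ?_
  simp only [smul_eq_mul]
  rw [Finset.prod_congr rfl fun i _ => real_inner_comm ((y : ι → H) i) ((x : ι → H) i)]
  ring

/-- The inner product `⟪⨂ i, x i, ⨂ i, y i⟫ = ∏ i, ⟪x i, y i⟫` on the algebraic tensor power. -/
abbrev core (ι H : Type*) [Fintype ι] [NormedAddCommGroup H] [InnerProductSpace ℝ H] :
    PreInnerProductSpace.Core ℝ (AlgTensorPower ι H) where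
  inner z z' := form ι H z z'
  conj_inner_symm z z' := form_symm z' z
  re_inner_nonneg z := form_self_nonneg z
  add_left z z' y := by simp
  smul_left z y r := by simp

instance : SeminormedAddCommGroup (AlgTensorPower ι H) :=
  @InnerProductSpace.Core.toSeminormedAddCommGroup ℝ _ _ _ _ (core ι H)

instance : InnerProductSpace ℝ (AlgTensorPower ι H) :=
  InnerProductSpace.ofCore (core ι H)

end AlgTensorPower

/-- The Hilbert tensor power `H^{⊗ι}`: the completion of the algebraic tensor power for the norm
of the inner product `⟪⨂ i, x i, ⨂ i, y i⟫ = ∏ i, ⟪x i, y i⟫`. -/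
abbrev HilbertTensorPower (ι : Type*) (H : Type*) [Fintype ι] [NormedAddCommGroup H]
    [InnerProductSpace ℝ H] : Type _ :=
  UniformSpace.Completion (AlgTensorPower ι H)

/-- The pure tensor `⨂ i, x i` in the Hilbert tensor power. -/
def HilbertTensorPower.pure {ι H : Type*} [Fintype ι] [NormedAddCommGroup H]
    [InnerProductSpace ℝ H] (x : ι → H) : HilbertTensorPower ι H :=
  ((AlgTensorPower.tprod ι H x : AlgTensorPower ι H) : UniformSpace.Completion (AlgTensorPower ι H))

theorem HilbertTensorPower.inner_pure {ι H : Type*} [Fintype ι] [NormedAddCommGroup H]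
    [InnerProductSpace ℝ H] (x y : ι → H) :
    inner ℝ (HilbertTensorPower.pure x) (HilbertTensorPower.pure y) = ∏ i, inner ℝ (x i) (y i) :=
  (UniformSpace.Completion.inner_coe (𝕜 := ℝ) _ _).trans (AlgTensorPower.form_tprod x y)

/-! ### Oriented graphs, oriented trees and homomorphism densities -/

/-- An oriented simple graph on the vertex set `V`: a set of directed edges which never contains
both `(i, j)` and `(j, i)`; in particular there are no loops. -/
structure OrientedGraph (V : Type*) where
  /-- The set of directed edges. -/
  edges : Finset (V × V)
  asymm : ∀ i j : V, (i, j) ∈ edges → (j, i) ∉ edges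

namespace OrientedGraph

variable {V : Type*}

/-- The underlying undirected graph. -/
def toSimpleGraph (F : OrientedGraph V) : SimpleGraph V where
  Adj i j := (i, j) ∈ F.edges ∨ (j, i) ∈ F.edges
  symm := ⟨fun _ _ h => h.symm⟩
  loopless := ⟨fun i h => h.elim (fun h' => F.asymm i i h' h') (fun h' => F.asymm i i h' h')⟩

/-- An oriented tree: the underlying undirected graph is connected and has no cycles. -/
def IsTree (F : OrientedGraph V) : Prop :=
  F.toSimpleGraph.IsTree

/-- The tensorized homomorphism density
`t(F, w) = ∫ ⨂_{(i,j) ∈ e(F)} w(ξ_i, ξ_j) ∏_{i ∈ v(F)} dξ_i ∈ H^{⊗ e(F)}`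
of an `H`-valued kernel `w` on a probability space. -/
def homDensity [Fintype V] {α : Type*} [MeasurableSpace α] {H : Type*} [NormedAddCommGroup H]
    [InnerProductSpace ℝ H] (F : OrientedGraph V) (μ : Measure α) (w : α × α → H) :
    HilbertTensorPower F.edges H :=
  ∫ ξ : V → α, HilbertTensorPower.pure (fun e : F.edges => w (ξ e.1.1, ξ e.1.2))
    ∂(Measure.pi fun _ : V => μ)

end OrientedGraph

/-! ### Cut norm and coupling distance -/

section Coupling

variable {α β δ : Type*} [MeasurableSpace α] [MeasurableSpace β] [MeasurableSpace δ]
  {H : Type*} [NormedAddCommGroup H] [InnerProductSpace ℝ H]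

/-- The cut norm of an `H`-valued kernel `w` on `α × β`: the supremum of
`⟪e, ∫_{S × T} w⟫` over `e` in the closed unit ball of `H` and measurable `S ⊆ α`, `T ⊆ β`.
(It is nonnegative, because `S = ∅` is allowed.) -/
def cutNorm (μ : Measure α) (ν : Measure β) (w : α × β → H) : ℝ≥0∞ :=
  ⨆ (e : H) (_ : ‖e‖ ≤ 1) (S : Set α) (_ : MeasurableSet S) (T : Set β) (_ : MeasurableSet T),
    ENNReal.ofReal (inner ℝ e (∫ p in S ×ˢ T, w p ∂(μ.prod ν)))

/-- The couplings of `μ` and `ν`: probability measures on `α × β` with marginals `μ` and `ν`. -/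
def couplings (μ : Measure α) (ν : Measure β) : Set (ProbabilityMeasure (α × β)) :=
  {γ | (γ : Measure (α × β)).map Prod.fst = μ ∧ (γ : Measure (α × β)).map Prod.snd = ν}

/-- The transpose `γᵀ` of a probability measure on `α × β`. -/
def transposeMeasure (γ : ProbabilityMeasure (α × β)) : ProbabilityMeasure (β × α) :=
  γ.map measurable_swap.aemeasurable

/-- The composition `(γ w)(x, y) = ∫ γ(x, z) w(z, y) dz` of a measure `γ` on `α × β` with a kernel
`w` on `β × δ`. Here `γ(x, z) dz` is the conditional law of the second coordinate under `γ`, given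
that the first one is `x`. -/
def couplingMulKernel [StandardBorelSpace β] [Nonempty β] (γ : ProbabilityMeasure (α × β))
    (w : β × δ → H) : α × δ → H :=
  fun p => ∫ z, w (z, p.2) ∂((γ : Measure (α × β)).condKernel p.1)

/-- The composition `(w γ)(x, y) = ∫ w(x, z) γ(z, y) dz` of a kernel `w` on `δ × α` with a measure
`γ` on `α × β`. Here `γ(z, y) dz` is the conditional law of the first coordinate under `γ`, given
that the second one is `y`. -/
def kernelMulCoupling [StandardBorelSpace α] [Nonempty α] (w : δ × α → H)
    (γ : ProbabilityMeasure (α × β)) : δ × β → H :=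
  fun p => ∫ z, w (p.1, z) ∂((transposeMeasure γ : Measure (β × α)).condKernel p.2)

/-- The coupling distance
`inf_γ (‖w₁ γ - γ w₂‖_□ + ‖γᵀ w₁ - w₂ γᵀ‖_□)`
of two `H`-valued kernels, with the infimum over all couplings `γ` of `μ` and `ν`. -/
def couplingDist [StandardBorelSpace α] [Nonempty α] [StandardBorelSpace β] [Nonempty β]
    (μ : Measure α) (ν : Measure β) (w₁ : α × α → H) (w₂ : β × β → H) : ℝ≥0∞ :=
  ⨅ γ ∈ couplings μ ν,
    (cutNorm μ ν (kernelMulCoupling w₁ γ - couplingMulKernel γ w₂) +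
      cutNorm ν μ (couplingMulKernel (transposeMeasure γ) w₁ -
        kernelMulCoupling w₂ (transposeMeasure γ)))

end Coupling

end

/-! Compactness of the embedding puts all values into one compact set of `H`. Finitely many
orthonormal directions then describe the kernels up to a uniform error, and both implications become
statements about finitely many scalar kernels u = ⟨e, w⟩. For these, the coupling distance controls
the `defect`, which measures how far a coupling γ is from intertwining the operators of two kernels
and of their transposes.

From distance to densities. Call f₁ and f₂ close if ∫ |f₁(x) - f₂(y)| dγ is small. Closeness
survives products of bounded functions, and it survives the kernel operators: expand the square of
u₁f₁ - u₂f₂ in L²(γ), move one operator of each diagonal term to its adjoint, and rewrite the cross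
term by the two defects (`integral_sq_kernelOp_sub_le`). This is where both orientations in the
distance are needed. A tree density is computed by integrating out leaves, each of which multiplies
the weight of its neighbour by a function obtained from a kernel operator, so scalar densities
converge (`tendsto_weightedDensity`). Multilinear expansion in the chosen directions gives the
tensor-valued densities.

From densities to distance. Adjoin the limit as an index a, and consider families of functions,
indexed by n, which near a are approximated in mean by a fixed linear combination of rooted tree
functions (`TreeApprox`). Rooted trees can be glued at the root and extended by a new root, so these
families form an algebra stable under the kernel operators. Weierstrass approximation adds
continuous functions of them, and then indicators of superlevel sets at levels without mass. Their
integrals are continuous at a, because the integral of a rooted tree function is a tensor density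
paired with a pure tensor. Hence finitely many such families can be discretized by labels whose
cells have converging measures (`TreeApprox.exists_label`).

Next, each kernel v is split as s + (v - s), with s of finite rank, built from such families, and
almost minimizing the L² distance to v at a. Near minimality makes v - s small at a as a bilinear
form on approximable functions (`exists_stepKernels_near`). For functions of the label this
smallness passes to n near a, since finitely many integrals decide it
(`eventually_integral_sq_kernelOp_label_le`). Finally, couple n with a by a measure whose density is
constant on products of cells and which mostly matches equal labels (`exists_block_coupling`). The
part s has small defect because its factors are nearly determined by the label
(`stepKernels_defect_le`). The part v - s has small defect because such a coupling turns every test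
function into a function of the label (`abs_defect_le_of_block`); v - s itself need not be small as
a kernel. -/

set_option linter.unusedSectionVars false

noncomputable section

/-! ### Bounded measurable functions and integral operators -/

section Bounded

variable {α β δ : Type*} [MeasurableSpace α] [MeasurableSpace β] [MeasurableSpace δ]

/-- A bounded measurable real function. -/
structure BddMeas (f : α → ℝ) : Prop where
  meas : Measurable f
  bdd : ∃ M, ∀ x, |f x| ≤ M

namespace BddMeas

variable {f g : α → ℝ}

theorem exists_nonneg (hf : BddMeas f) : ∃ M, 0 ≤ M ∧ ∀ x, |f x| ≤ M := by
  obtain ⟨M, hM⟩ := hf.bdd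
  exact ⟨max M 0, le_max_right _ _, fun x => (hM x).trans (le_max_left _ _)⟩

theorem const (c : ℝ) : BddMeas (fun _ : α => c) := ⟨measurable_const, |c|, fun _ => le_rfl⟩

theorem comp (hf : BddMeas f) {k : β → α} (hk : Measurable k) : BddMeas (fun x => f (k x)) :=
  ⟨hf.meas.comp hk, hf.bdd.imp fun _ h x => h (k x)⟩

theorem add (hf : BddMeas f) (hg : BddMeas g) : BddMeas (fun x => f x + g x) := by
  obtain ⟨M, hM⟩ := hf.bdd
  obtain ⟨N, hN⟩ := hg.bdd
  exact ⟨hf.meas.add hg.meas, M + N, fun x => (abs_add_le _ _).trans (add_le_add (hM x) (hN x))⟩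

theorem sub (hf : BddMeas f) (hg : BddMeas g) : BddMeas (fun x => f x - g x) := by
  obtain ⟨M, hM⟩ := hf.bdd
  obtain ⟨N, hN⟩ := hg.bdd
  exact ⟨hf.meas.sub hg.meas, M + N, fun x => (abs_sub _ _).trans (add_le_add (hM x) (hN x))⟩

theorem mul (hf : BddMeas f) (hg : BddMeas g) : BddMeas (fun x => f x * g x) := by
  obtain ⟨M, hM0, hM⟩ := hf.exists_nonneg
  obtain ⟨N, hN0, hN⟩ := hg.exists_nonneg
  exact ⟨hf.meas.mul hg.meas, M * N, fun x => by
    rw [abs_mul]; exact mul_le_mul (hM x) (hN x) (abs_nonneg _) hM0⟩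

theorem abs (hf : BddMeas f) : BddMeas (fun x => |f x|) :=
  ⟨hf.meas.abs, hf.bdd.imp fun _ h x => by rw [abs_abs]; exact h x⟩

theorem sum {ι : Type*} (s : Finset ι) {F : ι → α → ℝ} (h : ∀ i ∈ s, BddMeas (F i)) :
    BddMeas (fun x => ∑ i ∈ s, F i x) := by
  classical
  induction s using Finset.induction_on with
  | empty => simpa using const 0
  | insert i s hi ih =>
    simp only [Finset.sum_insert hi]
    exact (h i (Finset.mem_insert_self i s)).add (ih fun k hk => h k (Finset.mem_insert_of_mem hk))

theorem prod {ι : Type*} (s : Finset ι) {F : ι → α → ℝ} (h : ∀ i ∈ s, BddMeas (F i)) :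
    BddMeas (fun x => ∏ i ∈ s, F i x) := by
  classical
  induction s using Finset.induction_on with
  | empty => simpa using const 1
  | insert i s hi ih =>
    simp only [Finset.prod_insert hi]
    exact (h i (Finset.mem_insert_self i s)).mul (ih fun k hk => h k (Finset.mem_insert_of_mem hk))

theorem indicator_one {S : Set α} (hS : MeasurableSet S) :
    BddMeas (S.indicator (fun _ => (1 : ℝ))) :=
  ⟨measurable_const.indicator hS, 1, fun x => by
    by_cases h : x ∈ S <;> simp [h]⟩

theorem integrable (hf : BddMeas f) (μ : Measure α) [IsFiniteMeasure μ] : Integrable f μ := by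
  obtain ⟨M, hM⟩ := hf.bdd
  exact Integrable.of_bound hf.meas.aestronglyMeasurable M (Eventually.of_forall hM)

end BddMeas

theorem abs_integral_le_of_abs_le {μ : Measure α} [IsProbabilityMeasure μ] {f : α → ℝ} {M : ℝ}
    (h : ∀ x, |f x| ≤ M) : |∫ x, f x ∂μ| ≤ M := by
  simpa using norm_integral_le_of_norm_le_const (μ := μ) (f := f) (Eventually.of_forall h)

theorem abs_indicator_one_le (S : Set α) (x : α) : |S.indicator (fun _ => (1 : ℝ)) x| ≤ 1 := by
  by_cases h : x ∈ S <;> simp [h]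

/-- The integral operator with kernel `u`. -/
def kernelOp (μ : Measure β) (u : α × β → ℝ) (f : β → ℝ) (x : α) : ℝ := ∫ y, u (x, y) * f y ∂μ

theorem abs_kernelOp_le {μ : Measure β} [IsProbabilityMeasure μ] {u : α × β → ℝ} {f : β → ℝ}
    {C M : ℝ} (hu : ∀ p, |u p| ≤ C) (hf : ∀ y, |f y| ≤ M) (x : α) :
    |kernelOp μ u f x| ≤ C * M := by
  refine abs_integral_le_of_abs_le fun y => ?_
  rw [abs_mul]
  exact mul_le_mul (hu _) (hf y) (abs_nonneg _) ((abs_nonneg _).trans (hu (x, y)))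

theorem measurable_kernelOp {μ : Measure β} [SFinite μ] {u : α × β → ℝ} {f : β → ℝ}
    (hu : Measurable u) (hf : Measurable f) : Measurable (kernelOp μ u f) := by
  have : Measurable (fun p : α × β => u p * f p.2) := hu.mul (hf.comp measurable_snd)
  exact this.stronglyMeasurable.integral_prod_right'.measurable

theorem BddMeas.kernelOp {μ : Measure β} [IsProbabilityMeasure μ] {u : α × β → ℝ} {f : β → ℝ}
    (hu : BddMeas u) (hf : BddMeas f) : BddMeas (kernelOp μ u f) := by
  obtain ⟨C, hC⟩ := hu.bdd
  obtain ⟨M, hM⟩ := hf.bdd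
  exact ⟨measurable_kernelOp hu.meas hf.meas, C * M, abs_kernelOp_le hC hM⟩

/-- Fubini: the operator of the transposed kernel is the adjoint. -/
theorem integral_mul_kernelOp {μ : Measure α} {ν : Measure β} [IsProbabilityMeasure μ]
    [IsProbabilityMeasure ν] {u : α × β → ℝ} {f : α → ℝ} {g : β → ℝ}
    (hu : BddMeas u) (hf : BddMeas f) (hg : BddMeas g) :
    ∫ x, f x * kernelOp ν u g x ∂μ = ∫ y, kernelOp μ (u ∘ Prod.swap) f y * g y ∂ν := by
  have h : BddMeas (fun p : α × β => f p.1 * (u p * g p.2)) :=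
    (hf.comp measurable_fst).mul (hu.mul (hg.comp measurable_snd))
  have := integral_integral_swap (f := fun x y => f x * (u (x, y) * g y))
    (h.integrable (μ.prod ν))
  simp only [_root_.kernelOp, ← integral_const_mul, ← integral_mul_const] at *
  rw [this]
  refine integral_congr_ae (Eventually.of_forall fun y => integral_congr_ae
    (Eventually.of_forall fun x => ?_))
  simp only [Function.comp, Prod.swap_prod_mk]
  ring

theorem kernelOp_add {μ : Measure β} [IsProbabilityMeasure μ] {u : α × β → ℝ} {f g : β → ℝ}
    (hu : BddMeas u) (hf : BddMeas f) (hg : BddMeas g) (x : α) :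
    kernelOp μ u (fun y => f y + g y) x = kernelOp μ u f x + kernelOp μ u g x := by
  have h1 : BddMeas (fun y => u (x, y)) := hu.comp measurable_prodMk_left
  simp only [_root_.kernelOp, mul_add]
  exact integral_add ((h1.mul hf).integrable μ) ((h1.mul hg).integrable μ)

theorem kernelOp_const_mul {μ : Measure β} (u : α × β → ℝ) (f : β → ℝ) (c : ℝ) (x : α) :
    kernelOp μ u (fun y => c * f y) x = c * kernelOp μ u f x := by
  simp only [_root_.kernelOp, ← integral_const_mul]
  exact integral_congr_ae (Eventually.of_forall fun y => by ring)

theorem kernelOp_kernel_sub {μ : Measure β} [IsProbabilityMeasure μ] {u v : α × β → ℝ} {f : β → ℝ}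
    (hu : BddMeas u) (hv : BddMeas v) (hf : BddMeas f) (x : α) :
    kernelOp μ (fun p => u p - v p) f x = kernelOp μ u f x - kernelOp μ v f x := by
  have h1 : BddMeas (fun y => u (x, y)) := hu.comp measurable_prodMk_left
  have h2 : BddMeas (fun y => v (x, y)) := hv.comp measurable_prodMk_left
  simp only [_root_.kernelOp, sub_mul]
  exact integral_sub ((h1.mul hf).integrable μ) ((h2.mul hf).integrable μ)

theorem kernelOp_kernel_add {μ : Measure β} [IsProbabilityMeasure μ] {u v : α × β → ℝ} {f : β → ℝ}
    (hu : BddMeas u) (hv : BddMeas v) (hf : BddMeas f) (x : α) :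
    kernelOp μ (fun p => u p + v p) f x = kernelOp μ u f x + kernelOp μ v f x := by
  have h1 : BddMeas (fun y => u (x, y)) := hu.comp measurable_prodMk_left
  have h2 : BddMeas (fun y => v (x, y)) := hv.comp measurable_prodMk_left
  simp only [_root_.kernelOp, add_mul]
  exact integral_add ((h1.mul hf).integrable μ) ((h2.mul hf).integrable μ)

theorem kernelOp_kernel_const_mul {μ : Measure β} (u : α × β → ℝ) (f : β → ℝ) (c : ℝ) (x : α) :
    kernelOp μ (fun p => c * u p) f x = c * kernelOp μ u f x := by
  simp only [_root_.kernelOp, ← integral_const_mul]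
  exact integral_congr_ae (Eventually.of_forall fun y => by ring)

theorem kernelOp_finset_sum {ι : Type*} (s : Finset ι) {μ : Measure β} [IsProbabilityMeasure μ]
    {u : α × β → ℝ} {F : ι → β → ℝ} (hu : BddMeas u) (hF : ∀ i, BddMeas (F i)) (x : α) :
    kernelOp μ u (fun y => ∑ i ∈ s, F i y) x = ∑ i ∈ s, kernelOp μ u (F i) x := by
  have h1 : BddMeas (fun y => u (x, y)) := hu.comp measurable_prodMk_left
  simp only [_root_.kernelOp, Finset.mul_sum]
  exact integral_finsetSum _ fun i _ => (h1.mul (hF i)).integrable μ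

/-! ### Integrals with respect to couplings -/

theorem integral_fst_of_map_eq {γ : Measure (α × β)} {μ : Measure α} (h : γ.map Prod.fst = μ)
    {f : α → ℝ} (hf : Measurable f) : ∫ p, f p.1 ∂γ = ∫ x, f x ∂μ := by
  rw [← h, integral_map measurable_fst.aemeasurable hf.aestronglyMeasurable]

theorem integral_snd_of_map_eq {γ : Measure (α × β)} {ν : Measure β} (h : γ.map Prod.snd = ν)
    {f : β → ℝ} (hf : Measurable f) : ∫ p, f p.2 ∂γ = ∫ x, f x ∂ν := by
  rw [← h, integral_map measurable_snd.aemeasurable hf.aestronglyMeasurable]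

/-- The bilinear form `(φ, ψ) ↦ ⟨φ, (u₁ γ - γ u₂) ψ⟩` of the commutation defect of a coupling. -/
def defect (μ : Measure α) (ν : Measure β) (γ : Measure (α × β)) (u₁ : α × α → ℝ)
    (u₂ : β × β → ℝ) (φ : α → ℝ) (ψ : β → ℝ) : ℝ :=
  ∫ p, (ψ p.2 * kernelOp μ (u₁ ∘ Prod.swap) φ p.1 - φ p.1 * kernelOp ν u₂ ψ p.2) ∂γ

end Bounded

/-! ### Disintegration of couplings and compositions with kernels -/

section Disintegration

variable {α β δ : Type*} [MeasurableSpace α] [MeasurableSpace β] [MeasurableSpace δ]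
  {H : Type*} [NormedAddCommGroup H] [InnerProductSpace ℝ H]

theorem transposeMeasure_coe (γ : ProbabilityMeasure (α × β)) :
    (transposeMeasure γ : Measure (β × α)) = (γ : Measure (α × β)).map Prod.swap := rfl

theorem transposeMeasure_mem_couplings {μ : Measure α} {ν : Measure β}
    {γ : ProbabilityMeasure (α × β)} (hγ : γ ∈ couplings μ ν) :
    transposeMeasure γ ∈ couplings ν μ := by
  constructor
  · rw [transposeMeasure_coe, Measure.map_map measurable_fst measurable_swap]
    exact hγ.2
  · rw [transposeMeasure_coe, Measure.map_map measurable_snd measurable_swap]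
    exact hγ.1

theorem integral_transposeMeasure (γ : ProbabilityMeasure (α × β)) (f : β × α → ℝ) :
    ∫ q, f q ∂(transposeMeasure γ : Measure (β × α)) = ∫ p, f p.swap ∂(γ : Measure (α × β)) := by
  rw [transposeMeasure_coe]
  exact integral_map_equiv (MeasurableEquiv.prodComm) f

variable [StandardBorelSpace β] [Nonempty β]

theorem stronglyMeasurable_couplingMulKernel (γ : ProbabilityMeasure (α × β)) {w : β × δ → H}
    (hw : StronglyMeasurable w) : StronglyMeasurable (couplingMulKernel γ w) := by
  have h : StronglyMeasurable (fun q : (α × δ) × β => w (q.2, q.1.2)) :=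
    hw.comp_measurable (measurable_snd.prodMk (measurable_snd.comp measurable_fst))
  exact h.integral_kernel_prod_right'
    (κ := ((γ : Measure (α × β)).condKernel).comap Prod.fst measurable_fst)

theorem norm_couplingMulKernel_le (γ : ProbabilityMeasure (α × β)) {w : β × δ → H} {C : ℝ}
    (hC : ∀ p, ‖w p‖ ≤ C) (p : α × δ) : ‖couplingMulKernel γ w p‖ ≤ C := by
  have h := norm_integral_le_of_norm_le_const (μ := (γ : Measure (α × β)).condKernel p.1)
    (f := fun z => w (z, p.2)) (Eventually.of_forall fun z => hC _)
  rwa [probReal_univ, mul_one] at h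

theorem inner_couplingMulKernel [CompleteSpace H] (γ : ProbabilityMeasure (α × β)) {w : β × δ → H}
    (hw : StronglyMeasurable w) {C : ℝ} (hC : ∀ p, ‖w p‖ ≤ C) (e : H) (p : α × δ) :
    inner ℝ e (couplingMulKernel γ w p) = couplingMulKernel γ (fun q => inner ℝ e (w q)) p := by
  refine (integral_inner ?_ e).symm
  exact Integrable.of_bound (hw.comp_measurable measurable_prodMk_right).aestronglyMeasurable C
    (Eventually.of_forall fun z => hC _)

/-- Disintegrate γ over its first coordinate and exchange the two inner integrals. The conditional
laws disappear, and later estimates only involve integrals against γ itself. -/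
theorem integral_mul_couplingMulKernel {μ : Measure α} {ρ : Measure δ} [IsProbabilityMeasure μ]
    [IsProbabilityMeasure ρ] {γ : ProbabilityMeasure (α × β)}
    (hγ : (γ : Measure (α × β)).map Prod.fst = μ) {v : β × δ → ℝ} {φ : α → ℝ} {ψ : δ → ℝ}
    (hv : BddMeas v) (hφ : BddMeas φ) (hψ : BddMeas ψ) :
    ∫ p, φ p.1 * ψ p.2 * couplingMulKernel γ v p ∂(μ.prod ρ) =
      ∫ q, φ q.1 * kernelOp ρ v ψ q.2 ∂(γ : Measure (α × β)) := by
  have hr : BddMeas (couplingMulKernel γ v) := by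
    obtain ⟨C, hC⟩ := hv.bdd
    exact ⟨(stronglyMeasurable_couplingMulKernel γ hv.meas.stronglyMeasurable).measurable, C,
      norm_couplingMulKernel_le γ (w := v) hC⟩
  have hdis : (γ : Measure (α × β)) = μ ⊗ₘ (γ : Measure (α × β)).condKernel := by
    conv_lhs => rw [← (γ : Measure (α × β)).disintegrate (γ : Measure (α × β)).condKernel]
    rw [Measure.fst, hγ]
  have h1 : BddMeas (fun q : α × β => φ q.1 * kernelOp ρ v ψ q.2) :=
    (hφ.comp measurable_fst).mul ((hv.kernelOp hψ).comp measurable_snd)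
  conv_rhs => rw [hdis]
  rw [Measure.integral_compProd (by rw [← hdis]; exact h1.integrable _),
    integral_prod _ ((((hφ.comp measurable_fst).mul (hψ.comp measurable_snd)).mul hr).integrable _)]
  refine integral_congr_ae (Eventually.of_forall fun x => ?_)
  simp only [mul_assoc, couplingMulKernel, kernelOp]
  rw [integral_const_mul, integral_const_mul]
  congr 1
  simp only [← integral_const_mul]
  rw [integral_integral_swap]
  · refine integral_congr_ae (Eventually.of_forall fun z => integral_congr_ae
      (Eventually.of_forall fun y => mul_comm _ _))
  · exact BddMeas.integrable ((hψ.comp measurable_fst).mul (hv.comp measurable_swap)) _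

end Disintegration

/-! ### The coupling distance in terms of the commutation defect -/

section CutNorm

variable {α β δ : Type*} [MeasurableSpace α] [MeasurableSpace β] [MeasurableSpace δ]
  {H : Type*} [NormedAddCommGroup H] [InnerProductSpace ℝ H]
  {μ : Measure α} {ν : Measure β} [IsProbabilityMeasure μ] [IsProbabilityMeasure ν]

theorem couplingMulKernel_bddMeas [StandardBorelSpace β] [Nonempty β]
    (γ : ProbabilityMeasure (α × β)) {v : β × δ → ℝ} (hv : BddMeas v) :
    BddMeas (couplingMulKernel γ v) := by
  obtain ⟨C, hC⟩ := hv.bdd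
  exact ⟨(stronglyMeasurable_couplingMulKernel γ hv.meas.stronglyMeasurable).measurable, C,
    norm_couplingMulKernel_le γ (w := v) hC⟩

/-- Up to exchanging arguments, `kernelMulCoupling` is `couplingMulKernel` for the transposed
coupling and the transposed kernel, so every fact about it is inherited. -/
theorem kernelMulCoupling_bddMeas [StandardBorelSpace α] [Nonempty α]
    (γ : ProbabilityMeasure (α × β)) {v : δ × α → ℝ} (hv : BddMeas v) :
    BddMeas (kernelMulCoupling v γ) :=
  (couplingMulKernel_bddMeas (transposeMeasure γ) (hv.comp measurable_swap)).comp measurable_swap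

theorem stronglyMeasurable_kernelMulCoupling [StandardBorelSpace α] [Nonempty α]
    (γ : ProbabilityMeasure (α × β)) {w : δ × α → H} (hw : StronglyMeasurable w) :
    StronglyMeasurable (kernelMulCoupling w γ) :=
  (stronglyMeasurable_couplingMulKernel (transposeMeasure γ)
    (hw.comp_measurable measurable_swap)).comp_measurable measurable_swap

variable [StandardBorelSpace α] [Nonempty α] [StandardBorelSpace β] [Nonempty β]

/-- Each composition is unfolded by disintegration, the left one along the transposed coupling; the
kernel operators then act on the test functions. This is the bridge between cut norms and defects.
-/
theorem integral_mul_eq_defect {γ : ProbabilityMeasure (α × β)} (hγ : γ ∈ couplings μ ν)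
    {u₁ : α × α → ℝ} {u₂ : β × β → ℝ} (h₁ : BddMeas u₁) (h₂ : BddMeas u₂)
    {φ : α → ℝ} {ψ : β → ℝ} (hφ : BddMeas φ) (hψ : BddMeas ψ) :
    ∫ p, φ p.1 * ψ p.2 * (kernelMulCoupling u₁ γ p - couplingMulKernel γ u₂ p) ∂(μ.prod ν) =
      defect μ ν γ u₁ u₂ φ ψ := by
  have hφψ : BddMeas (fun p : α × β => φ p.1 * ψ p.2) :=
    (hφ.comp measurable_fst).mul (hψ.comp measurable_snd)
  have e1 : ∫ p, φ p.1 * ψ p.2 * kernelMulCoupling u₁ γ p ∂(μ.prod ν) =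
      ∫ p, ψ p.2 * kernelOp μ (u₁ ∘ Prod.swap) φ p.1 ∂(γ : Measure (α × β)) := by
    have h := integral_mul_couplingMulKernel (ρ := μ) (transposeMeasure_mem_couplings hγ).1
      (h₁.comp measurable_swap) hψ hφ
    rw [integral_transposeMeasure] at h
    refine Eq.trans ?_ h
    rw [← Measure.prod_swap]
    rw [show Measure.map Prod.swap (ν.prod μ) =
      Measure.map (MeasurableEquiv.prodComm (α := β) (β := α)) (ν.prod μ) from rfl,
      integral_map_equiv]
    refine integral_congr_ae (Eventually.of_forall fun p => ?_)
    change φ p.2 * ψ p.1 * kernelMulCoupling u₁ γ p.swap = _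
    rw [mul_comm (φ _)]
    rfl
  have e2 := integral_mul_couplingMulKernel (ρ := ν) hγ.1 h₂ hφ hψ
  simp only [mul_sub, defect]
  rw [integral_sub ((hφψ.mul (kernelMulCoupling_bddMeas γ h₁)).integrable _)
    ((hφψ.mul (couplingMulKernel_bddMeas γ h₂)).integrable _), e1, e2, integral_sub]
  · exact BddMeas.integrable ((hψ.comp measurable_snd).mul
      (((h₁.comp measurable_swap).kernelOp hφ).comp measurable_fst)) _
  · exact BddMeas.integrable ((hφ.comp measurable_fst).mul
      ((h₂.kernelOp hψ).comp measurable_snd)) _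

/-- Transposition exchanges the two terms of the defect, whence the sign. It turns the second
summand of the coupling distance into a defect of transposed kernels under the same γ. -/
theorem defect_transposeMeasure (γ : ProbabilityMeasure (α × β))
    (u₁ : α × α → ℝ) (u₂ : β × β → ℝ) (φ : α → ℝ) (ψ : β → ℝ) :
    defect ν μ (transposeMeasure γ : Measure (β × α)) u₂ u₁ ψ φ =
      - defect μ ν γ (u₁ ∘ Prod.swap) (u₂ ∘ Prod.swap) φ ψ := by
  rw [defect, integral_transposeMeasure, defect, ← integral_neg]
  refine integral_congr_ae (Eventually.of_forall fun p => ?_)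
  simp only [Prod.fst_swap, Prod.snd_swap, Function.comp_assoc, Prod.swap_swap_eq,
    Function.comp_id]
  ring

theorem BddMeas.inner {w : δ → H} (hw : StronglyMeasurable w) {C : ℝ} (hC : ∀ p, ‖w p‖ ≤ C)
    (e : H) : BddMeas (fun p => inner ℝ e (w p) : δ → ℝ) :=
  ⟨(stronglyMeasurable_const.inner hw).measurable, ‖e‖ * C, fun p =>
    (abs_real_inner_le_norm _ _).trans (mul_le_mul_of_nonneg_left (hC p) (norm_nonneg _))⟩

theorem inner_setIntegral_eq_defect [CompleteSpace H] {γ : ProbabilityMeasure (α × β)}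
    (hγ : γ ∈ couplings μ ν) {w₁ : α × α → H} {w₂ : β × β → H} (h₁ : StronglyMeasurable w₁)
    (h₂ : StronglyMeasurable w₂) {C : ℝ} (hC₁ : ∀ p, ‖w₁ p‖ ≤ C) (hC₂ : ∀ p, ‖w₂ p‖ ≤ C) (e : H)
    {S : Set α} {T : Set β} (hS : MeasurableSet S) (hT : MeasurableSet T) :
    inner ℝ e (∫ p in S ×ˢ T, (kernelMulCoupling w₁ γ - couplingMulKernel γ w₂) p ∂(μ.prod ν)) =
      defect μ ν γ (fun p => inner ℝ e (w₁ p)) (fun p => inner ℝ e (w₂ p))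
        (S.indicator fun _ => 1) (T.indicator fun _ => 1) := by
  have hint : Integrable (kernelMulCoupling w₁ γ - couplingMulKernel γ w₂)
      ((μ.prod ν).restrict (S ×ˢ T)) := by
    refine Integrable.of_bound ((stronglyMeasurable_kernelMulCoupling γ h₁).sub
      (stronglyMeasurable_couplingMulKernel γ h₂)).aestronglyMeasurable (C + C)
      (Eventually.of_forall fun p => (norm_sub_le _ _).trans (add_le_add ?_ ?_))
    · exact norm_couplingMulKernel_le (transposeMeasure γ) (w := w₁ ∘ Prod.swap)
        (fun q => hC₁ _) p.swap
    · exact norm_couplingMulKernel_le γ hC₂ p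
  rw [← integral_mul_eq_defect hγ (BddMeas.inner h₁ hC₁ e) (BddMeas.inner h₂ hC₂ e)
    (BddMeas.indicator_one hS) (BddMeas.indicator_one hT), ← integral_inner hint,
    ← integral_indicator (hS.prod hT)]
  refine integral_congr_ae (Eventually.of_forall fun p => ?_)
  have hk : inner ℝ e (kernelMulCoupling w₁ γ p) =
      kernelMulCoupling (fun q => inner ℝ e (w₁ q)) γ p :=
    inner_couplingMulKernel (transposeMeasure γ) (h₁.comp_measurable measurable_swap)
      (fun q => hC₁ _) e p.swap
  have hk2 : inner ℝ e (couplingMulKernel γ w₂ p) =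
      couplingMulKernel γ (fun q => inner ℝ e (w₂ q)) p :=
    inner_couplingMulKernel γ h₂ hC₂ e p
  by_cases hs : p.1 ∈ S <;> by_cases ht : p.2 ∈ T <;>
    simp [Set.indicator, Set.mem_prod, hs, ht, inner_sub_right, hk, hk2]

theorem inner_setIntegral_transpose_eq_defect [CompleteSpace H] {γ : ProbabilityMeasure (α × β)}
    (hγ : γ ∈ couplings μ ν) {w₁ : α × α → H} {w₂ : β × β → H} (h₁ : StronglyMeasurable w₁)
    (h₂ : StronglyMeasurable w₂) {C : ℝ} (hC₁ : ∀ p, ‖w₁ p‖ ≤ C) (hC₂ : ∀ p, ‖w₂ p‖ ≤ C) (e : H)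
    {S : Set α} {T : Set β} (hS : MeasurableSet S) (hT : MeasurableSet T) :
    inner ℝ e (∫ p in T ×ˢ S, (couplingMulKernel (transposeMeasure γ) w₁ -
        kernelMulCoupling w₂ (transposeMeasure γ)) p ∂(ν.prod μ)) =
      defect μ ν γ ((fun p => inner ℝ e (w₁ p)) ∘ Prod.swap)
        ((fun p => inner ℝ e (w₂ p)) ∘ Prod.swap)
        (S.indicator fun _ => 1) (T.indicator fun _ => 1) := by
  have h := inner_setIntegral_eq_defect (transposeMeasure_mem_couplings hγ) h₂ h₁ hC₂ hC₁ e hT hS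
  rw [defect_transposeMeasure, ← neg_eq_iff_eq_neg] at h
  rw [← h, ← inner_neg_right, ← integral_neg]
  congr 2
  ext p
  simp

theorem cutNorm_le {w : α × β → H} {ε : ℝ}
    (h : ∀ e : H, ‖e‖ ≤ 1 → ∀ S, MeasurableSet S → ∀ T, MeasurableSet T →
      inner ℝ e (∫ p in S ×ˢ T, w p ∂(μ.prod ν)) ≤ ε) : cutNorm μ ν w ≤ ENNReal.ofReal ε :=
  iSup₂_le fun e he => iSup₂_le fun S hS => iSup₂_le fun T hT =>
    ENNReal.ofReal_le_ofReal (h e he S hS T hT)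

theorem abs_inner_setIntegral_le_of_cutNorm_le {w : α × β → H} {ε : ℝ} (hε : 0 ≤ ε)
    (h : cutNorm μ ν w ≤ ENNReal.ofReal ε) {e : H} (he : ‖e‖ ≤ 1) {S : Set α} {T : Set β}
    (hS : MeasurableSet S) (hT : MeasurableSet T) :
    |inner ℝ e (∫ p in S ×ˢ T, w p ∂(μ.prod ν))| ≤ ε := by
  have key : ∀ e : H, ‖e‖ ≤ 1 → inner ℝ e (∫ p in S ×ˢ T, w p ∂(μ.prod ν)) ≤ ε := by
    intro e he
    rw [← ENNReal.ofReal_le_ofReal_iff hε]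
    refine le_trans ?_ h
    exact le_iSup₂_of_le e he (le_iSup₂_of_le S hS (le_iSup₂_of_le T hT le_rfl))
  refine abs_le.2 ⟨?_, key e he⟩
  -- The cut norm has no absolute value, but the unit ball is symmetric.
  have := key (-e) (by rwa [norm_neg])
  rw [inner_neg_left] at this
  linarith

theorem couplingDist_le [CompleteSpace H] {γ : ProbabilityMeasure (α × β)}
    (hγ : γ ∈ couplings μ ν) {w₁ : α × α → H} {w₂ : β × β → H} (h₁ : StronglyMeasurable w₁)
    (h₂ : StronglyMeasurable w₂) {C : ℝ} (hC₁ : ∀ p, ‖w₁ p‖ ≤ C) (hC₂ : ∀ p, ‖w₂ p‖ ≤ C) {ε : ℝ}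
    (hε : 0 ≤ ε)
    (h : ∀ e : H, ‖e‖ ≤ 1 → ∀ S, MeasurableSet S → ∀ T, MeasurableSet T →
      defect μ ν γ (fun p => inner ℝ e (w₁ p)) (fun p => inner ℝ e (w₂ p))
        (S.indicator fun _ => 1) (T.indicator fun _ => 1) ≤ ε ∧
      defect μ ν γ ((fun p => inner ℝ e (w₁ p)) ∘ Prod.swap)
        ((fun p => inner ℝ e (w₂ p)) ∘ Prod.swap)
        (S.indicator fun _ => 1) (T.indicator fun _ => 1) ≤ ε) :
    couplingDist μ ν w₁ w₂ ≤ ENNReal.ofReal (ε + ε) := by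
  rw [ENNReal.ofReal_add hε hε]
  refine iInf₂_le_of_le γ hγ (add_le_add ?_ ?_)
  · refine cutNorm_le fun e he S hS T hT => ?_
    rw [inner_setIntegral_eq_defect hγ h₁ h₂ hC₁ hC₂ e hS hT]
    exact (h e he S hS T hT).1
  · refine cutNorm_le fun e he T hT S hS => ?_
    rw [inner_setIntegral_transpose_eq_defect hγ h₁ h₂ hC₁ hC₂ e hS hT]
    exact (h e he S hS T hT).2

theorem exists_coupling_of_couplingDist_lt [CompleteSpace H] {w₁ : α × α → H} {w₂ : β × β → H}
    (h₁ : StronglyMeasurable w₁) (h₂ : StronglyMeasurable w₂) {C : ℝ} (hC₁ : ∀ p, ‖w₁ p‖ ≤ C)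
    (hC₂ : ∀ p, ‖w₂ p‖ ≤ C) {ε : ℝ} (hε : 0 ≤ ε)
    (h : couplingDist μ ν w₁ w₂ < ENNReal.ofReal ε) :
    ∃ γ ∈ couplings μ ν, ∀ e : H, ‖e‖ ≤ 1 → ∀ S, MeasurableSet S → ∀ T, MeasurableSet T →
      |defect μ ν γ (fun p => inner ℝ e (w₁ p)) (fun p => inner ℝ e (w₂ p))
        (S.indicator fun _ => 1) (T.indicator fun _ => 1)| ≤ ε ∧
      |defect μ ν γ ((fun p => inner ℝ e (w₁ p)) ∘ Prod.swap)
        ((fun p => inner ℝ e (w₂ p)) ∘ Prod.swap)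
        (S.indicator fun _ => 1) (T.indicator fun _ => 1)| ≤ ε := by
  obtain ⟨γ, h⟩ := iInf_lt_iff.1 h
  obtain ⟨hγ, h⟩ := iInf_lt_iff.1 h
  refine ⟨γ, hγ, fun e he S hS T hT => ⟨?_, ?_⟩⟩
  · rw [← inner_setIntegral_eq_defect hγ h₁ h₂ hC₁ hC₂ e hS hT]
    exact abs_inner_setIntegral_le_of_cutNorm_le hε (le_self_add.trans h.le) he hS hT
  · rw [← inner_setIntegral_transpose_eq_defect hγ h₁ h₂ hC₁ hC₂ e hS hT]
    exact abs_inner_setIntegral_le_of_cutNorm_le hε (le_add_self.trans h.le) he hT hS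

/-! ### Modification on null sets -/

/-- For almost every y the section of the exceptional set is ν-null. Since ν is the second marginal
of γ, this section is also null for the conditional law at almost every x. -/
theorem couplingMulKernel_congr_ae {ρ : Measure δ} [IsProbabilityMeasure ρ]
    {γ : ProbabilityMeasure (α × β)} (hγ : γ ∈ couplings μ ν) {w w' : β × δ → H}
    (h : w =ᵐ[ν.prod ρ] w') :
    couplingMulKernel γ w =ᵐ[μ.prod ρ] couplingMulKernel γ w' := by
  obtain ⟨N, hN, hNm, hN0⟩ := exists_measurable_superset_of_null (ae_iff.1 h)
  have hdis : (γ : Measure (α × β)) = μ ⊗ₘ (γ : Measure (α × β)).condKernel := by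
    conv_lhs => rw [← (γ : Measure (α × β)).disintegrate (γ : Measure (α × β)).condKernel]
    rw [Measure.fst, hγ.1]
  have hf : Measurable (fun q : δ × β => N.indicator (fun _ => (1 : ℝ≥0∞)) (q.2, q.1)) :=
    (measurable_const.indicator hNm).comp measurable_swap
  have hzero : ∀ᵐ y ∂ρ, ∀ᵐ x ∂μ, ∀ᵐ z ∂(γ : Measure (α × β)).condKernel x, (z, y) ∉ N := by
    have h1 : ∀ᵐ q ∂(ρ.prod ν), q.swap ∉ N := by
      have : ∀ᵐ q ∂(ν.prod ρ), q ∉ N := measure_eq_zero_iff_ae_notMem.1 hN0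
      rw [← Measure.prod_swap] at this
      exact ae_of_ae_map measurable_swap.aemeasurable this
    filter_upwards [Measure.ae_ae_of_ae_prod h1] with y hy
    rw [← hγ.2] at hy
    have h2 := ae_of_ae_map measurable_snd.aemeasurable hy
    rw [hdis] at h2
    exact Measure.ae_ae_of_ae_compProd h2
  -- Measurability is needed to turn "for a.e. y, for a.e. x" into a statement about the product
  -- measure.
  have hms : MeasurableSet {p : δ × α |
      ∀ᵐ z ∂(γ : Measure (α × β)).condKernel p.2, (z, p.1) ∉ N} := by
    have hker : Measurable (fun p : δ × α =>
        ((γ : Measure (α × β)).condKernel.comap Prod.snd measurable_snd : Kernel (δ × α) β) p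
          (Prod.mk p ⁻¹' {q : (δ × α) × β | (q.2, q.1.1) ∈ N})) :=
      Kernel.measurable_kernel_prodMk_left
        (((measurable_snd).prodMk (measurable_fst.comp measurable_fst)) hNm)
    have := hker (measurableSet_singleton 0)
    convert this using 1
    ext p
    simp only [Set.mem_ofPred_eq, Set.mem_preimage, Set.mem_singleton_iff, Kernel.comap_apply]
    rw [ae_iff]
    simp only [not_not]
    rfl
  have h3 : ∀ᵐ p ∂(ρ.prod μ), ∀ᵐ z ∂(γ : Measure (α × β)).condKernel p.2, (z, p.1) ∉ N :=
    (Measure.ae_prod_iff_ae_ae hms).2 hzero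
  rw [← Measure.prod_swap] at h3
  have h4 := ae_of_ae_map measurable_swap.aemeasurable h3
  filter_upwards [h4] with p hp
  refine integral_congr_ae ?_
  filter_upwards [hp] with z hz
  by_contra hne
  exact hz (hN hne)

theorem kernelMulCoupling_congr_ae {ρ : Measure δ} [IsProbabilityMeasure ρ]
    {γ : ProbabilityMeasure (α × β)} (hγ : γ ∈ couplings μ ν) {w w' : δ × α → H}
    (h : w =ᵐ[ρ.prod μ] w') :
    kernelMulCoupling w γ =ᵐ[ρ.prod ν] kernelMulCoupling w' γ := by
  have h1 : (w ∘ Prod.swap) =ᵐ[μ.prod ρ] (w' ∘ Prod.swap) := by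
    rw [← Measure.prod_swap] at h
    exact ae_of_ae_map measurable_swap.aemeasurable h
  have h2 := couplingMulKernel_congr_ae (transposeMeasure_mem_couplings hγ) h1
  rw [← Measure.prod_swap] at h2
  exact ae_of_ae_map measurable_swap.aemeasurable h2

theorem cutNorm_congr_ae {w w' : α × β → H} (h : w =ᵐ[μ.prod ν] w') :
    cutNorm μ ν w = cutNorm μ ν w' := by
  unfold cutNorm
  have : ∀ (S : Set α) (T : Set β), ∫ p in S ×ˢ T, w p ∂(μ.prod ν) =
      ∫ p in S ×ˢ T, w' p ∂(μ.prod ν) := fun S T => integral_congr_ae (ae_restrict_of_ae h)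
  simp only [this]

theorem couplingDist_congr_ae {w₁ w₁' : α × α → H} {w₂ w₂' : β × β → H}
    (h₁ : w₁ =ᵐ[μ.prod μ] w₁') (h₂ : w₂ =ᵐ[ν.prod ν] w₂') :
    couplingDist μ ν w₁ w₂ = couplingDist μ ν w₁' w₂' := by
  unfold couplingDist
  refine iInf_congr fun γ => iInf_congr fun hγ => ?_
  have hγ' := transposeMeasure_mem_couplings hγ
  rw [cutNorm_congr_ae ((kernelMulCoupling_congr_ae hγ h₁).sub (couplingMulKernel_congr_ae hγ h₂)),
    cutNorm_congr_ae
      ((couplingMulKernel_congr_ae hγ' h₁).sub (kernelMulCoupling_congr_ae hγ' h₂))]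

end CutNorm

/-! ### From measurable sets to bounded functions -/

section Functions

variable {α β : Type*} [MeasurableSpace α] [MeasurableSpace β]
  {μ : Measure α} {ν : Measure β} [IsProbabilityMeasure μ] [IsProbabilityMeasure ν]

/-- Testing with the set where θ is nonnegative and with its complement bounds the L¹ norm of θ by
2ε. -/
theorem abs_integral_mul_le_of_sets {θ φ : α → ℝ} (hθ : BddMeas θ) (hφ : BddMeas φ) {M ε : ℝ}
    (hM : ∀ x, |φ x| ≤ M)
    (h : ∀ S, MeasurableSet S → |∫ x, S.indicator (fun _ => 1) x * θ x ∂μ| ≤ ε) :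
    |∫ x, φ x * θ x ∂μ| ≤ 2 * M * ε := by
  have hS : MeasurableSet {x | 0 ≤ θ x} := measurableSet_le measurable_const hθ.meas
  have hM0 : 0 ≤ M := by
    obtain ⟨x⟩ := Measure.nonempty_of_neZero μ
    exact (abs_nonneg _).trans (hM x)
  set S := {x | 0 ≤ θ x}
  have i1 := (BddMeas.indicator_one hS).mul hθ
  have i2 := (BddMeas.indicator_one hS.compl).mul hθ
  have habs : ∀ x, |θ x| = S.indicator (fun _ => 1) x * θ x -
      Sᶜ.indicator (fun _ => 1) x * θ x := by
    intro x
    by_cases hx : 0 ≤ θ x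
    · have : x ∈ S := hx
      simp [this, abs_of_nonneg hx]
    · have : x ∉ S := hx
      simp [this, abs_of_neg (not_le.1 hx)]
  have h1 : ∫ x, |θ x| ∂μ ≤ 2 * ε := by
    simp only [habs]
    rw [integral_sub (i1.integrable μ) (i2.integrable μ)]
    linarith [abs_le.1 (h S hS), abs_le.1 (h Sᶜ hS.compl)]
  calc |∫ x, φ x * θ x ∂μ| ≤ ∫ x, |φ x * θ x| ∂μ := abs_integral_le_integral_abs
    _ ≤ ∫ x, M * |θ x| ∂μ := by
        refine integral_mono ((hφ.mul hθ).abs.integrable μ)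
          (((BddMeas.const M).mul hθ.abs).integrable μ) fun x => ?_
        simp only [abs_mul]
        exact mul_le_mul_of_nonneg_right (hM x) (abs_nonneg _)
    _ = M * ∫ x, |θ x| ∂μ := integral_const_mul _ _
    _ ≤ M * (2 * ε) := mul_le_mul_of_nonneg_left h1 hM0
    _ = 2 * M * ε := by ring

theorem integral_prod_mul_mul_eq {r : α × β → ℝ} (hr : BddMeas r) {φ : α → ℝ} {ψ : β → ℝ}
    (hφ : BddMeas φ) (hψ : BddMeas ψ) :
    ∫ p, φ p.1 * ψ p.2 * r p ∂(μ.prod ν) = ∫ x, φ x * kernelOp ν r ψ x ∂μ := by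
  rw [integral_prod _ (((((hφ.comp measurable_fst).mul (hψ.comp measurable_snd)).mul hr)).integrable _)]
  refine integral_congr_ae (Eventually.of_forall fun x => ?_)
  simp only [kernelOp, ← integral_const_mul]
  exact integral_congr_ae (Eventually.of_forall fun y => by ring)

/-- Sets are replaced by functions in one variable at a time, at the cost of a factor 2 for each. -/
theorem abs_integral_mul_mul_le_of_sets {r : α × β → ℝ} (hr : BddMeas r) {ε : ℝ}
    (h : ∀ S, MeasurableSet S → ∀ T, MeasurableSet T →
      |∫ p, S.indicator (fun _ => 1) p.1 * T.indicator (fun _ => 1) p.2 * r p ∂(μ.prod ν)| ≤ ε)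
    {φ : α → ℝ} {ψ : β → ℝ} (hφ : BddMeas φ) (hψ : BddMeas ψ) {M N : ℝ} (hM : ∀ x, |φ x| ≤ M)
    (hN : ∀ y, |ψ y| ≤ N) :
    |∫ p, φ p.1 * ψ p.2 * r p ∂(μ.prod ν)| ≤ 4 * M * N * ε := by
  have hrs : BddMeas (r ∘ Prod.swap) := hr.comp measurable_swap
  rw [integral_prod_mul_mul_eq hr hφ hψ, integral_mul_kernelOp hr hφ hψ]
  simp only [mul_comm (kernelOp μ (r ∘ Prod.swap) φ _)]
  have : 4 * M * N * ε = 2 * N * (2 * M * ε) := by ring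
  rw [this]
  refine abs_integral_mul_le_of_sets (hrs.kernelOp hφ) hψ hN fun T hT => ?_
  have hT' := BddMeas.indicator_one hT
  simp only [mul_comm (T.indicator _ _)]
  rw [← integral_mul_kernelOp hr hφ hT']
  refine abs_integral_mul_le_of_sets (hr.kernelOp hT') hφ hM fun S hS => ?_
  rw [← integral_prod_mul_mul_eq hr (BddMeas.indicator_one hS) hT']
  exact h S hS T hT

/-- The variance of |h| is nonnegative. -/
theorem integral_abs_sq_le {γ : Measure α} [IsProbabilityMeasure γ] {h : α → ℝ} (hh : BddMeas h) :
    (∫ x, |h x| ∂γ) ^ 2 ≤ ∫ x, h x ^ 2 ∂γ := by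
  set m := ∫ x, |h x| ∂γ with hm
  have hsq : BddMeas (fun x => h x ^ 2) := by simpa only [sq] using hh.mul hh
  have h0 : 0 ≤ ∫ x, (|h x| - m) ^ 2 ∂γ := integral_nonneg fun x => sq_nonneg _
  have : ∫ x, (|h x| - m) ^ 2 ∂γ = ∫ x, h x ^ 2 ∂γ - m ^ 2 := by
    calc ∫ x, (|h x| - m) ^ 2 ∂γ = ∫ x, (h x ^ 2 - (2 * m * |h x| - m ^ 2)) ∂γ := by
          refine integral_congr_ae (Eventually.of_forall fun x => ?_)
          change (|h x| - m) ^ 2 = h x ^ 2 - (2 * m * |h x| - m ^ 2)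
          rw [← sq_abs (h x)]
          ring
      _ = _ := by
          rw [integral_sub (hsq.integrable _)
            ((((BddMeas.const _).mul hh.abs).sub (BddMeas.const _)).integrable _),
            integral_sub (((BddMeas.const _).mul hh.abs).integrable _)
              ((BddMeas.const _).integrable _), integral_const_mul, ← hm]
          simp
          ring
  linarith

variable [StandardBorelSpace α] [Nonempty α] [StandardBorelSpace β] [Nonempty β]

theorem abs_defect_le_of_sets {γ : ProbabilityMeasure (α × β)} (hγ : γ ∈ couplings μ ν)
    {u₁ : α × α → ℝ} {u₂ : β × β → ℝ} (h₁ : BddMeas u₁) (h₂ : BddMeas u₂) {ε : ℝ}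
    (h : ∀ S, MeasurableSet S → ∀ T, MeasurableSet T →
      |defect μ ν γ u₁ u₂ (S.indicator fun _ => 1) (T.indicator fun _ => 1)| ≤ ε)
    {φ : α → ℝ} {ψ : β → ℝ} (hφ : BddMeas φ) (hψ : BddMeas ψ) {M N : ℝ} (hM : ∀ x, |φ x| ≤ M)
    (hN : ∀ y, |ψ y| ≤ N) : |defect μ ν γ u₁ u₂ φ ψ| ≤ 4 * M * N * ε := by
  rw [← integral_mul_eq_defect hγ h₁ h₂ hφ hψ]
  refine abs_integral_mul_mul_le_of_sets
    ((kernelMulCoupling_bddMeas γ h₁).sub (couplingMulKernel_bddMeas γ h₂)) (fun S hS T hT => ?_)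
    hφ hψ hM hN
  rw [integral_mul_eq_defect hγ h₁ h₂ (BddMeas.indicator_one hS) (BddMeas.indicator_one hT)]
  exact h S hS T hT

/-- Write g = u f and k = uᵀ g on each side. By adjunction the diagonal terms of the square are ⟨f₁,
k₁⟩ and ⟨f₂, k₂⟩. The defect tested with (g₁, f₂) replaces the cross term ⟨g₁, g₂⟩ by ⟨f₂, k₁⟩, and
the transposed defect tested with (f₁, g₂) replaces it by ⟨f₁, k₂⟩. What is left is f₁ - f₂ paired
with the bounded functions k₁ and k₂. -/
theorem integral_sq_kernelOp_sub_le {γ : ProbabilityMeasure (α × β)} (hγ : γ ∈ couplings μ ν)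
    {u₁ : α × α → ℝ} {u₂ : β × β → ℝ} (h₁ : Measurable u₁) (h₂ : Measurable u₂) {C : ℝ}
    (hC₁ : ∀ p, |u₁ p| ≤ C) (hC₂ : ∀ p, |u₂ p| ≤ C) {ε : ℝ}
    (h : ∀ S, MeasurableSet S → ∀ T, MeasurableSet T →
      |defect μ ν γ u₁ u₂ (S.indicator fun _ => 1) (T.indicator fun _ => 1)| ≤ ε ∧
      |defect μ ν γ (u₁ ∘ Prod.swap) (u₂ ∘ Prod.swap)
        (S.indicator fun _ => 1) (T.indicator fun _ => 1)| ≤ ε)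
    {f₁ : α → ℝ} {f₂ : β → ℝ} (hf₁ : Measurable f₁) (hf₂ : Measurable f₂) {M : ℝ}
    (hM₁ : ∀ x, |f₁ x| ≤ M) (hM₂ : ∀ y, |f₂ y| ≤ M) :
    ∫ p, (kernelOp μ u₁ f₁ p.1 - kernelOp ν u₂ f₂ p.2) ^ 2 ∂(γ : Measure (α × β)) ≤
      8 * C * M ^ 2 * ε +
        2 * (C * (C * M)) * ∫ p, |f₁ p.1 - f₂ p.2| ∂(γ : Measure (α × β)) := by
  have bu₁ : BddMeas u₁ := ⟨h₁, C, hC₁⟩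
  have bu₂ : BddMeas u₂ := ⟨h₂, C, hC₂⟩
  have bf₁ : BddMeas f₁ := ⟨hf₁, M, hM₁⟩
  have bf₂ : BddMeas f₂ := ⟨hf₂, M, hM₂⟩
  have bs₁ : BddMeas (u₁ ∘ Prod.swap) := bu₁.comp measurable_swap
  have bs₂ : BddMeas (u₂ ∘ Prod.swap) := bu₂.comp measurable_swap
  set g₁ := kernelOp μ u₁ f₁ with hg₁
  set g₂ := kernelOp ν u₂ f₂ with hg₂
  have bg₁ : BddMeas g₁ := bu₁.kernelOp bf₁
  have bg₂ : BddMeas g₂ := bu₂.kernelOp bf₂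
  have mg₁ : ∀ x, |g₁ x| ≤ C * M := abs_kernelOp_le hC₁ hM₁
  have mg₂ : ∀ x, |g₂ x| ≤ C * M := abs_kernelOp_le hC₂ hM₂
  set k₁ := kernelOp μ (u₁ ∘ Prod.swap) g₁ with hk₁
  set k₂ := kernelOp ν (u₂ ∘ Prod.swap) g₂ with hk₂
  have bk₁ : BddMeas k₁ := bs₁.kernelOp bg₁
  have bk₂ : BddMeas k₂ := bs₂.kernelOp bg₂
  have mk₁ : ∀ x, |k₁ x| ≤ C * (C * M) := abs_kernelOp_le (fun p => hC₁ _) mg₁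
  have mk₂ : ∀ x, |k₂ x| ≤ C * (C * M) := abs_kernelOp_le (fun p => hC₂ _) mg₂
  have d₁ := abs_defect_le_of_sets hγ bu₁ bu₂ (fun S hS T hT => (h S hS T hT).1) bg₁ bf₂ mg₁ hM₂
  have d₂ := abs_defect_le_of_sets hγ bs₁ bs₂ (fun S hS T hT => (h S hS T hT).2) bf₁ bg₂ hM₁ mg₂
  have X {f : α → ℝ} (hf : BddMeas f) : BddMeas (fun p : α × β => f p.1) := hf.comp measurable_fst
  have Y {f : β → ℝ} (hf : BddMeas f) : BddMeas (fun p : α × β => f p.2) := hf.comp measurable_snd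
  have int {f : α × β → ℝ} (hf : BddMeas f) : Integrable f (γ : Measure (α × β)) := hf.integrable _
  rw [defect] at d₁ d₂
  simp only [Function.comp_assoc, Prod.swap_swap_eq, Function.comp_id] at d₂
  rw [← hk₁, ← hg₂, integral_sub (int ((Y bf₂).mul (X bk₁))) (int ((X bg₁).mul (Y bg₂)))] at d₁
  rw [← hk₂, ← hg₁, integral_sub (int ((Y bg₂).mul (X bg₁))) (int ((X bf₁).mul (Y bk₂)))] at d₂
  have s₁ : ∫ p, g₁ p.1 * g₁ p.1 ∂(γ : Measure (α × β)) =
      ∫ p, f₁ p.1 * k₁ p.1 ∂(γ : Measure (α × β)) := by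
    rw [integral_fst_of_map_eq hγ.1 (bg₁.mul bg₁).meas, integral_fst_of_map_eq hγ.1 (bf₁.mul bk₁).meas]
    conv_lhs => rw [hg₁]
    rw [integral_mul_kernelOp bu₁ bg₁ bf₁]
    exact integral_congr_ae (Eventually.of_forall fun x => mul_comm _ _)
  have s₂ : ∫ p, g₂ p.2 * g₂ p.2 ∂(γ : Measure (α × β)) =
      ∫ p, f₂ p.2 * k₂ p.2 ∂(γ : Measure (α × β)) := by
    rw [integral_snd_of_map_eq hγ.2 (bg₂.mul bg₂).meas, integral_snd_of_map_eq hγ.2 (bf₂.mul bk₂).meas]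
    conv_lhs => rw [hg₂]
    rw [integral_mul_kernelOp bu₂ bg₂ bf₂]
    exact integral_congr_ae (Eventually.of_forall fun x => mul_comm _ _)
  have bfd : BddMeas (fun p : α × β => f₁ p.1 - f₂ p.2) := (X bf₁).sub (Y bf₂)
  have e₁ : |∫ p, f₁ p.1 * k₁ p.1 ∂(γ : Measure (α × β)) -
      ∫ p, f₂ p.2 * k₁ p.1 ∂(γ : Measure (α × β))| ≤
      C * (C * M) * ∫ p, |f₁ p.1 - f₂ p.2| ∂(γ : Measure (α × β)) := by
    rw [← integral_sub (int ((X bf₁).mul (X bk₁))) (int ((Y bf₂).mul (X bk₁))), ← integral_const_mul]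
    refine abs_integral_le_integral_abs.trans (integral_mono
      (int (((X bf₁).mul (X bk₁)).sub ((Y bf₂).mul (X bk₁))).abs)
      (int ((BddMeas.const _).mul bfd.abs)) fun p => ?_)
    simp only [← sub_mul, abs_mul]
    rw [mul_comm]
    exact mul_le_mul_of_nonneg_right (mk₁ _) (abs_nonneg _)
  have e₂ : |∫ p, f₁ p.1 * k₂ p.2 ∂(γ : Measure (α × β)) -
      ∫ p, f₂ p.2 * k₂ p.2 ∂(γ : Measure (α × β))| ≤
      C * (C * M) * ∫ p, |f₁ p.1 - f₂ p.2| ∂(γ : Measure (α × β)) := by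
    rw [← integral_sub (int ((X bf₁).mul (Y bk₂))) (int ((Y bf₂).mul (Y bk₂))), ← integral_const_mul]
    refine abs_integral_le_integral_abs.trans (integral_mono
      (int (((X bf₁).mul (Y bk₂)).sub ((Y bf₂).mul (Y bk₂))).abs)
      (int ((BddMeas.const _).mul bfd.abs)) fun p => ?_)
    simp only [← sub_mul, abs_mul]
    rw [mul_comm]
    exact mul_le_mul_of_nonneg_right (mk₂ _) (abs_nonneg _)
  have expand : ∫ p, (g₁ p.1 - g₂ p.2) ^ 2 ∂(γ : Measure (α × β)) =
      ∫ p, g₁ p.1 * g₁ p.1 ∂(γ : Measure (α × β)) - ∫ p, g₁ p.1 * g₂ p.2 ∂(γ : Measure (α × β)) +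
      (∫ p, g₂ p.2 * g₂ p.2 ∂(γ : Measure (α × β)) -
        ∫ p, g₁ p.1 * g₂ p.2 ∂(γ : Measure (α × β))) := by
    rw [← integral_sub (int ((X bg₁).mul (X bg₁))) (int ((X bg₁).mul (Y bg₂))),
      ← integral_sub (int ((Y bg₂).mul (Y bg₂))) (int ((X bg₁).mul (Y bg₂))), ← integral_add
      (int (((X bg₁).mul (X bg₁)).sub ((X bg₁).mul (Y bg₂))))
      (int (((Y bg₂).mul (Y bg₂)).sub ((X bg₁).mul (Y bg₂))))]
    exact integral_congr_ae (Eventually.of_forall fun p => by ring)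
  have comm : ∫ p, g₂ p.2 * g₁ p.1 ∂(γ : Measure (α × β)) =
      ∫ p, g₁ p.1 * g₂ p.2 ∂(γ : Measure (α × β)) :=
    integral_congr_ae (Eventually.of_forall fun p => mul_comm _ _)
  rw [expand, s₁, s₂]
  rw [comm] at d₂
  have := abs_le.1 d₁
  have := abs_le.1 d₂
  have := abs_le.1 e₁
  have := abs_le.1 e₂
  linarith

end Functions

/-! ### Leaves and integration over a leaf -/

section Leaf

variable {V : Type*}

/-- The component of an edge is a tree with at least two vertices, hence has a vertex of degree one,
and all neighbours of that vertex lie in the component. -/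
theorem SimpleGraph.IsAcyclic.exists_leaf [Finite V] {G : SimpleGraph V} (hG : G.IsAcyclic)
    {a b : V} (hab : G.Adj a b) : ∃ l p, G.Adj l p ∧ ∀ q, G.Adj l q → q = p := by
  classical
  have := Fintype.ofFinite V
  set c := G.connectedComponentMk a with hc
  have ht := hG.isTree_connectedComponent c
  have ha : a ∈ c := rfl
  have hb : b ∈ c := (SimpleGraph.ConnectedComponent.eq.2 hab.reachable).symm
  have : Nontrivial c := ⟨⟨⟨a, ha⟩, ⟨b, hb⟩, fun h => hab.ne (congrArg Subtype.val h)⟩⟩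
  obtain ⟨⟨l, hl⟩, hdeg⟩ := ht.exists_vert_degree_one_of_nontrivial
  rw [SimpleGraph.degree_eq_one_iff_existsUnique_adj] at hdeg
  obtain ⟨⟨p, hp⟩, hlp, huniq⟩ := hdeg
  refine ⟨l, p, hlp, fun q hq => ?_⟩
  have hqc : q ∈ c := by
    have : G.connectedComponentMk q = G.connectedComponentMk l :=
      (SimpleGraph.ConnectedComponent.eq.2 hq.reachable).symm
    exact this.trans hl
  exact congrArg Subtype.val (huniq ⟨q, hqc⟩ hq)

/-- Antisymmetry of the edge set excludes a second directed edge between the leaf and its neighbour.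
-/
theorem OrientedGraph.exists_leaf [Finite V] (F : OrientedGraph V)
    (hF : F.toSimpleGraph.IsAcyclic) (hne : F.edges.Nonempty) :
    ∃ e ∈ F.edges, ∃ l p : V, l ≠ p ∧ (e = (l, p) ∨ e = (p, l)) ∧
      ∀ e' ∈ F.edges, e' ≠ e → e'.1 ≠ l ∧ e'.2 ≠ l := by
  obtain ⟨⟨a, b⟩, hab⟩ := hne
  obtain ⟨l, p, hlp, huniq⟩ := hF.exists_leaf (show F.toSimpleGraph.Adj a b from Or.inl hab)
  have key : ∀ e ∈ F.edges, (e = (l, p) ∨ e = (p, l)) →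
      ∀ e' ∈ F.edges, e' ≠ e → e'.1 ≠ l ∧ e'.2 ≠ l := by
    rintro e he hee ⟨x, y⟩ he' hne
    constructor
    · rintro (rfl : x = l)
      have hy : y = p := huniq y (Or.inl he')
      subst hy
      rcases hee with rfl | rfl
      · exact hne rfl
      · exact F.asymm _ _ he he'
    · rintro (rfl : y = l)
      have hx : x = p := huniq x (Or.inr he')
      subst hx
      rcases hee with rfl | rfl
      · exact F.asymm _ _ he he'
      · exact hne rfl
  rcases hlp with h | h
  · exact ⟨_, h, l, p, fun hlp => F.toSimpleGraph.ne_of_adj (Or.inl h) hlp, Or.inl rfl,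
      key _ h (Or.inl rfl)⟩
  · exact ⟨_, h, l, p, fun hlp => F.toSimpleGraph.ne_of_adj (Or.inr h) hlp, Or.inr rfl,
      key _ h (Or.inr rfl)⟩

/-- The oriented graph with the edge `e` removed. -/
def OrientedGraph.eraseEdge [DecidableEq V] (F : OrientedGraph V) (e : V × V) :
    OrientedGraph V where
  edges := F.edges.erase e
  asymm i j h h' := F.asymm i j (Finset.mem_of_mem_erase h) (Finset.mem_of_mem_erase h')

theorem OrientedGraph.eraseEdge_isAcyclic [DecidableEq V] {F : OrientedGraph V}
    (hF : F.toSimpleGraph.IsAcyclic) (e : V × V) : (F.eraseEdge e).toSimpleGraph.IsAcyclic :=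
  hF.anti fun _ _ h => h.imp Finset.mem_of_mem_erase Finset.mem_of_mem_erase

variable [Fintype V] [DecidableEq V] {α : Type*} [MeasurableSpace α] {μ : Measure α}
  [IsProbabilityMeasure μ]

/-- Resampling one coordinate independently preserves the product measure. A vertex can thus be
integrated out without changing the vertex type. -/
theorem measurePreserving_update (l : V) :
    MeasurePreserving (fun q : (V → α) × α => Function.update q.1 l q.2)
      ((Measure.pi fun _ : V => μ).prod μ) (Measure.pi fun _ : V => μ) := by
  have hm : Measurable (fun q : (V → α) × α => Function.update q.1 l q.2) := by
    refine measurable_pi_lambda _ fun v => ?_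
    by_cases h : v = l
    · subst h; simpa using measurable_snd
    · simp only [Function.update_of_ne h]
      exact (measurable_pi_apply v).comp measurable_fst
  refine ⟨hm, ?_⟩
  refine (Measure.pi_eq fun s hs => ?_).symm
  rw [Measure.map_apply hm (MeasurableSet.univ_pi hs)]
  have : (fun q : (V → α) × α => Function.update q.1 l q.2) ⁻¹' (Set.univ.pi s) =
      (Set.univ.pi (Function.update s l Set.univ)) ×ˢ s l := by
    ext ⟨ξ, y⟩
    simp only [Set.mem_preimage, Set.mem_univ_pi, Set.mem_prod]
    constructor
    · intro h
      refine ⟨fun v => ?_, by simpa using h l⟩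
      by_cases hv : v = l
      · subst hv; simp
      · simpa [Function.update_of_ne hv] using h v
    · rintro ⟨h, hy⟩ v
      by_cases hv : v = l
      · subst hv; simpa using hy
      · simpa [Function.update_of_ne hv] using h v
  rw [this, Measure.prod_prod, Measure.pi_pi, ← Finset.mul_prod_erase _ _ (Finset.mem_univ l),
    ← Finset.mul_prod_erase _ (fun v => μ (s v)) (Finset.mem_univ l)]
  simp only [Function.update_self, measure_univ, one_mul]
  rw [mul_comm]
  congr 1
  refine Finset.prod_congr rfl fun v hv => ?_
  rw [Function.update_of_ne (Finset.ne_of_mem_erase hv)]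

theorem integral_pi_eq_integral_update (l : V) {F : (V → α) → ℝ} (hF : BddMeas F) :
    ∫ ξ, F ξ ∂(Measure.pi fun _ : V => μ) =
      ∫ ξ, ∫ y, F (Function.update ξ l y) ∂μ ∂(Measure.pi fun _ : V => μ) := by
  have h := measurePreserving_update (μ := μ) l
  conv_lhs => rw [← h.map_eq]
  rw [integral_map h.measurable.aemeasurable hF.meas.aestronglyMeasurable]
  exact integral_prod _ ((hF.comp h.measurable).integrable _)

/-- The vertex weights which remain after integrating over the leaf `l` with neighbour `p`. -/
def leafWeight (μ : Measure α) (u : α × α → ℝ) (G : V → α → ℝ) (l p v : V) (x : α) : ℝ :=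
  if v = l then 1 else G v x * (if v = p then kernelOp μ u (G l) x else 1)

/-- The homomorphism density of an oriented graph with edge kernels and vertex weights. -/
def weightedDensity (μ : Measure α) (F : OrientedGraph V) (U : V × V → α × α → ℝ)
    (G : V → α → ℝ) : ℝ :=
  ∫ ξ : V → α, (∏ e ∈ F.edges, U e (ξ e.1, ξ e.2)) * ∏ v, G v (ξ v) ∂(Measure.pi fun _ : V => μ)

theorem BddMeas.edgeProd {F : OrientedGraph V} {U : V × V → α × α → ℝ}
    (hU : ∀ e ∈ F.edges, BddMeas (U e)) :
    BddMeas (fun ξ : V → α => ∏ e ∈ F.edges, U e (ξ e.1, ξ e.2)) :=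
  BddMeas.prod _ fun e he =>
    (hU e he).comp ((measurable_pi_apply e.1).prodMk (measurable_pi_apply e.2))

/-- Only the edge e and the weight of l depend on the position of l; their integral is a function of
the position of p and is absorbed into its weight. The vertex l stays, isolated and with weight 1,
so the outcome is a forest even if F is a tree. -/
theorem weightedDensity_eq_eraseEdge {F : OrientedGraph V} {U : V × V → α × α → ℝ}
    {G : V → α → ℝ} (hU : ∀ e ∈ F.edges, BddMeas (U e)) (hG : ∀ v, BddMeas (G v))
    {e : V × V} (he : e ∈ F.edges) {l p : V} (hlp : l ≠ p)
    (hleaf : ∀ e' ∈ F.edges, e' ≠ e → e'.1 ≠ l ∧ e'.2 ≠ l) {u : α × α → ℝ}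
    (hu : ∀ ξ : V → α, U e (ξ e.1, ξ e.2) = u (ξ p, ξ l)) :
    weightedDensity μ F U G = weightedDensity μ (F.eraseEdge e) U (leafWeight μ u G l p) := by
  unfold weightedDensity
  rw [integral_pi_eq_integral_update l]
  swap
  · exact (BddMeas.edgeProd hU).mul
      (BddMeas.prod _ fun v _ => (hG v).comp (measurable_pi_apply v))
  refine integral_congr_ae (Eventually.of_forall fun ξ => ?_)
  have h1 : ∀ y, ∏ e' ∈ F.edges, U e' (Function.update ξ l y e'.1, Function.update ξ l y e'.2) =
      u (ξ p, y) * ∏ e' ∈ (F.eraseEdge e).edges, U e' (ξ e'.1, ξ e'.2) := by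
    intro y
    rw [← Finset.mul_prod_erase _ _ he, hu, Function.update_self, Function.update_of_ne hlp.symm]
    congr 1
    refine Finset.prod_congr rfl fun e' he' => ?_
    obtain ⟨h1, h2⟩ := hleaf e' (Finset.mem_of_mem_erase he') (Finset.ne_of_mem_erase he')
    rw [Function.update_of_ne h1, Function.update_of_ne h2]
  have h2 : ∀ y, ∏ v, G v (Function.update ξ l y v) =
      G l y * ∏ v ∈ Finset.univ.erase l, G v (ξ v) := by
    intro y
    rw [← Finset.mul_prod_erase _ _ (Finset.mem_univ l), Function.update_self]
    congr 1
    refine Finset.prod_congr rfl fun v hv => ?_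
    rw [Function.update_of_ne (Finset.ne_of_mem_erase hv)]
  have h3 : ∏ v, leafWeight μ u G l p v (ξ v) =
      kernelOp μ u (G l) (ξ p) * ∏ v ∈ Finset.univ.erase l, G v (ξ v) := by
    rw [← Finset.mul_prod_erase _ _ (Finset.mem_univ l)]
    have : ∀ v ∈ Finset.univ.erase l, leafWeight μ u G l p v (ξ v) =
        G v (ξ v) * (if v = p then kernelOp μ u (G l) (ξ v) else 1) := fun v hv => by
      simp [leafWeight, Finset.ne_of_mem_erase hv]
    rw [Finset.prod_congr rfl this, Finset.prod_mul_distrib, Finset.prod_ite_eq',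
      if_pos (Finset.mem_erase.2 ⟨hlp.symm, Finset.mem_univ p⟩)]
    simp [leafWeight, mul_comm]
  simp only [h1, h2, h3]
  rw [kernelOp, ← integral_mul_const, ← integral_const_mul]
  exact integral_congr_ae (Eventually.of_forall fun y => by ring)

end Leaf

/-! ### The counting lemma for weighted forests -/

section Counting

variable {α β : Type*} [MeasurableSpace α] [MeasurableSpace β]
  {μ : Measure α} {ν : Measure β} [IsProbabilityMeasure μ] [IsProbabilityMeasure ν]

/-- Uniformly bounded functions `f₁ n` and `f₂` which become close under the couplings `γ n`. -/
structure CloseFunctions (γ : ℕ → ProbabilityMeasure (α × β)) (f₁ : ℕ → α → ℝ) (f₂ : β → ℝ) :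
    Prop where
  meas₁ : ∀ n, Measurable (f₁ n)
  meas₂ : Measurable f₂
  bdd : ∃ M, (∀ n x, |f₁ n x| ≤ M) ∧ ∀ y, |f₂ y| ≤ M
  tendsto : Tendsto (fun n => ∫ p, |f₁ n p.1 - f₂ p.2| ∂(γ n : Measure (α × β))) atTop (𝓝 0)

/-- Uniformly bounded kernels `u₁ n` and `u₂` which asymptotically commute with the couplings
`γ n`, in both orientations. -/
structure CloseKernels (μ : Measure α) (ν : Measure β) (γ : ℕ → ProbabilityMeasure (α × β))
    (u₁ : ℕ → α × α → ℝ) (u₂ : β × β → ℝ) : Prop where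
  meas₁ : ∀ n, Measurable (u₁ n)
  meas₂ : Measurable u₂
  bdd : ∃ C, (∀ n p, |u₁ n p| ≤ C) ∧ ∀ p, |u₂ p| ≤ C
  defect_le : ∀ ε > 0, ∀ᶠ n in atTop, ∀ S, MeasurableSet S → ∀ T, MeasurableSet T →
    |defect μ ν (γ n) (u₁ n) u₂ (S.indicator fun _ => 1) (T.indicator fun _ => 1)| ≤ ε ∧
    |defect μ ν (γ n) (u₁ n ∘ Prod.swap) (u₂ ∘ Prod.swap)
      (S.indicator fun _ => 1) (T.indicator fun _ => 1)| ≤ ε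

variable {γ : ℕ → ProbabilityMeasure (α × β)}

theorem CloseFunctions.const (c : ℝ) :
    CloseFunctions γ (fun _ _ => c) (fun _ => c) :=
  ⟨fun _ => measurable_const, measurable_const, ⟨|c|, fun _ _ => le_rfl, fun _ => le_rfl⟩,
    by simp⟩

theorem CloseFunctions.bddMeas₁ {f₁ : ℕ → α → ℝ} {f₂ : β → ℝ} (h : CloseFunctions γ f₁ f₂)
    (n : ℕ) : BddMeas (f₁ n) := ⟨h.meas₁ n, h.bdd.imp fun _ hM => hM.1 n⟩

theorem CloseFunctions.bddMeas₂ {f₁ : ℕ → α → ℝ} {f₂ : β → ℝ} (h : CloseFunctions γ f₁ f₂) :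
    BddMeas f₂ := ⟨h.meas₂, h.bdd.imp fun _ hM => hM.2⟩

theorem CloseKernels.bddMeas₁ {u₁ : ℕ → α × α → ℝ} {u₂ : β × β → ℝ}
    (h : CloseKernels μ ν γ u₁ u₂) (n : ℕ) : BddMeas (u₁ n) :=
  ⟨h.meas₁ n, h.bdd.imp fun _ hM => hM.1 n⟩

theorem CloseKernels.bddMeas₂ {u₁ : ℕ → α × α → ℝ} {u₂ : β × β → ℝ}
    (h : CloseKernels μ ν γ u₁ u₂) : BddMeas u₂ :=
  ⟨h.meas₂, h.bdd.imp fun _ hM => hM.2⟩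

theorem CloseKernels.swap {u₁ : ℕ → α × α → ℝ} {u₂ : β × β → ℝ} (h : CloseKernels μ ν γ u₁ u₂) :
    CloseKernels μ ν γ (fun n => u₁ n ∘ Prod.swap) (u₂ ∘ Prod.swap) := by
  obtain ⟨C, h1, h2⟩ := h.bdd
  refine ⟨fun n => (h.meas₁ n).comp measurable_swap, h.meas₂.comp measurable_swap,
    ⟨C, fun n p => h1 n _, fun p => h2 _⟩, fun ε hε => ?_⟩
  filter_upwards [h.defect_le ε hε] with n hn S hS T hT
  simpa only [Function.comp_assoc, Prod.swap_swap_eq, Function.comp_id] using (hn S hS T hT).symm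

theorem CloseFunctions.mul {f₁ g₁ : ℕ → α → ℝ} {f₂ g₂ : β → ℝ} (hf : CloseFunctions γ f₁ f₂)
    (hg : CloseFunctions γ g₁ g₂) :
    CloseFunctions γ (fun n x => f₁ n x * g₁ n x) (fun y => f₂ y * g₂ y) := by
  obtain ⟨M, hM₁, hM₂⟩ := hf.bdd
  obtain ⟨N, hN₁, hN₂⟩ := hg.bdd
  have bd {a b : ℝ} (ha : |a| ≤ M) (hb : |b| ≤ N) : |a * b| ≤ M * N := by
    rw [abs_mul]
    exact mul_le_mul ha hb (abs_nonneg _) ((abs_nonneg _).trans ha)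
  refine ⟨fun n => (hf.meas₁ n).mul (hg.meas₁ n), hf.meas₂.mul hg.meas₂,
    ⟨M * N, fun n x => bd (hM₁ n x) (hN₁ n x), fun y => bd (hM₂ y) (hN₂ y)⟩, ?_⟩
  have hlim : Tendsto (fun n => N * ∫ p, |f₁ n p.1 - f₂ p.2| ∂(γ n : Measure (α × β)) +
      M * ∫ p, |g₁ n p.1 - g₂ p.2| ∂(γ n : Measure (α × β))) atTop (𝓝 0) := by
    simpa using (hf.tendsto.const_mul N).add (hg.tendsto.const_mul M)
  refine squeeze_zero (fun n => integral_nonneg fun p => abs_nonneg _) (fun n => ?_) hlim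
  have bf : BddMeas (fun p : α × β => |f₁ n p.1 - f₂ p.2|) :=
    (((hf.bddMeas₁ n).comp measurable_fst).sub (hf.bddMeas₂.comp measurable_snd)).abs
  have bg : BddMeas (fun p : α × β => |g₁ n p.1 - g₂ p.2|) :=
    (((hg.bddMeas₁ n).comp measurable_fst).sub (hg.bddMeas₂.comp measurable_snd)).abs
  rw [← integral_const_mul, ← integral_const_mul, ← integral_add
    (((BddMeas.const N).mul bf).integrable _) (((BddMeas.const M).mul bg).integrable _)]
  refine integral_mono (((((hf.bddMeas₁ n).mul (hg.bddMeas₁ n)).comp measurable_fst).sub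
    ((hf.bddMeas₂.mul hg.bddMeas₂).comp measurable_snd)).abs.integrable _)
    ((((BddMeas.const N).mul bf).add ((BddMeas.const M).mul bg)).integrable _) fun p => ?_
  change |f₁ n p.1 * g₁ n p.1 - f₂ p.2 * g₂ p.2| ≤
    N * |f₁ n p.1 - f₂ p.2| + M * |g₁ n p.1 - g₂ p.2|
  calc |f₁ n p.1 * g₁ n p.1 - f₂ p.2 * g₂ p.2|
      = |g₁ n p.1 * (f₁ n p.1 - f₂ p.2) + f₂ p.2 * (g₁ n p.1 - g₂ p.2)| := by ring_nf
    _ ≤ |g₁ n p.1 * (f₁ n p.1 - f₂ p.2)| + |f₂ p.2 * (g₁ n p.1 - g₂ p.2)| := abs_add_le _ _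
    _ ≤ _ := by
        rw [abs_mul, abs_mul]
        exact add_le_add (mul_le_mul_of_nonneg_right (hN₁ n _) (abs_nonneg _))
          (mul_le_mul_of_nonneg_right (hM₂ _) (abs_nonneg _))

variable [StandardBorelSpace α] [Nonempty α] [StandardBorelSpace β] [Nonempty β]

/-- The L² estimate `integral_sq_kernelOp_sub_le` gives convergence of the squares, and
Cauchy–Schwarz returns to L¹. -/
theorem CloseFunctions.kernelOp (hγ : ∀ n, γ n ∈ couplings μ ν) {u₁ : ℕ → α × α → ℝ}
    {u₂ : β × β → ℝ} (hu : CloseKernels μ ν γ u₁ u₂) {f₁ : ℕ → α → ℝ} {f₂ : β → ℝ}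
    (hf : CloseFunctions γ f₁ f₂) :
    CloseFunctions γ (fun n => kernelOp μ (u₁ n) (f₁ n)) (kernelOp ν u₂ f₂) := by
  obtain ⟨M, hM₁, hM₂⟩ := hf.bdd
  obtain ⟨C, hC₁, hC₂⟩ := hu.bdd
  refine ⟨fun n => measurable_kernelOp (hu.meas₁ n) (hf.meas₁ n),
    measurable_kernelOp hu.meas₂ hf.meas₂,
    ⟨C * M, fun n => abs_kernelOp_le (hC₁ n) (hM₁ n), abs_kernelOp_le hC₂ hM₂⟩, ?_⟩
  have hC0 : 0 ≤ C := (abs_nonneg _).trans (hC₂ (Classical.arbitrary _))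
  have hsq : Tendsto (fun n => ∫ p, (_root_.kernelOp μ (u₁ n) (f₁ n) p.1 -
      _root_.kernelOp ν u₂ f₂ p.2) ^ 2 ∂(γ n : Measure (α × β))) atTop (𝓝 0) := by
    refine (tendsto_order.2 ⟨fun a ha => Eventually.of_forall fun n =>
      ha.trans_le (integral_nonneg fun p => sq_nonneg _), fun a ha => ?_⟩)
    set K := 8 * C * M ^ 2 with hK
    have hK0 : 0 ≤ K := by positivity
    -- This makes the defect term at most a/2; the summand 1 covers K = 0.
    have hε : 0 < a / (2 * (K + 1)) := by positivity
    have ht : Tendsto (fun n => 2 * (C * (C * M)) *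
        ∫ p, |f₁ n p.1 - f₂ p.2| ∂(γ n : Measure (α × β))) atTop (𝓝 0) := by
      simpa using hf.tendsto.const_mul (2 * (C * (C * M)))
    filter_upwards [hu.defect_le _ hε, ht.eventually (gt_mem_nhds (half_pos ha))] with n h1 h2
    refine (integral_sq_kernelOp_sub_le (hγ n) (hu.meas₁ n) hu.meas₂ (hC₁ n) hC₂ h1 (hf.meas₁ n)
      hf.meas₂ (hM₁ n) hM₂).trans_lt ?_
    have h3 : K * (a / (2 * (K + 1))) ≤ a / 2 := by
      rw [mul_div_assoc', div_le_div_iff₀ (by positivity) (by positivity)]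
      nlinarith
    linarith
  have hsqrt := hsq.sqrt
  rw [Real.sqrt_zero] at hsqrt
  refine squeeze_zero (fun n => integral_nonneg fun p => abs_nonneg _) (fun n => ?_) hsqrt
  refine Real.le_sqrt_of_sq_le (integral_abs_sq_le ?_)
  exact (((hu.bddMeas₁ n).kernelOp (hf.bddMeas₁ n)).comp measurable_fst).sub
    ((hu.bddMeas₂.kernelOp hf.bddMeas₂).comp measurable_snd)

theorem CloseFunctions.tendsto_integral (hγ : ∀ n, γ n ∈ couplings μ ν) {f₁ : ℕ → α → ℝ}
    {f₂ : β → ℝ} (hf : CloseFunctions γ f₁ f₂) :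
    Tendsto (fun n => ∫ x, f₁ n x ∂μ) atTop (𝓝 (∫ y, f₂ y ∂ν)) := by
  rw [tendsto_iff_norm_sub_tendsto_zero]
  refine squeeze_zero (fun n => norm_nonneg _) (fun n => ?_) hf.tendsto
  rw [← integral_fst_of_map_eq (hγ n).1 (hf.meas₁ n), ← integral_snd_of_map_eq (hγ n).2 hf.meas₂,
    ← integral_sub (((hf.bddMeas₁ n).comp measurable_fst).integrable _)
      ((hf.bddMeas₂.comp measurable_snd).integrable _)]
  exact norm_integral_le_integral_norm _

/-- Induction on the number of edges by removing leaves. The vertex weights carry what has been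
integrated out, and forests are allowed because the removed leaf remains as an isolated vertex. -/
theorem tendsto_weightedDensity (hγ : ∀ n, γ n ∈ couplings μ ν) {V : Type*} [Fintype V]
    [DecidableEq V] (F : OrientedGraph V) (hF : F.toSimpleGraph.IsAcyclic)
    {U₁ : ℕ → V × V → α × α → ℝ} {U₂ : V × V → β × β → ℝ}
    (hU : ∀ e ∈ F.edges, CloseKernels μ ν γ (fun n => U₁ n e) (U₂ e))
    {G₁ : ℕ → V → α → ℝ} {G₂ : V → β → ℝ} (hG : ∀ v, CloseFunctions γ (fun n => G₁ n v) (G₂ v)) :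
    Tendsto (fun n => weightedDensity μ F (U₁ n) (G₁ n)) atTop (𝓝 (weightedDensity ν F U₂ G₂)) := by
  induction hm : F.edges.card generalizing F G₁ G₂ with
  | zero =>
    rw [Finset.card_eq_zero] at hm
    simp only [weightedDensity, hm, Finset.prod_empty, one_mul, integral_fintype_prod_eq_prod]
    exact tendsto_finsetProd _ fun v _ => (hG v).tendsto_integral hγ
  | succ m ih =>
    obtain ⟨e, he, l, p, hlp, hor, hleaf⟩ := F.exists_leaf hF (Finset.card_pos.1 (by omega))
    have key : ∀ {u₁ : ℕ → α × α → ℝ} {u₂ : β × β → ℝ}, CloseKernels μ ν γ u₁ u₂ →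
        (∀ n (ξ : V → α), U₁ n e (ξ e.1, ξ e.2) = u₁ n (ξ p, ξ l)) →
        (∀ ξ : V → β, U₂ e (ξ e.1, ξ e.2) = u₂ (ξ p, ξ l)) →
        Tendsto (fun n => weightedDensity μ F (U₁ n) (G₁ n)) atTop
          (𝓝 (weightedDensity ν F U₂ G₂)) := by
      intro u₁ u₂ hu hu₁ hu₂
      have e₁ : ∀ n, weightedDensity μ F (U₁ n) (G₁ n) =
          weightedDensity μ (F.eraseEdge e) (U₁ n) (leafWeight μ (u₁ n) (G₁ n) l p) := fun n =>
        weightedDensity_eq_eraseEdge (fun e he => (hU e he).bddMeas₁ n)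
          (fun v => (hG v).bddMeas₁ n) he hlp hleaf (hu₁ n)
      rw [weightedDensity_eq_eraseEdge (fun e he => (hU e he).bddMeas₂)
        (fun v => (hG v).bddMeas₂) he hlp hleaf hu₂]
      simp only [e₁]
      refine ih (F.eraseEdge e) (OrientedGraph.eraseEdge_isAcyclic hF e)
        (fun e' he' => hU e' (Finset.mem_of_mem_erase he')) (fun v => ?_) ?_
      · unfold leafWeight
        by_cases hvl : v = l
        · simpa only [hvl, if_true] using CloseFunctions.const 1
        · by_cases hvp : v = p
          · simpa only [hvl, hvp, if_true, if_false, hlp.symm] using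
              (hG p).mul ((hG l).kernelOp hγ hu)
          · simpa only [hvl, hvp, if_false, mul_one] using hG v
      · rw [OrientedGraph.eraseEdge, Finset.card_erase_of_mem he, hm, Nat.add_sub_cancel]
    -- The kernel is read from the neighbour to the leaf, so an edge that starts at the leaf
    -- contributes the transposed kernel.
    rcases hor with rfl | rfl
    · exact key (hU _ he).swap (fun n ξ => rfl) (fun ξ => rfl)
    · exact key (hU _ he) (fun n ξ => rfl) (fun ξ => rfl)

end Counting

/-! ### Pure tensors and homomorphism densities -/

section Tensor

variable {ι H : Type*} [Fintype ι] [NormedAddCommGroup H] [InnerProductSpace ℝ H]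

theorem HilbertTensorPower.norm_pure (x : ι → H) : ‖HilbertTensorPower.pure x‖ = ∏ i, ‖x i‖ := by
  have h := HilbertTensorPower.inner_pure x x
  simp only [real_inner_self_eq_norm_sq, Finset.prod_pow] at h
  exact (pow_left_inj₀ (norm_nonneg _) (Finset.prod_nonneg fun i _ => norm_nonneg _)
    two_ne_zero).1 h

/-- The pure tensor as a continuous multilinear map. -/
def HilbertTensorPower.pureMultilinear (ι H : Type*) [Fintype ι] [NormedAddCommGroup H]
    [InnerProductSpace ℝ H] :
    ContinuousMultilinearMap ℝ (fun _ : ι => H) (HilbertTensorPower ι H) :=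
  (({ toFun := fun z => (z : UniformSpace.Completion (AlgTensorPower ι H))
      map_add' := UniformSpace.Completion.coe_add
      map_smul' := UniformSpace.Completion.coe_smul } :
    AlgTensorPower ι H →ₗ[ℝ] HilbertTensorPower ι H).compMultilinearMap
      (AlgTensorPower.tprod ι H)).mkContinuous 1 fun x => by
        rw [one_mul]
        exact (HilbertTensorPower.norm_pure x).le

theorem HilbertTensorPower.pureMultilinear_apply (x : ι → H) :
    HilbertTensorPower.pureMultilinear ι H x = HilbertTensorPower.pure x := rfl

theorem HilbertTensorPower.continuous_pure :
    Continuous (HilbertTensorPower.pure : (ι → H) → HilbertTensorPower ι H) :=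
  (HilbertTensorPower.pureMultilinear ι H).cont

theorem HilbertTensorPower.norm_pure_sub_le {x y : ι → H} {C ε : ℝ} (hC : 0 ≤ C) (hε : 0 ≤ ε)
    (hx : ∀ i, ‖x i‖ ≤ C) (hy : ∀ i, ‖y i‖ ≤ C) (hxy : ∀ i, ‖x i - y i‖ ≤ ε) :
    ‖HilbertTensorPower.pure x - HilbertTensorPower.pure y‖ ≤
      Fintype.card ι * C ^ (Fintype.card ι - 1) * ε := by
  have h := (HilbertTensorPower.pureMultilinear ι H).norm_image_sub_le x y
  have h1 : ‖HilbertTensorPower.pureMultilinear ι H‖ ≤ 1 :=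
    MultilinearMap.mkContinuous_norm_le _ zero_le_one _
  refine h.trans ?_
  have h2 : max ‖x‖ ‖y‖ ≤ C :=
    max_le ((pi_norm_le_iff_of_nonneg hC).2 hx) ((pi_norm_le_iff_of_nonneg hC).2 hy)
  have h3 : ‖x - y‖ ≤ ε := (pi_norm_le_iff_of_nonneg hε).2 hxy
  calc _ ≤ 1 * (Fintype.card ι : ℝ) * C ^ (Fintype.card ι - 1) * ε := by gcongr
    _ = _ := by ring

/-- Take the span of the centres of a finite cover by ε-balls: the orthogonal projection is at least
as close to x as the centre of a ball containing x. -/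
theorem exists_orthonormal_approx {K : Set H} (hK : IsCompact K) {ε : ℝ} (hε : 0 < ε) :
    ∃ (m : ℕ) (e : Fin m → H), Orthonormal ℝ e ∧
      ∀ x ∈ K, ‖x - ∑ i, (inner ℝ (e i) x : ℝ) • e i‖ ≤ ε := by
  obtain ⟨t, -, ht, hKt⟩ := hK.finite_cover_balls hε
  set W := Submodule.span ℝ t
  have : FiniteDimensional ℝ W := FiniteDimensional.span_of_finite ℝ ht
  set b := stdOrthonormalBasis ℝ W
  refine ⟨_, fun i => (b i : H), ?_, fun x hx => ?_⟩
  · exact b.orthonormal.comp_linearIsometry W.subtypeₗᵢ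
  · obtain ⟨y, hy, hxy⟩ := Set.mem_iUnion₂.1 (hKt hx)
    have h1 : W.starProjection x = ∑ i, (inner ℝ (b i : H) x : ℝ) • (b i : H) := by
      rw [Submodule.starProjection_apply, b.orthogonalProjectionOnto_apply_eq_sum x]
      simp
    rw [← h1, Submodule.starProjection_minimal]
    have hbdd : BddBelow (Set.range fun z : W => ‖x - z‖) :=
      ⟨0, by rintro _ ⟨z, rfl⟩; exact norm_nonneg _⟩
    refine (ciInf_le hbdd ⟨y, Submodule.subset_span hy⟩).trans ?_
    simpa [dist_eq_norm] using (Metric.mem_ball.1 hxy).le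

end Tensor

/-! ### Tensor-valued densities: null sets, pairings and multilinear expansion -/

section HomDensity

variable {V : Type*} [Fintype V] {α : Type*} [MeasurableSpace α] {μ : Measure α}
  [IsProbabilityMeasure μ] {H : Type*} [NormedAddCommGroup H] [InnerProductSpace ℝ H]

/-- Used to pull null sets of the square back along an edge; this is where the absence of loops
matters. -/
theorem map_eval_pair {i j : V} (hij : i ≠ j) :
    (Measure.pi fun _ : V => μ).map (fun ξ => (ξ i, ξ j)) = μ.prod μ := by
  have hind : iIndepFun (fun (v : V) (ξ : V → α) => ξ v) (Measure.pi fun _ : V => μ) :=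
    iIndepFun_pi (X := fun _ x => x) fun v => aemeasurable_id
  have h := (hind.indepFun hij)
  rw [indepFun_iff_map_prod_eq_prod_map_map (measurable_pi_apply i).aemeasurable
    (measurable_pi_apply j).aemeasurable] at h
  rw [h]
  congr 1
  · exact (measurePreserving_eval (fun _ : V => μ) i).map_eq
  · exact (measurePreserving_eval (fun _ : V => μ) j).map_eq

theorem OrientedGraph.homDensity_congr_ae (F : OrientedGraph V) {w w' : α × α → H}
    (h : w =ᵐ[μ.prod μ] w') : F.homDensity μ w = F.homDensity μ w' := by
  refine integral_congr_ae ?_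
  have : ∀ e : F.edges, ∀ᵐ ξ ∂(Measure.pi fun _ : V => μ),
      w (ξ e.1.1, ξ e.1.2) = w' (ξ e.1.1, ξ e.1.2) := by
    rintro ⟨⟨i, j⟩, he⟩
    have hij : i ≠ j := by
      rintro rfl
      exact F.asymm _ _ he he
    rw [← map_eval_pair hij] at h
    exact ae_of_ae_map ((measurable_pi_apply i).prodMk (measurable_pi_apply j)).aemeasurable h
  filter_upwards [ae_all_iff.2 this] with ξ hξ
  simp only [hξ]

theorem OrientedGraph.integrable_pure (F : OrientedGraph V) [SecondCountableTopology H]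
    {w : α × α → H} (hw : StronglyMeasurable w) {C : ℝ} (hC : ∀ p, ‖w p‖ ≤ C) :
    Integrable (fun ξ : V → α =>
      HilbertTensorPower.pure (fun e : F.edges => w (ξ e.1.1, ξ e.1.2)))
      (Measure.pi fun _ : V => μ) := by
  borelize H
  have hm : Measurable (fun ξ : V → α => fun e : F.edges => w (ξ e.1.1, ξ e.1.2)) :=
    measurable_pi_lambda _ fun e => hw.measurable.comp
      ((measurable_pi_apply e.1.1).prodMk (measurable_pi_apply e.1.2))
  refine Integrable.of_bound (HilbertTensorPower.continuous_pure.comp_stronglyMeasurable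
    hm.stronglyMeasurable).aestronglyMeasurable (∏ _e : F.edges, C)
    (Eventually.of_forall fun ξ => ?_)
  rw [HilbertTensorPower.norm_pure]
  exact Finset.prod_le_prod (fun _ _ => norm_nonneg _) fun _ _ => hC _

theorem OrientedGraph.inner_pure_homDensity (F : OrientedGraph V) [SecondCountableTopology H]
    {w : α × α → H} (hw : StronglyMeasurable w) {C : ℝ} (hC : ∀ p, ‖w p‖ ≤ C) (x : F.edges → H) :
    inner ℝ (HilbertTensorPower.pure x) (F.homDensity μ w) =
      ∫ ξ : V → α, ∏ e : F.edges, inner ℝ (x e) (w (ξ e.1.1, ξ e.1.2))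
        ∂(Measure.pi fun _ : V => μ) := by
  rw [OrientedGraph.homDensity, ← integral_inner (F.integrable_pure hw hC)]
  simp only [HilbertTensorPower.inner_pure]

theorem OrientedGraph.norm_homDensity_sub_le (F : OrientedGraph V) [SecondCountableTopology H]
    {w v : α × α → H} (hw : StronglyMeasurable w) (hv : StronglyMeasurable v) {C ε : ℝ}
    (h0 : 0 ≤ C) (hε : 0 ≤ ε) (hwC : ∀ p, ‖w p‖ ≤ C) (hvC : ∀ p, ‖v p‖ ≤ C)
    (hwv : ∀ p, ‖w p - v p‖ ≤ ε) :
    ‖F.homDensity μ w - F.homDensity μ v‖ ≤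
      Fintype.card F.edges * C ^ (Fintype.card F.edges - 1) * ε := by
  rw [OrientedGraph.homDensity, OrientedGraph.homDensity,
    ← integral_sub (F.integrable_pure hw hwC) (F.integrable_pure hv hvC)]
  refine (norm_integral_le_of_norm_le_const (Eventually.of_forall fun ξ =>
    HilbertTensorPower.norm_pure_sub_le h0 hε (fun e => hwC _) (fun e => hvC _)
      fun e => hwv _)).trans_eq ?_
  simp

open Classical in
-- Multilinearity of the pure tensor: each κ assigns a direction to every edge, and its coefficient
-- is a scalar density with edge-dependent kernels.
theorem OrientedGraph.homDensity_sum_smul (F : OrientedGraph V) {m : ℕ} (e : Fin m → H)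
    {u : Fin m → α × α → ℝ} (hu : ∀ k, BddMeas (u k)) :
    F.homDensity μ (fun p => ∑ k, u k p • e k) =
      ∑ κ : F.edges → Fin m, (∫ ξ : V → α, ∏ a : F.edges, u (κ a) (ξ a.1.1, ξ a.1.2)
        ∂(Measure.pi fun _ : V => μ)) • HilbertTensorPower.pure (fun a => e (κ a)) := by
  classical
  have h1 : ∀ ξ : V → α, HilbertTensorPower.pure
      (fun a : F.edges => ∑ k, u k (ξ a.1.1, ξ a.1.2) • e k) =
      ∑ κ : F.edges → Fin m, (∏ a : F.edges, u (κ a) (ξ a.1.1, ξ a.1.2)) •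
        HilbertTensorPower.pure (fun a => e (κ a)) := by
    intro ξ
    rw [← HilbertTensorPower.pureMultilinear_apply]
    change (HilbertTensorPower.pureMultilinear F.edges H).toMultilinearMap _ = _
    rw [MultilinearMap.map_sum]
    refine Finset.sum_congr rfl fun κ _ => ?_
    rw [MultilinearMap.map_smul_univ]
    rfl
  have hb : ∀ κ : F.edges → Fin m, BddMeas
      (fun ξ : V → α => ∏ a : F.edges, u (κ a) (ξ a.1.1, ξ a.1.2)) := fun κ =>
    BddMeas.prod _ fun a _ => (hu (κ a)).comp
      ((measurable_pi_apply a.1.1).prodMk (measurable_pi_apply a.1.2))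
  simp only [OrientedGraph.homDensity, h1]
  rw [integral_finsetSum _ fun κ _ => ((hb κ).integrable _).smul_const _]
  exact Finset.sum_congr rfl fun κ _ => integral_smul_const _ _

open Classical in
/-- The extension by zero of a family of kernels on the edges. -/
def OrientedGraph.extendKernels (F : OrientedGraph V) (u : F.edges → α × α → ℝ) (e : V × V) :
    α × α → ℝ := if h : e ∈ F.edges then u ⟨e, h⟩ else 0

theorem OrientedGraph.extendKernels_apply (F : OrientedGraph V) (u : F.edges → α × α → ℝ)
    {e : V × V} (h : e ∈ F.edges) : F.extendKernels u e = u ⟨e, h⟩ := by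
  simp [OrientedGraph.extendKernels, h]

theorem weightedDensity_extendKernels (F : OrientedGraph V) (u : F.edges → α × α → ℝ) :
    weightedDensity μ F (F.extendKernels u) (fun _ _ => 1) =
      ∫ ξ : V → α, ∏ a : F.edges, u a (ξ a.1.1, ξ a.1.2) ∂(Measure.pi fun _ : V => μ) := by
  unfold weightedDensity
  refine integral_congr_ae (Eventually.of_forall fun ξ => ?_)
  simp only [Finset.prod_const_one, mul_one]
  rw [← Finset.prod_coe_sort]
  refine Finset.prod_congr rfl fun a _ => ?_
  rw [F.extendKernels_apply u a.2]

end HomDensity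

/-! ### The counting lemma -/

section CountingLemma

variable {α β : Type*} [MeasurableSpace α] [MeasurableSpace β]
  {μ : Measure α} {ν : Measure β} [IsProbabilityMeasure μ] [IsProbabilityMeasure ν]
  [StandardBorelSpace α] [Nonempty α] [StandardBorelSpace β] [Nonempty β]
  {H : Type*} [NormedAddCommGroup H] [InnerProductSpace ℝ H] [CompleteSpace H]
  [SecondCountableTopology H]

theorem stronglyMeasurable_sum_inner_smul {m : ℕ} (e : Fin m → H) {v : α → H}
    (hv : StronglyMeasurable v) :
    StronglyMeasurable (fun p => ∑ i, (inner ℝ (e i) (v p) : ℝ) • e i) :=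
  Finset.stronglyMeasurable_fun_sum _ fun _ _ =>
    (stronglyMeasurable_const.inner hv).smul_const _

theorem prod_mem_couplings :
    (⟨μ.prod ν, inferInstance⟩ : ProbabilityMeasure (α × β)) ∈ couplings μ ν :=
  ⟨by simp, by simp⟩

theorem exists_closeKernels_of_tendsto_couplingDist {w : ℕ → α × α → H} {w' : β × β → H}
    (hw : ∀ n, StronglyMeasurable (w n)) (hw' : StronglyMeasurable w') {C : ℝ}
    (hC : ∀ n p, ‖w n p‖ ≤ C) (hC' : ∀ p, ‖w' p‖ ≤ C)
    (h : Tendsto (fun n => couplingDist μ ν (w n) w') atTop (𝓝 0)) :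
    ∃ γ : ℕ → ProbabilityMeasure (α × β), (∀ n, γ n ∈ couplings μ ν) ∧ ∀ e : H, ‖e‖ ≤ 1 →
      CloseKernels μ ν γ (fun n p => inner ℝ e (w n p)) (fun p => inner ℝ e (w' p)) := by
  set d : ℕ → ℝ := fun n => (couplingDist μ ν (w n) w').toReal + 1 / ((n : ℝ) + 1) with hd
  have hd0 : ∀ n, 0 ≤ d n := fun n => by positivity
  have hdlim : Tendsto d atTop (𝓝 0) := by
    have h1 := (ENNReal.tendsto_toReal ENNReal.zero_ne_top).comp h
    simpa [hd] using h1.add tendsto_one_div_add_atTop_nhds_zero_nat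
  have hex : ∀ n, ∃ γ ∈ couplings μ ν, couplingDist μ ν (w n) w' ≠ ⊤ → ∀ e : H, ‖e‖ ≤ 1 →
      ∀ S, MeasurableSet S → ∀ T, MeasurableSet T →
      |defect μ ν γ (fun p => inner ℝ e (w n p)) (fun p => inner ℝ e (w' p))
        (S.indicator fun _ => 1) (T.indicator fun _ => 1)| ≤ d n ∧
      |defect μ ν γ ((fun p => inner ℝ e (w n p)) ∘ Prod.swap)
        ((fun p => inner ℝ e (w' p)) ∘ Prod.swap)
        (S.indicator fun _ => 1) (T.indicator fun _ => 1)| ≤ d n := by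
    intro n
    by_cases htop : couplingDist μ ν (w n) w' = ⊤
    · exact ⟨_, prod_mem_couplings, fun h => absurd htop h⟩
    · have hlt : couplingDist μ ν (w n) w' < ENNReal.ofReal (d n) := by
        rw [ENNReal.lt_ofReal_iff_toReal_lt htop]
        have : (0 : ℝ) < 1 / ((n : ℝ) + 1) := by positivity
        linarith
      obtain ⟨γ, hγ, hb⟩ := exists_coupling_of_couplingDist_lt (hw n) hw' (hC n) hC' (hd0 n) hlt
      exact ⟨γ, hγ, fun _ => hb⟩
  choose γ hγ hb using hex
  refine ⟨γ, hγ, fun e he => ⟨fun n => (BddMeas.inner (hw n) (hC n) e).meas,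
    (BddMeas.inner hw' hC' e).meas, ⟨‖e‖ * C, fun n p => ?_, fun p => ?_⟩, fun ε hε => ?_⟩⟩
  · exact (abs_real_inner_le_norm _ _).trans (mul_le_mul_of_nonneg_left (hC n p) (norm_nonneg _))
  · exact (abs_real_inner_le_norm _ _).trans (mul_le_mul_of_nonneg_left (hC' p) (norm_nonneg _))
  · have hfin : ∀ᶠ n in atTop, couplingDist μ ν (w n) w' < ⊤ :=
      h.eventually (gt_mem_nhds ENNReal.zero_lt_top)
    filter_upwards [hfin, hdlim.eventually (gt_mem_nhds hε)] with n h1 h2 S hS T hT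
    obtain ⟨h3, h4⟩ := hb n h1.ne e he S hS T hT
    exact ⟨h3.trans h2.le, h4.trans h2.le⟩

theorem tendsto_homDensity_of_tendsto_couplingDist {w : ℕ → α × α → H} {w' : β × β → H}
    (hw : ∀ n, StronglyMeasurable (w n)) (hw' : StronglyMeasurable w') {K : Set H}
    (hK : IsCompact K) (hwK : ∀ n p, w n p ∈ K) (hwK' : ∀ p, w' p ∈ K)
    (h : Tendsto (fun n => couplingDist μ ν (w n) w') atTop (𝓝 0))
    {V : Type*} [Fintype V] (F : OrientedGraph V) (hF : F.toSimpleGraph.IsAcyclic) :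
    Tendsto (fun n => ‖F.homDensity μ (w n) - F.homDensity ν w'‖) atTop (𝓝 0) := by
  classical
  obtain ⟨C, hC0, hKC⟩ := hK.isBounded.exists_pos_norm_le
  have hC : ∀ n p, ‖w n p‖ ≤ C := fun n p => hKC _ (hwK n p)
  have hC' : ∀ p, ‖w' p‖ ≤ C := fun p => hKC _ (hwK' p)
  obtain ⟨γ, hγ, hclose⟩ := exists_closeKernels_of_tendsto_couplingDist hw hw' hC hC' h
  refine tendsto_order.2 ⟨fun a ha => Eventually.of_forall fun n => ha.trans_le (norm_nonneg _),
    fun a ha => ?_⟩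
  set L : ℝ := Fintype.card F.edges * (C + 1) ^ (Fintype.card F.edges - 1) with hL
  have hL0 : 0 ≤ L := by positivity
  -- The bound 1 keeps the projected kernels in the ball of radius C + 1, for which L is the
  -- Lipschitz constant. The other bound makes each of the two projection errors less than a/3.
  set ε : ℝ := min 1 (a / (4 * (L + 1))) with hε
  have hε0 : 0 < ε := lt_min one_pos (by positivity)
  have hLε : L * ε < a / 3 := by
    have h1 : L * ε ≤ L * (a / (4 * (L + 1))) := mul_le_mul_of_nonneg_left (min_le_right _ _) hL0
    have h2 : L * (a / (4 * (L + 1))) < a / 3 := by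
      rw [mul_div_assoc', div_lt_div_iff₀ (by positivity) (by positivity)]
      nlinarith
    linarith
  obtain ⟨m, e, he, happ⟩ := exists_orthonormal_approx hK hε0
  have proj_le : ∀ x ∈ K, ‖∑ i, (inner ℝ (e i) x : ℝ) • e i‖ ≤ C + 1 := fun x hx => by
    have h1 := norm_sub_le x (x - ∑ i, (inner ℝ (e i) x : ℝ) • e i)
    rw [sub_sub_cancel] at h1
    linarith [hKC x hx, happ x hx, min_le_left (1 : ℝ) (a / (4 * (L + 1)))]
  have e1 : ∀ n, ‖F.homDensity μ (w n) -
      F.homDensity μ (fun p => ∑ i, (inner ℝ (e i) (w n p) : ℝ) • e i)‖ ≤ L * ε := fun n =>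
    F.norm_homDensity_sub_le (hw n) (stronglyMeasurable_sum_inner_smul e (hw n)) (by positivity) hε0.le
      (fun p => (hC n p).trans (by linarith)) (fun p => proj_le _ (hwK n p))
      (fun p => happ _ (hwK n p))
  have e2 : ‖F.homDensity ν w' -
      F.homDensity ν (fun p => ∑ i, (inner ℝ (e i) (w' p) : ℝ) • e i)‖ ≤ L * ε :=
    F.norm_homDensity_sub_le hw' (stronglyMeasurable_sum_inner_smul e hw') (by positivity) hε0.le
      (fun p => (hC' p).trans (by linarith)) (fun p => proj_le _ (hwK' p))
      (fun p => happ _ (hwK' p))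
  have e3 : Tendsto (fun n => F.homDensity μ (fun p => ∑ i, (inner ℝ (e i) (w n p) : ℝ) • e i))
      atTop (𝓝 (F.homDensity ν (fun p => ∑ i, (inner ℝ (e i) (w' p) : ℝ) • e i))) := by
    rw [F.homDensity_sum_smul e (fun k => BddMeas.inner hw' hC' (e k))]
    simp only [fun n => F.homDensity_sum_smul (μ := μ) e (fun k => BddMeas.inner (hw n) (hC n) (e k))]
    refine tendsto_finsetSum _ fun κ _ => Tendsto.smul_const ?_ _
    have hconv := tendsto_weightedDensity hγ F hF
      (U₁ := fun n => F.extendKernels fun a p => inner ℝ (e (κ a)) (w n p))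
      (U₂ := F.extendKernels fun a p => inner ℝ (e (κ a)) (w' p))
      (fun a ha => by
        simpa only [F.extendKernels_apply _ ha] using hclose (e (κ ⟨a, ha⟩)) (he.1 _).le)
      (fun _ => CloseFunctions.const 1)
    simpa only [weightedDensity_extendKernels] using hconv
  rw [tendsto_iff_norm_sub_tendsto_zero] at e3
  filter_upwards [e3.eventually (gt_mem_nhds (show 0 < a / 3 by positivity))] with n hn
  have t1 := norm_sub_le_norm_sub_add_norm_sub (F.homDensity μ (w n))
    (F.homDensity μ (fun p => ∑ i, (inner ℝ (e i) (w n p) : ℝ) • e i)) (F.homDensity ν w')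
  have t2 := norm_sub_le_norm_sub_add_norm_sub
    (F.homDensity μ (fun p => ∑ i, (inner ℝ (e i) (w n p) : ℝ) • e i))
    (F.homDensity ν (fun p => ∑ i, (inner ℝ (e i) (w' p) : ℝ) • e i)) (F.homDensity ν w')
  rw [norm_sub_rev] at e2
  linarith [e1 n, e2]

end CountingLemma

/-! ### Grafting of oriented trees -/

section Graft

/-- Acyclicity means that every edge is a bridge. A walk in the disjoint union stays on the side
where it starts, so a detour around an edge would already exist in its summand. -/
theorem SimpleGraph.IsAcyclic.sum {V W : Type*} {G : SimpleGraph V} {H : SimpleGraph W}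
    (hG : G.IsAcyclic) (hH : H.IsAcyclic) : (G.sum H).IsAcyclic := by
  rw [SimpleGraph.isAcyclic_iff_forall_adj_isBridge] at hG hH ⊢
  have left : ∀ (a b : V) (x y : V ⊕ W)
      (_ : ((G.sum H).deleteEdges {s(Sum.inl a, Sum.inl b)}).Walk x y) (v : V), x = Sum.inl v →
      ∃ v', y = Sum.inl v' ∧ (G.deleteEdges {s(a, b)}).Reachable v v' := by
    intro a b x y p
    induction p with
    | nil => exact fun v hv => ⟨v, hv, SimpleGraph.Reachable.refl v⟩
    | @cons x z y hadj p ih =>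
      rintro v rfl
      rcases z with z | z
      · obtain ⟨v', hv', hr⟩ := ih z rfl
        refine ⟨v', hv', SimpleGraph.Reachable.trans (SimpleGraph.Adj.reachable ?_) hr⟩
        simpa [SimpleGraph.deleteEdges_adj] using hadj
      · simp [SimpleGraph.deleteEdges_adj] at hadj
  have right : ∀ (a b : W) (x y : V ⊕ W)
      (_ : ((G.sum H).deleteEdges {s(Sum.inr a, Sum.inr b)}).Walk x y) (v : W), x = Sum.inr v →
      ∃ v', y = Sum.inr v' ∧ (H.deleteEdges {s(a, b)}).Reachable v v' := by
    intro a b x y p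
    induction p with
    | nil => exact fun v hv => ⟨v, hv, SimpleGraph.Reachable.refl v⟩
    | @cons x z y hadj p ih =>
      rintro v rfl
      rcases z with z | z
      · simp [SimpleGraph.deleteEdges_adj] at hadj
      · obtain ⟨v', hv', hr⟩ := ih z rfl
        refine ⟨v', hv', SimpleGraph.Reachable.trans (SimpleGraph.Adj.reachable ?_) hr⟩
        simpa [SimpleGraph.deleteEdges_adj] using hadj
  rintro (a | a) (b | b) hab
  · rintro ⟨p⟩
    obtain ⟨v', hv', hr⟩ := left a b _ _ p a rfl
    cases hv'
    exact hG (by simpa using hab) hr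
  · simp at hab
  · simp at hab
  · rintro ⟨p⟩
    obtain ⟨v', hv', hr⟩ := right a b _ _ p a rfl
    cases hv'
    exact hH (by simpa using hab) hr

namespace OrientedGraph

variable {V W : Type*}

open Classical in
/-- The disjoint union of two oriented graphs with an additional edge between the vertices `r` and
`s`, which points from `r` to `s` if `b` holds, and from `s` to `r` otherwise. -/
def graft (F : OrientedGraph V) (F' : OrientedGraph W) (r : V) (s : W) (b : Bool) :
    OrientedGraph (V ⊕ W) where
  edges := insert (if b then (Sum.inl r, Sum.inr s) else (Sum.inr s, Sum.inl r))
    (F.edges.map (Function.Embedding.inl.prodMap Function.Embedding.inl) ∪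
      F'.edges.map (Function.Embedding.inr.prodMap Function.Embedding.inr))
  asymm i j := by
    have h1 := F.asymm
    have h2 := F'.asymm
    rcases i with i | i <;> rcases j with j | j <;> cases b <;> simp <;> grind

theorem graft_toSimpleGraph (F : OrientedGraph V) (F' : OrientedGraph W) (r : V) (s : W)
    (b : Bool) : (F.graft F' r s b).toSimpleGraph =
      F.toSimpleGraph.sum F'.toSimpleGraph ⊔ SimpleGraph.edge (Sum.inl r) (Sum.inr s) := by
  ext i j
  rcases i with i | i <;> rcases j with j | j <;> cases b <;>
    simp [toSimpleGraph, graft, SimpleGraph.edge_adj, and_comm]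

theorem IsTree.graft {F : OrientedGraph V} {F' : OrientedGraph W} (h : F.IsTree) (h' : F'.IsTree)
    (r : V) (s : W) (b : Bool) : (F.graft F' r s b).IsTree := by
  unfold IsTree at *
  rw [graft_toSimpleGraph]
  exact ⟨h.connected.sum_sup_edge h'.connected,
    (h.isAcyclic.sum h'.isAcyclic).sup_edge_of_not_reachable
      (SimpleGraph.not_reachable_sum_inl_inr _ _)⟩

theorem prod_graft_edges (F : OrientedGraph V) (F' : OrientedGraph W) (r : V) (s : W) (b : Bool)
    (f : (V ⊕ W) × (V ⊕ W) → ℝ) : ∏ e ∈ (F.graft F' r s b).edges, f e =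
      f (if b then (Sum.inl r, Sum.inr s) else (Sum.inr s, Sum.inl r)) *
        ((∏ e ∈ F.edges, f (Sum.inl e.1, Sum.inl e.2)) *
          ∏ e ∈ F'.edges, f (Sum.inr e.1, Sum.inr e.2)) := by
  classical
  rw [graft, Finset.prod_insert, Finset.prod_union, Finset.prod_map, Finset.prod_map]
  · rfl
  · rw [Finset.disjoint_left]
    rintro ⟨i, j⟩ h h'
    simp only [Finset.mem_map] at h h'
    obtain ⟨⟨a, a'⟩, -, ha⟩ := h
    obtain ⟨⟨c, c'⟩, -, hc⟩ := h'
    have := ha.trans hc.symm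
    simp at this
  · cases b <;> simp

/-- The oriented graph with one vertex. -/
def single : OrientedGraph Unit where
  edges := ∅
  asymm := by simp

theorem single_isTree : single.IsTree := SimpleGraph.IsTree.of_subsingleton

end OrientedGraph

end Graft

/-! ### Rooted trees with decorated edges -/

/-- Rooted trees with edge labels in `κ`: either a single vertex, or obtained from two rooted trees
by adding an edge between the two roots; the root of the first tree is the new root. -/
inductive LabelledTree (κ : Type*)
  | leaf : LabelledTree κ
  | graft (k : κ) (t₁ t₂ : LabelledTree κ) : LabelledTree κ

namespace LabelledTree

variable {κ : Type*} {α : Type*} [MeasurableSpace α]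

/-- The homomorphism density of a rooted tree as a function of the position of the root. -/
def eval (μ : Measure α) (u : κ → α × α → ℝ) : LabelledTree κ → α → ℝ
  | leaf => fun _ => 1
  | graft k t₁ t₂ => fun x => eval μ u t₁ x * kernelOp μ (u k) (eval μ u t₂) x

theorem eval_bddMeas {μ : Measure α} [IsProbabilityMeasure μ] {u : κ → α × α → ℝ}
    (hu : ∀ k, BddMeas (u k)) (t : LabelledTree κ) : BddMeas (eval μ u t) := by
  induction t with
  | leaf => exact BddMeas.const 1
  | graft k t₁ t₂ h₁ h₂ => exact h₁.mul ((hu k).kernelOp h₂)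

/-- The kernels of a family together with their transposes. -/
def withTranspose (u : κ → α × α → ℝ) (k : κ × Bool) : α × α → ℝ :=
  if k.2 then u k.1 else u k.1 ∘ Prod.swap

theorem withTranspose_bddMeas {u : κ → α × α → ℝ} (hu : ∀ k, BddMeas (u k)) (k : κ × Bool) :
    BddMeas (withTranspose u k) := by
  unfold withTranspose
  split_ifs
  · exact hu _
  · exact (hu _).comp measurable_swap

/-- The Boolean becomes the orientation of the edge. The free root weight g drives the induction:
when two trees are joined, the second is integrated with the joining kernel as its root weight, and
the resulting kernel operator enters the root weight of the first. -/
theorem exists_realization [Nonempty κ] (t : LabelledTree (κ × Bool)) :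
    ∃ (V : Type) (_ : Fintype V) (F : OrientedGraph V) (r : V) (c : V × V → κ), F.IsTree ∧
      ∀ (μ : Measure α) [IsProbabilityMeasure μ] (u : κ → α × α → ℝ), (∀ k, BddMeas (u k)) →
        ∀ g : α → ℝ, BddMeas g →
          ∫ ξ : V → α, g (ξ r) * ∏ e ∈ F.edges, u (c e) (ξ e.1, ξ e.2)
            ∂(Measure.pi fun _ : V => μ) = ∫ x, g x * eval μ (withTranspose u) t x ∂μ := by
  induction t with
  | leaf =>
    refine ⟨Unit, inferInstance, OrientedGraph.single, (), fun _ => Classical.arbitrary κ,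
      OrientedGraph.single_isTree, fun μ _ u hu g hg => ?_⟩
    simp only [OrientedGraph.single, Finset.prod_empty, mul_one, eval]
    have hmap := (measurePreserving_eval (fun _ : Unit => μ) ()).map_eq
    conv_rhs => rw [← hmap]
    exact (integral_map (measurable_pi_apply ()).aemeasurable hg.meas.aestronglyMeasurable).symm
  | graft k t₁ t₂ h₁ h₂ =>
    obtain ⟨k, b⟩ := k
    obtain ⟨V, _, F, r, c, hF, hV⟩ := h₁
    obtain ⟨W, _, F', s, c', hF', hW⟩ := h₂
    refine ⟨V ⊕ W, inferInstance, F.graft F' r s b, Sum.inl r, fun e => match e with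
      | (Sum.inl i, Sum.inl j) => c (i, j)
      | (Sum.inr i, Sum.inr j) => c' (i, j)
      | _ => k, hF.graft hF' r s b, fun μ _ u hu g hg => ?_⟩
    have hmp := measurePreserving_sumPiEquivProdPi_symm (fun _ : V ⊕ W => μ)
    rw [← hmp.integral_comp']
    have hP : BddMeas (fun ξ : V → α => ∏ e ∈ F.edges, u (c e) (ξ e.1, ξ e.2)) :=
      BddMeas.prod _ fun e _ => (hu (c e)).comp
        ((measurable_pi_apply e.1).prodMk (measurable_pi_apply e.2))
    have hP' : BddMeas (fun ξ : W → α => ∏ e ∈ F'.edges, u (c' e) (ξ e.1, ξ e.2)) :=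
      BddMeas.prod _ fun e _ => (hu (c' e)).comp
        ((measurable_pi_apply e.1).prodMk (measurable_pi_apply e.2))
    have hk := withTranspose_bddMeas hu (k, b)
    set P := fun ξ : V → α => ∏ e ∈ F.edges, u (c e) (ξ e.1, ξ e.2)
    set P' := fun ξ : W → α => ∏ e ∈ F'.edges, u (c' e) (ξ e.1, ξ e.2)
    have e1 : ∀ q : (V → α) × (W → α),
        (fun ξ : V ⊕ W → α => g (ξ (Sum.inl r)) * ∏ e ∈ (F.graft F' r s b).edges,
          u (match e with
            | (Sum.inl i, Sum.inl j) => c (i, j)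
            | (Sum.inr i, Sum.inr j) => c' (i, j)
            | _ => k) (ξ e.1, ξ e.2))
          ((MeasurableEquiv.sumPiEquivProdPi fun _ : V ⊕ W => α).symm q) =
        g (q.1 r) * P q.1 * (withTranspose u (k, b) (q.1 r, q.2 s) * P' q.2) := by
      rintro ⟨ξ, η⟩
      simp only [OrientedGraph.prod_graft_edges]
      have ha : ∀ v, (MeasurableEquiv.sumPiEquivProdPi fun _ : V ⊕ W => α).symm (ξ, η)
          (Sum.inl v) = ξ v := fun _ => rfl
      have hb : ∀ v, (MeasurableEquiv.sumPiEquivProdPi fun _ : V ⊕ W => α).symm (ξ, η)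
          (Sum.inr v) = η v := fun _ => rfl
      have hc : u k ((MeasurableEquiv.sumPiEquivProdPi fun _ : V ⊕ W => α).symm (ξ, η)
            (if b then ((Sum.inl r, Sum.inr s) : (V ⊕ W) × (V ⊕ W))
              else (Sum.inr s, Sum.inl r)).1,
          (MeasurableEquiv.sumPiEquivProdPi fun _ : V ⊕ W => α).symm (ξ, η)
            (if b then ((Sum.inl r, Sum.inr s) : (V ⊕ W) × (V ⊕ W))
              else (Sum.inr s, Sum.inl r)).2) = withTranspose u (k, b) (ξ r, η s) := by
        cases b <;> rfl
      have hd : (match (if b then ((Sum.inl r, Sum.inr s) : (V ⊕ W) × (V ⊕ W))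
              else (Sum.inr s, Sum.inl r)) with
            | (Sum.inl i, Sum.inl j) => c (i, j)
            | (Sum.inr i, Sum.inr j) => c' (i, j)
            | _ => k) = k := by
        cases b <;> rfl
      rw [hd, hc]
      simp only [ha, hb, P, P']
      ring
    simp only [e1]
    have hint : BddMeas (fun q : (V → α) × (W → α) =>
        g (q.1 r) * P q.1 * (withTranspose u (k, b) (q.1 r, q.2 s) * P' q.2)) :=
      ((hg.comp ((measurable_pi_apply r).comp measurable_fst)).mul (hP.comp measurable_fst)).mul
        ((hk.comp (((measurable_pi_apply r).comp measurable_fst).prodMk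
          ((measurable_pi_apply s).comp measurable_snd))).mul (hP'.comp measurable_snd))
    rw [integral_prod _ (hint.integrable _)]
    simp only [integral_const_mul]
    have e2 : ∀ x, ∫ η, withTranspose u (k, b) (x, η s) * P' η ∂(Measure.pi fun _ : W => μ) =
        kernelOp μ (withTranspose u (k, b)) (eval μ (withTranspose u) t₂) x := fun x =>
      hW μ u hu (fun y => withTranspose u (k, b) (x, y)) (hk.comp measurable_prodMk_left)
    simp only [e2]
    have e3 := hV μ u hu (fun x => g x * kernelOp μ (withTranspose u (k, b))
      (eval μ (withTranspose u) t₂) x)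
      (hg.mul (hk.kernelOp (eval_bddMeas (withTranspose_bddMeas hu) t₂)))
    refine (integral_congr_ae (Eventually.of_forall fun ξ => ?_)).trans
      (e3.trans (integral_congr_ae (Eventually.of_forall fun x => ?_)))
    · simp only [P]; ring
    · simp only [eval]; ring

end LabelledTree

/-! ### Uniformly bounded families of functions -/

section Families

variable {N α β : Type*} [MeasurableSpace α] [MeasurableSpace β]

/-- A uniformly bounded family of measurable functions. -/
structure BddFamily (Φ : N → α → ℝ) : Prop where
  meas : ∀ n, Measurable (Φ n)
  bdd : ∃ M, ∀ n x, |Φ n x| ≤ M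

namespace BddFamily

variable {Φ Ψ : N → α → ℝ}

theorem bddMeas (h : BddFamily Φ) (n : N) : BddMeas (Φ n) :=
  ⟨h.meas n, h.bdd.imp fun _ hM => hM n⟩

theorem exists_pos (h : BddFamily Φ) : ∃ M, 0 < M ∧ ∀ n x, |Φ n x| ≤ M := by
  obtain ⟨M, hM⟩ := h.bdd
  exact ⟨max M 1, by positivity, fun n x => (hM n x).trans (le_max_left _ _)⟩

theorem const (c : ℝ) : BddFamily (fun (_ : N) (_ : α) => c) :=
  ⟨fun _ => measurable_const, |c|, fun _ _ => le_rfl⟩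

theorem comp (h : BddFamily Φ) {k : β → α} (hk : Measurable k) :
    BddFamily (fun n x => Φ n (k x)) :=
  ⟨fun n => (h.meas n).comp hk, h.bdd.imp fun _ hM n x => hM n (k x)⟩

theorem add (h : BddFamily Φ) (h' : BddFamily Ψ) : BddFamily (fun n x => Φ n x + Ψ n x) := by
  obtain ⟨M, hM⟩ := h.bdd
  obtain ⟨M', hM'⟩ := h'.bdd
  exact ⟨fun n => (h.meas n).add (h'.meas n), M + M', fun n x =>
    (abs_add_le _ _).trans (add_le_add (hM n x) (hM' n x))⟩

theorem mul (h : BddFamily Φ) (h' : BddFamily Ψ) : BddFamily (fun n x => Φ n x * Ψ n x) := by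
  obtain ⟨M, hM0, hM⟩ := h.exists_pos
  obtain ⟨M', hM'⟩ := h'.bdd
  exact ⟨fun n => (h.meas n).mul (h'.meas n), M * M', fun n x => by
    rw [abs_mul]; exact mul_le_mul (hM n x) (hM' n x) (abs_nonneg _) hM0.le⟩

theorem const_mul (h : BddFamily Φ) (c : ℝ) : BddFamily (fun n x => c * Φ n x) :=
  (const c).mul h

theorem kernelOp {μ : Measure β} [IsProbabilityMeasure μ] {u : N → α × β → ℝ} {F : N → β → ℝ}
    (hu : BddFamily u) (hF : BddFamily F) : BddFamily (fun n => kernelOp μ (u n) (F n)) := by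
  obtain ⟨C, hC⟩ := hu.bdd
  obtain ⟨M, hM⟩ := hF.bdd
  exact ⟨fun n => measurable_kernelOp (hu.meas n) (hF.meas n), C * M,
    fun n => abs_kernelOp_le (hC n) (hM n)⟩

theorem continuous_comp (h : BddFamily Φ) {φ : ℝ → ℝ} (hφ : Continuous φ) :
    BddFamily (fun n x => φ (Φ n x)) := by
  obtain ⟨M, hM⟩ := h.bdd
  obtain ⟨K, hK⟩ := (isCompact_Icc (a := -M) (b := M)).exists_bound_of_continuousOn
    hφ.continuousOn
  exact ⟨fun n => hφ.measurable.comp (h.meas n), K, fun n x => hK _ (abs_le.1 (hM n x))⟩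

end BddFamily

theorem integral_abs_sub_le_of_forall {μ : Measure α} [IsProbabilityMeasure μ] {f g : α → ℝ}
    {ε : ℝ} (h : ∀ x, |f x - g x| ≤ ε) : ∫ x, |f x - g x| ∂μ ≤ ε := by
  have := norm_integral_le_of_norm_le_const (μ := μ) (f := fun x => |f x - g x|)
    (Eventually.of_forall fun x => by simpa using h x)
  rw [probReal_univ, mul_one] at this
  exact (le_abs_self _).trans this

theorem integral_abs_sub_le_add {μ : Measure α} [IsProbabilityMeasure μ] {f g h : α → ℝ}
    (hf : BddMeas f) (hg : BddMeas g) (hh : BddMeas h) :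
    ∫ x, |f x - h x| ∂μ ≤ ∫ x, |f x - g x| ∂μ + ∫ x, |g x - h x| ∂μ := by
  rw [← integral_add ((hf.sub hg).abs.integrable μ) ((hg.sub hh).abs.integrable μ)]
  exact integral_mono ((hf.sub hh).abs.integrable μ)
    (((hf.sub hg).abs.add (hg.sub hh).abs).integrable μ) fun x => abs_sub_le _ _ _

theorem integral_abs_mul_sub_le {μ : Measure α} [IsProbabilityMeasure μ] {f g h : α → ℝ} {M : ℝ}
    (hf : BddMeas f) (hg : BddMeas g) (hh : BddMeas h) (hM : ∀ x, |h x| ≤ M) :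
    ∫ x, |h x * f x - h x * g x| ∂μ ≤ M * ∫ x, |f x - g x| ∂μ := by
  rw [← integral_const_mul]
  refine integral_mono (((hh.mul hf).sub (hh.mul hg)).abs.integrable μ)
    (((BddMeas.const M).mul (hf.sub hg).abs).integrable μ) fun x => ?_
  simp only [← mul_sub, abs_mul]
  exact mul_le_mul_of_nonneg_right (hM x) (abs_nonneg _)

theorem integral_abs_kernelOp_sub_le {μ : Measure α} {ν : Measure β} [IsProbabilityMeasure μ]
    [IsProbabilityMeasure ν] {u : α × β → ℝ} {f g : β → ℝ} {C : ℝ} (hu : BddMeas u)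
    (hf : BddMeas f) (hg : BddMeas g) (hC : ∀ p, |u p| ≤ C) :
    ∫ x, |kernelOp ν u f x - kernelOp ν u g x| ∂μ ≤ C * ∫ y, |f y - g y| ∂ν := by
  have key : ∀ x, |kernelOp ν u f x - kernelOp ν u g x| ≤ C * ∫ y, |f y - g y| ∂ν := by
    intro x
    have hux : BddMeas (fun y => u (x, y)) := hu.comp measurable_prodMk_left
    rw [kernelOp, kernelOp, ← integral_sub ((hux.mul hf).integrable ν) ((hux.mul hg).integrable ν)]
    exact abs_integral_le_integral_abs.trans (integral_abs_mul_sub_le hf hg hux fun y => hC _)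
  exact integral_abs_sub_le_of_forall key

end Families

/-! ### Families which are determined by the tree densities -/

namespace LabelledTree

variable {κ α : Type*} [MeasurableSpace α]

/-- The product of two rooted trees, in which the roots are identified. -/
def mul (t : LabelledTree κ) : LabelledTree κ → LabelledTree κ
  | leaf => t
  | graft k t₁ t₂ => graft k (mul t t₁) t₂

theorem eval_mul (μ : Measure α) (u : κ → α × α → ℝ) (t t' : LabelledTree κ) (x : α) :
    eval μ u (mul t t') x = eval μ u t x * eval μ u t' x := by
  induction t' with
  | leaf => simp [mul, eval]
  | graft k t₁ t₂ h₁ h₂ => simp only [mul, eval, h₁, mul_assoc]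

end LabelledTree

section Good

variable {N κ α : Type*} [MeasurableSpace α]

/-- The span of the density functions of rooted trees. -/
def treeSpan (μ : Measure α) (v : N → κ → α × α → ℝ) : Submodule ℝ (N → α → ℝ) :=
  Submodule.span ℝ (Set.range fun (t : LabelledTree κ) (n : N) => LabelledTree.eval μ (v n) t)

/-- Families which are approximated in mean by linear combinations of density functions of rooted
trees, uniformly for indices close to `a`. -/
def TreeApprox [TopologicalSpace N] (μ : Measure α) (v : N → κ → α × α → ℝ) (a : N)
    (Φ : N → α → ℝ) : Prop :=
  BddFamily Φ ∧ ∀ ε > 0, ∃ Ψ ∈ treeSpan μ v, ∀ᶠ n in 𝓝 a, ∫ x, |Φ n x - Ψ n x| ∂μ ≤ ε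

variable {μ : Measure α} [IsProbabilityMeasure μ] {v : N → κ → α × α → ℝ}
  (hv : ∀ k, BddFamily fun n => v n k)

include hv

theorem LabelledTree.eval_bddFamily (t : LabelledTree κ) :
    BddFamily fun n => LabelledTree.eval μ (v n) t := by
  induction t with
  | leaf => exact BddFamily.const 1
  | graft k t₁ t₂ h₁ h₂ => exact h₁.mul ((hv k).kernelOp h₂)

theorem bddFamily_of_mem_treeSpan {Φ : N → α → ℝ} (h : Φ ∈ treeSpan μ v) : BddFamily Φ := by
  induction h using Submodule.span_induction with
  | mem Φ h =>
    obtain ⟨t, rfl⟩ := h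
    exact LabelledTree.eval_bddFamily hv t
  | zero => exact BddFamily.const 0
  | add Φ Ψ _ _ h h' => exact h.add h'
  | smul c Φ _ h => exact h.const_mul c

omit [IsProbabilityMeasure μ] hv in
theorem mul_mem_treeSpan {Φ Ψ : N → α → ℝ} (h : Φ ∈ treeSpan μ v) (h' : Ψ ∈ treeSpan μ v) :
    Φ * Ψ ∈ treeSpan μ v := by
  have hmul := Submodule.mul_mem_mul h h'
  rw [treeSpan, Submodule.span_mul_span] at hmul
  refine Submodule.span_mono ?_ hmul
  rintro _ ⟨_, ⟨t, rfl⟩, _, ⟨t', rfl⟩, rfl⟩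
  refine ⟨t.mul t', ?_⟩
  ext n x
  exact LabelledTree.eval_mul μ (v n) t t' x

theorem kernelOp_mem_treeSpan (k : κ) {Φ : N → α → ℝ} (h : Φ ∈ treeSpan μ v) :
    (fun n => kernelOp μ (v n k) (Φ n)) ∈ treeSpan μ v := by
  induction h using Submodule.span_induction with
  | mem Φ h =>
    obtain ⟨t, rfl⟩ := h
    -- A new root, joined to the old one by a single edge, realizes the kernel operator.
    refine Submodule.subset_span ⟨.graft k .leaf t, ?_⟩
    ext n x
    simp [LabelledTree.eval]
  | zero =>
    convert (treeSpan μ v).zero_mem using 1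
    ext n x
    simp [kernelOp]
  | add Φ Ψ h h' i i' =>
    convert (treeSpan μ v).add_mem i i' using 1
    ext n x
    exact kernelOp_add ((hv k).bddMeas n) ((bddFamily_of_mem_treeSpan hv h).bddMeas n)
      ((bddFamily_of_mem_treeSpan hv h').bddMeas n) x
  | smul c Φ h i =>
    convert (treeSpan μ v).smul_mem c i using 1
    ext n x
    exact kernelOp_const_mul _ _ c x

variable [TopologicalSpace N] {a : N}

namespace TreeApprox

theorem of_mem_treeSpan {Φ : N → α → ℝ} (h : Φ ∈ treeSpan μ v) : TreeApprox μ v a Φ :=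
  ⟨bddFamily_of_mem_treeSpan hv h, fun ε hε => ⟨Φ, h, by simp [hε.le]⟩⟩

theorem const (c : ℝ) : TreeApprox μ v a fun _ _ => c := by
  refine of_mem_treeSpan hv ?_
  convert (treeSpan μ v).smul_mem c (Submodule.subset_span ⟨.leaf, rfl⟩) using 1
  ext n x
  simp [LabelledTree.eval]

theorem of_approx {Φ : N → α → ℝ} (hΦ : BddFamily Φ)
    (h : ∀ ε > 0, ∃ Ψ, TreeApprox μ v a Ψ ∧ ∀ᶠ n in 𝓝 a, ∫ x, |Φ n x - Ψ n x| ∂μ ≤ ε) :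
    TreeApprox μ v a Φ := by
  refine ⟨hΦ, fun ε hε => ?_⟩
  obtain ⟨Ψ, hΨ, h1⟩ := h (ε / 2) (half_pos hε)
  obtain ⟨Θ, hΘ, h2⟩ := hΨ.2 (ε / 2) (half_pos hε)
  refine ⟨Θ, hΘ, ?_⟩
  filter_upwards [h1, h2] with n h1 h2
  have := integral_abs_sub_le_add (μ := μ) (hΦ.bddMeas n) (hΨ.1.bddMeas n)
    ((bddFamily_of_mem_treeSpan hv hΘ).bddMeas n)
  linarith

theorem add {Φ Ψ : N → α → ℝ} (h : TreeApprox μ v a Φ) (h' : TreeApprox μ v a Ψ) :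
    TreeApprox μ v a fun n x => Φ n x + Ψ n x := by
  refine ⟨h.1.add h'.1, fun ε hε => ?_⟩
  obtain ⟨Φ', hΦ', h1⟩ := h.2 (ε / 2) (half_pos hε)
  obtain ⟨Ψ', hΨ', h2⟩ := h'.2 (ε / 2) (half_pos hε)
  refine ⟨Φ' + Ψ', (treeSpan μ v).add_mem hΦ' hΨ', ?_⟩
  filter_upwards [h1, h2] with n h1 h2
  have b1 := ((h.1.bddMeas n).sub ((bddFamily_of_mem_treeSpan hv hΦ').bddMeas n)).abs
  have b2 := ((h'.1.bddMeas n).sub ((bddFamily_of_mem_treeSpan hv hΨ').bddMeas n)).abs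
  have b3 := (((h.1.add h'.1).bddMeas n).sub
    ((bddFamily_of_mem_treeSpan hv ((treeSpan μ v).add_mem hΦ' hΨ')).bddMeas n)).abs
  have : ∫ x, |Φ n x + Ψ n x - (Φ' + Ψ') n x| ∂μ ≤
      ∫ x, |Φ n x - Φ' n x| ∂μ + ∫ x, |Ψ n x - Ψ' n x| ∂μ := by
    rw [← integral_add (b1.integrable μ) (b2.integrable μ)]
    refine integral_mono (b3.integrable μ) ((b1.add b2).integrable μ) fun x => ?_
    calc |Φ n x + Ψ n x - (Φ' + Ψ') n x| = |(Φ n x - Φ' n x) + (Ψ n x - Ψ' n x)| := by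
          simp only [Pi.add_apply]; ring_nf
      _ ≤ _ := abs_add_le _ _
  linarith

theorem mul_of_mem_treeSpan {Φ Ψ : N → α → ℝ} (h : TreeApprox μ v a Φ) (h' : Ψ ∈ treeSpan μ v) :
    TreeApprox μ v a fun n x => Ψ n x * Φ n x := by
  have bΨ := bddFamily_of_mem_treeSpan hv h'
  refine ⟨bΨ.mul h.1, fun ε hε => ?_⟩
  obtain ⟨M, hM0, hM⟩ := bΨ.exists_pos
  obtain ⟨Φ', hΦ', h1⟩ := h.2 (ε / M) (by positivity)
  refine ⟨Ψ * Φ', mul_mem_treeSpan h' hΦ', ?_⟩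
  filter_upwards [h1] with n h1
  refine (integral_abs_mul_sub_le (h.1.bddMeas n)
    ((bddFamily_of_mem_treeSpan hv hΦ').bddMeas n) (bΨ.bddMeas n) (hM n)).trans ?_
  rwa [le_div_iff₀' hM0] at h1

/-- An L¹ error in one factor costs a sup bound of the other, and the sup norm of an approximant is
not controlled by the error. Hence two stages: Ψ is approximated against the bounded Φ, and Φ only
after the approximant of Ψ is fixed. -/
theorem mul {Φ Ψ : N → α → ℝ} (h : TreeApprox μ v a Φ) (h' : TreeApprox μ v a Ψ) :
    TreeApprox μ v a fun n x => Φ n x * Ψ n x := by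
  refine of_approx hv (h.1.mul h'.1) fun ε hε => ?_
  obtain ⟨M, hM0, hM⟩ := h.1.exists_pos
  obtain ⟨Ψ', hΨ', h1⟩ := h'.2 (ε / M) (by positivity)
  refine ⟨fun n x => Φ n x * Ψ' n x, ?_, ?_⟩
  · simpa only [mul_comm] using mul_of_mem_treeSpan hv h hΨ'
  · filter_upwards [h1] with n h1
    refine (integral_abs_mul_sub_le (h'.1.bddMeas n)
      ((bddFamily_of_mem_treeSpan hv hΨ').bddMeas n) (h.1.bddMeas n) (hM n)).trans ?_
    rwa [le_div_iff₀' hM0] at h1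

theorem const_mul {Φ : N → α → ℝ} (h : TreeApprox μ v a Φ) (c : ℝ) :
    TreeApprox μ v a fun n x => c * Φ n x := (const hv c).mul hv h

theorem sub {Φ Ψ : N → α → ℝ} (h : TreeApprox μ v a Φ) (h' : TreeApprox μ v a Ψ) :
    TreeApprox μ v a fun n x => Φ n x - Ψ n x := by
  simpa [sub_eq_add_neg] using h.add hv (h'.const_mul hv (-1))

theorem sum {ι : Type*} (s : Finset ι) {F : ι → N → α → ℝ} (h : ∀ i, TreeApprox μ v a (F i)) :
    TreeApprox μ v a fun n x => ∑ i ∈ s, F i n x := by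
  classical
  induction s using Finset.induction_on with
  | empty => simpa using const hv 0
  | insert i s hi ih =>
    simp only [Finset.sum_insert hi]
    exact (h i).add hv ih

theorem prod {ι : Type*} (s : Finset ι) {F : ι → N → α → ℝ} (h : ∀ i, TreeApprox μ v a (F i)) :
    TreeApprox μ v a fun n x => ∏ i ∈ s, F i n x := by
  classical
  induction s using Finset.induction_on with
  | empty => simpa using const hv 1
  | insert i s hi ih =>
    simp only [Finset.prod_insert hi]
    exact (h i).mul hv ih

theorem kernelOp {Φ : N → α → ℝ} (k : κ) (h : TreeApprox μ v a Φ) :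
    TreeApprox μ v a fun n => kernelOp μ (v n k) (Φ n) := by
  refine ⟨(hv k).kernelOp h.1, fun ε hε => ?_⟩
  obtain ⟨C, hC0, hC⟩ := (hv k).exists_pos
  obtain ⟨Φ', hΦ', h1⟩ := h.2 (ε / C) (by positivity)
  refine ⟨_, kernelOp_mem_treeSpan hv k hΦ', ?_⟩
  filter_upwards [h1] with n h1
  refine (integral_abs_kernelOp_sub_le ((hv k).bddMeas n) (h.1.bddMeas n)
    ((bddFamily_of_mem_treeSpan hv hΦ').bddMeas n) (hC n)).trans ?_
  rwa [le_div_iff₀' hC0] at h1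

theorem polynomial_eval {Φ : N → α → ℝ} (h : TreeApprox μ v a Φ) (p : Polynomial ℝ) :
    TreeApprox μ v a fun n x => p.eval (Φ n x) := by
  induction p using Polynomial.induction_on with
  | C c => simpa using const hv c
  | add p q hp hq => simpa using hp.add hv hq
  | monomial m c ih =>
    have := ih.mul hv h
    simpa [pow_succ, mul_assoc] using this

/-- Weierstrass approximation on an interval that contains all values of the family, for all indices
at once. -/
theorem continuous_comp {Φ : N → α → ℝ} (h : TreeApprox μ v a Φ) {φ : ℝ → ℝ}
    (hφ : Continuous φ) : TreeApprox μ v a fun n x => φ (Φ n x) := by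
  refine of_approx hv (h.1.continuous_comp hφ) fun ε hε => ?_
  obtain ⟨M, hM⟩ := h.1.bdd
  obtain ⟨p, hp⟩ := exists_polynomial_near_of_continuousOn (-M) M φ hφ.continuousOn ε hε
  refine ⟨_, polynomial_eval hv h p, Eventually.of_forall fun n =>
    integral_abs_sub_le_of_forall fun x => ?_⟩
  rw [abs_sub_comm]
  exact (hp _ (abs_le.1 (hM n x))).le

variable (hconv : ∀ t : LabelledTree κ,
  ContinuousAt (fun n => ∫ x, LabelledTree.eval μ (v n) t x ∂μ) a)

include hconv

omit [TopologicalSpace N] in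
omit hconv in
theorem abs_integral_sub_le {f g : α → ℝ} (hf : BddMeas f) (hg : BddMeas g) :
    |∫ x, f x ∂μ - ∫ x, g x ∂μ| ≤ ∫ x, |f x - g x| ∂μ := by
  rw [← integral_sub (hf.integrable μ) (hg.integrable μ)]
  exact abs_integral_le_integral_abs

theorem continuousAt_integral {Φ : N → α → ℝ} (h : TreeApprox μ v a Φ) :
    ContinuousAt (fun n => ∫ x, Φ n x ∂μ) a := by
  have key : ∀ Ψ ∈ treeSpan μ v, ContinuousAt (fun n => ∫ x, Ψ n x ∂μ) a := by
    intro Ψ hΨ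
    induction hΨ using Submodule.span_induction with
    | mem Φ h =>
      obtain ⟨t, rfl⟩ := h
      exact hconv t
    | zero => simpa using continuousAt_const
    | add Φ Ψ h h' i i' =>
      have : ∀ n, ∫ x, (Φ + Ψ) n x ∂μ = ∫ x, Φ n x ∂μ + ∫ x, Ψ n x ∂μ := fun n =>
        integral_add (((bddFamily_of_mem_treeSpan hv h).bddMeas n).integrable μ)
          (((bddFamily_of_mem_treeSpan hv h').bddMeas n).integrable μ)
      simp only [this]
      exact i.add i'
    | smul c Φ h i =>
      have : ∀ n, ∫ x, (c • Φ) n x ∂μ = c * ∫ x, Φ n x ∂μ := fun n => integral_const_mul _ _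
      simp only [this]
      exact continuousAt_const.mul i
  rw [Metric.continuousAt_iff']
  intro ε hε
  obtain ⟨Ψ, hΨ, h1⟩ := h.2 (ε / 3) (by positivity)
  have bΨ := bddFamily_of_mem_treeSpan hv hΨ
  have h2 := Metric.continuousAt_iff'.1 (key Ψ hΨ) (ε / 3) (by positivity)
  -- The neighbourhood filter is not punctured, so the approximation also holds at a itself.
  have h3 := abs_le.1 ((abs_integral_sub_le hv (h.1.bddMeas a) (bΨ.bddMeas a)).trans h1.self_of_nhds)
  filter_upwards [h1, h2] with n h1 h2
  have h4 := abs_le.1 ((abs_integral_sub_le hv (h.1.bddMeas n) (bΨ.bddMeas n)).trans h1)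
  rw [Real.dist_eq, abs_lt] at h2 ⊢
  constructor <;> linarith

/-- The error of the steep ramp φ as a replacement for the jump at c is bounded by a narrow tent ψ
around c. At a the tent has small integral because the level c carries no mass, and continuity of
its integral extends this to n near a. Level sets at other indices are not restricted. -/
theorem indicator_lt {Φ : N → α → ℝ} (h : TreeApprox μ v a Φ) {c : ℝ}
    (hc : μ {x | Φ a x = c} = 0) :
    TreeApprox μ v a fun n x => if c < Φ n x then 1 else 0 := by
  have hB : BddFamily fun n x => if c < Φ n x then (1 : ℝ) else 0 :=
    ⟨fun n => Measurable.ite (measurableSet_lt measurable_const (h.1.meas n)) measurable_const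
      measurable_const, 1, fun n x => by split_ifs <;> simp⟩
  refine of_approx hv hB fun ε hε => ?_
  let ψ : ℕ → ℝ → ℝ := fun m y => max 0 (1 - m * |y - c|)
  have hψc : ∀ m, Continuous (ψ m) := fun m => by fun_prop
  let φ : ℕ → ℝ → ℝ := fun m y => max 0 (min 1 (m * (y - c)))
  have hφc : ∀ m, Continuous (φ m) := fun m => by fun_prop
  have hlim : Tendsto (fun m => ∫ x, ψ m (Φ a x) ∂μ) atTop (𝓝 0) := by
    have : Tendsto (fun m => ∫ x, ψ m (Φ a x) ∂μ) atTop (𝓝 (∫ _, (0 : ℝ) ∂μ)) := by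
      refine tendsto_integral_of_dominated_convergence (fun _ => 1) (fun m =>
        ((hψc m).measurable.comp (h.1.meas a)).aestronglyMeasurable) (integrable_const _)
        (fun m => Eventually.of_forall fun x => ?_) ?_
      · have h0 : 0 ≤ (m : ℝ) * |Φ a x - c| := by positivity
        rw [Real.norm_of_nonneg (le_max_left _ _)]
        exact max_le zero_le_one (by linarith)
      · filter_upwards [measure_eq_zero_iff_ae_notMem.1 hc] with x hx
        have hpos : 0 < |Φ a x - c| := abs_pos.2 (sub_ne_zero.2 hx)
        obtain ⟨m₀, hm₀⟩ := exists_nat_gt (1 / |Φ a x - c|)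
        refine tendsto_const_nhds.congr' ?_
        filter_upwards [eventually_ge_atTop m₀] with m hm
        have h1 : 1 ≤ (m : ℝ) * |Φ a x - c| := by
          rw [div_lt_iff₀ hpos] at hm₀
          refine hm₀.le.trans (mul_le_mul_of_nonneg_right (by exact_mod_cast hm) hpos.le)
        exact (max_eq_left (by linarith)).symm
    simpa using this
  obtain ⟨m, hm⟩ := (hlim.eventually (gt_mem_nhds hε)).exists
  refine ⟨_, continuous_comp hv h (hφc m), ?_⟩
  have hcont := continuousAt_integral hv hconv (continuous_comp hv h (hψc m))
  filter_upwards [hcont.eventually (gt_mem_nhds hm)] with n hn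
  refine le_trans (integral_mono (((hB.bddMeas n).sub
    ((h.1.continuous_comp (hφc m)).bddMeas n)).abs.integrable μ)
    (((h.1.continuous_comp (hψc m)).bddMeas n).integrable μ) fun x => ?_) hn.le
  have hm0 : (0 : ℝ) ≤ m := Nat.cast_nonneg m
  change |(if c < Φ n x then (1 : ℝ) else 0) - max 0 (min 1 (m * (Φ n x - c)))| ≤
    max 0 (1 - m * |Φ n x - c|)
  by_cases hcx : c < Φ n x
  · have h0 : 0 < Φ n x - c := sub_pos.2 hcx
    have h1 : 0 ≤ (m : ℝ) * (Φ n x - c) := by positivity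
    rw [if_pos hcx, max_eq_right (le_min zero_le_one h1), abs_of_pos h0]
    rcases le_total (1 : ℝ) (m * (Φ n x - c)) with h2 | h2
    · simp [min_eq_left h2]
    · rw [min_eq_right h2, abs_of_nonneg (by linarith)]
      exact le_max_right _ _
  · have h0 : Φ n x - c ≤ 0 := by linarith [not_lt.1 hcx]
    have h1 : (m : ℝ) * (Φ n x - c) ≤ 0 := mul_nonpos_of_nonneg_of_nonpos hm0 h0
    rw [if_neg hcx, max_eq_left ((min_le_right _ _).trans h1), sub_self, abs_zero]
    exact le_max_left _ _

omit [TopologicalSpace N] hconv in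
-- Each function charges at most countably many levels.
theorem exists_threshold {L : Type*} [Finite L] {F : L → N → α → ℝ} (hF : ∀ l, BddFamily (F l))
    (a : N) {s t : ℝ} (hst : s < t) : ∃ c, s < c ∧ c < t ∧ ∀ l, μ {x | F l a x = c} = 0 := by
  have h1 : (⋃ l, {c : ℝ | 0 < μ {x | F l a x = c}}).Countable :=
    Set.countable_iUnion fun l => Measure.countable_meas_level_set_pos ((hF l).meas a)
  obtain ⟨c, hc, h2⟩ := (h1.dense_compl ℝ).exists_between hst
  refine ⟨c, h2.1, h2.2, fun l => ?_⟩
  by_contra hne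
  exact hc (Set.mem_iUnion.2 ⟨l, pos_iff_ne_zero.2 hne⟩)

/-- Finitely many approximable families can be discretized simultaneously, by labels with
approximable level sets. -/
theorem exists_label {L : Type*} [Fintype L] {F : L → N → α → ℝ}
    (hF : ∀ l, TreeApprox μ v a (F l)) {δ : ℝ} (hδ : 0 < δ) :
    ∃ (m : ℕ) (c : N → α → (L → Fin m → Bool)), (∀ n, Measurable (c n)) ∧
      (∀ i, TreeApprox μ v a fun n x => if c n x = i then 1 else 0) ∧
      ∀ l n n' x x', c n x = c n' x' → |F l n x - F l n' x'| ≤ δ := by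
  classical
  have hM : ∃ M, ∀ l n x, |F l n x| ≤ M := by
    choose M hM using fun l => (hF l).1.bdd
    exact ⟨∑ l, |M l|, fun l n x => (hM l n x).trans ((le_abs_self _).trans
      (Finset.single_le_sum (f := fun l => |M l|) (fun _ _ => abs_nonneg _) (Finset.mem_univ l)))⟩
  obtain ⟨M, hM⟩ := hM
  -- One threshold is chosen in each of m consecutive intervals of length δ/2, which together cover
  -- the range of all the functions.
  obtain ⟨m, hm⟩ := exists_nat_gt (2 * (|M| + 1) / (δ / 2))
  have hth : ∀ j : Fin m, ∃ c, -|M| - 1 + j * (δ / 2) < c ∧ c < -|M| - 1 + j * (δ / 2) + δ / 2 ∧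
      ∀ l, μ {x | F l a x = c} = 0 := fun j =>
    exists_threshold hv (fun l => (hF l).1) a (by linarith)
  choose c hc1 hc2 hc3 using hth
  refine ⟨m, fun n x l j => decide (c j < F l n x), fun n => ?_, fun i => ?_, ?_⟩
  · refine measurable_pi_lambda _ fun l => measurable_pi_lambda _ fun j => ?_
    refine measurable_to_bool ?_
    convert measurableSet_lt (measurable_const (a := c j)) ((hF l).1.meas n) using 1
    ext x
    simp
  · have hprod : ∀ n x, (if (fun l j => decide (c j < F l n x)) = i then (1 : ℝ) else 0) =
        ∏ l, ∏ j, if decide (c j < F l n x) = i l j then (1 : ℝ) else 0 := by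
      intro n x
      split_ifs with h
      · rw [← h]; simp
      · rw [funext_iff, not_forall] at h
        obtain ⟨l, h⟩ := h
        rw [funext_iff, not_forall] at h
        obtain ⟨j, h⟩ := h
        symm
        refine Finset.prod_eq_zero (Finset.mem_univ l) (Finset.prod_eq_zero (Finset.mem_univ j) ?_)
        rw [if_neg h]
    simp only [hprod]
    refine prod hv _ fun l => prod hv _ fun j => ?_
    have hi := indicator_lt hv hconv (hF l) (hc3 j l)
    cases i l j
    · convert (const hv 1).sub hv hi using 3 with n x
      by_cases h : c j < F l n x <;> simp [h]
    · simpa using hi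
  · have key : ∀ l n n' x x', (∀ j, decide (c j < F l n x) = decide (c j < F l n' x')) →
        F l n x - F l n' x' ≤ δ := by
      intro l n n' x x' h
      by_contra! hlt
      have hx := abs_le.1 (hM l n x)
      have hx' := abs_le.1 (hM l n' x')
      have hMa := le_abs_self M
      have hy0 : 0 ≤ (F l n' x' + |M| + 1) / (δ / 2) := by
        apply div_nonneg <;> linarith
      -- The first interval that starts at or above the smaller value. It ends before that value
      -- plus δ, so its threshold separates the two values, contradicting equal labels.
      set q := ⌈(F l n' x' + |M| + 1) / (δ / 2)⌉₊ with hq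
      have q1 : F l n' x' + |M| + 1 ≤ q * (δ / 2) := by
        rw [← div_le_iff₀ (by positivity)]; exact Nat.le_ceil _
      have q2 : q * (δ / 2) < F l n' x' + |M| + 1 + δ / 2 := by
        have := Nat.ceil_lt_add_one hy0
        rw [← hq] at this
        calc (q : ℝ) * (δ / 2) < ((F l n' x' + |M| + 1) / (δ / 2) + 1) * (δ / 2) := by gcongr
          _ = _ := by field_simp
      have q3 : q < m := by
        have h1 : (m : ℝ) * (δ / 2) > 2 * (|M| + 1) := by
          rwa [div_lt_iff₀ (by positivity)] at hm
        have h2 : (q : ℝ) * (δ / 2) < m * (δ / 2) := by linarith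
        exact_mod_cast lt_of_mul_lt_mul_right h2 (by positivity)
      have := h ⟨q, q3⟩
      have h1 := hc1 ⟨q, q3⟩
      have h2 := hc2 ⟨q, q3⟩
      simp only at h1 h2
      have t1 : c ⟨q, q3⟩ < F l n x := by linarith
      have t2 : ¬ c ⟨q, q3⟩ < F l n' x' := by linarith
      simp [t1, t2] at this
    intro l n n' x x' h
    have h1 : ∀ j, decide (c j < F l n x) = decide (c j < F l n' x') := fun j =>
      congrFun (congrFun h l) j
    exact abs_le.2 ⟨by linarith [key l n' n x' x fun j => (h1 j).symm], key l n n' x x' h1⟩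

end TreeApprox

end Good

/-! ### Couplings which match the cells of two finite partitions -/

section BlockCoupling

/-- Two probability vectors have a coupling whose off-diagonal mass is at most their distance. -/
theorem exists_matrix_coupling {ι : Type*} [Fintype ι] [DecidableEq ι] {p q : ι → ℝ}
    (hp : ∀ i, 0 ≤ p i) (hq : ∀ i, 0 ≤ q i) (hpq : ∑ i, p i = ∑ i, q i) :
    ∃ π : ι → ι → ℝ, (∀ i j, 0 ≤ π i j) ∧ (∀ i, ∑ j, π i j = p i) ∧ (∀ j, ∑ i, π i j = q j) ∧
      ∑ i, ∑ j, (if i = j then 0 else π i j) ≤ ∑ i, |p i - q i| := by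
  -- The common mass stays on the diagonal; the excesses a and b have the same total t and are
  -- coupled independently. If t = 0 they vanish, and division by zero is harmless.
  set a : ι → ℝ := fun i => p i - min (p i) (q i) with ha
  set b : ι → ℝ := fun i => q i - min (p i) (q i) with hb
  have ha0 : ∀ i, 0 ≤ a i := fun i => sub_nonneg.2 (min_le_left _ _)
  have hb0 : ∀ i, 0 ≤ b i := fun i => sub_nonneg.2 (min_le_right _ _)
  set t := ∑ i, a i with ht
  have hbt : ∑ i, b i = t := by
    simp only [ht, ha, hb, Finset.sum_sub_distrib, hpq]
  have ht0 : 0 ≤ t := Finset.sum_nonneg fun i _ => ha0 i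
  have row : ∀ i, ∑ j, a i * b j / t = a i := by
    intro i
    rw [← Finset.sum_div, ← Finset.mul_sum, hbt]
    by_cases h : t = 0
    · have := (Finset.sum_eq_zero_iff_of_nonneg fun i _ => ha0 i).1 (ht ▸ h) i (Finset.mem_univ i)
      simp [this]
    · field_simp
  have col : ∀ j, ∑ i, a i * b j / t = b j := by
    intro j
    rw [← Finset.sum_div, ← Finset.sum_mul, ← ht]
    by_cases h : t = 0
    · have := (Finset.sum_eq_zero_iff_of_nonneg fun i _ => hb0 i).1 (hbt.trans h) j
        (Finset.mem_univ j)
      simp [this]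
    · field_simp
  refine ⟨fun i j => (if i = j then min (p i) (q i) else 0) + a i * b j / t, fun i j => ?_,
    fun i => ?_, fun j => ?_, ?_⟩
  · refine add_nonneg ?_ (div_nonneg (mul_nonneg (ha0 i) (hb0 j)) ht0)
    split_ifs
    · exact le_min (hp i) (hq i)
    · exact le_rfl
  · rw [Finset.sum_add_distrib, row]
    simp [ha]
  · rw [Finset.sum_add_distrib, col]
    simp [hb]
  · refine Finset.sum_le_sum fun i _ => ?_
    calc ∑ j, (if i = j then 0 else (if i = j then min (p i) (q i) else 0) + a i * b j / t)
        ≤ ∑ j, a i * b j / t := by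
          refine Finset.sum_le_sum fun j _ => ?_
          split_ifs
          · exact div_nonneg (mul_nonneg (ha0 i) (hb0 j)) ht0
          · simp
      _ = a i := row i
      _ ≤ |p i - q i| := by
          simp only [ha]
          rcases min_choice (p i) (q i) with h | h <;> rw [h]
          · simp
          · exact le_abs_self _

variable {α β ι : Type*} [MeasurableSpace α] [MeasurableSpace β] [Fintype ι]
  [MeasurableSpace ι] [MeasurableSingletonClass ι]
  {μ : Measure α} {ν : Measure β} [IsProbabilityMeasure μ] [IsProbabilityMeasure ν]

theorem integral_comp_label {c : α → ι} (hc : Measurable c) (f : ι → ℝ) :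
    ∫ x, f (c x) ∂μ = ∑ i, μ.real (c ⁻¹' {i}) * f i := by
  have := Measure.isProbabilityMeasure_map (μ := μ) hc.aemeasurable
  rw [← integral_map (f := f) hc.aemeasurable (measurable_of_finite f).aestronglyMeasurable,
    integral_fintype (Integrable.of_finite)]
  refine Finset.sum_congr rfl fun i _ => ?_
  rw [map_measureReal_apply hc (measurableSet_singleton i), smul_eq_mul]

theorem bddMeas_comp_label {c : α → ι} (hc : Measurable c) (f : ι → ℝ) :
    BddMeas (fun x => f (c x)) :=
  ⟨(measurable_of_finite f).comp hc, ∑ i, |f i|, fun x =>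
    Finset.single_le_sum (f := fun i => |f i|) (fun _ _ => abs_nonneg _) (Finset.mem_univ (c x))⟩

open Classical in
-- A coupling π of the two label distributions is lifted with density π i j / (p i q j) on products
-- of cells. Given one coordinate, the law of the other depends only on the label of the first; so
-- conditional averages of test functions are functions of the label.
theorem exists_block_coupling {c₁ : α → ι} {c₂ : β → ι} (h₁ : Measurable c₁)
    (h₂ : Measurable c₂) :
    ∃ γ ∈ couplings μ ν,
      (∀ ψ : β → ℝ, BddMeas ψ → (∀ y, 0 ≤ ψ y ∧ ψ y ≤ 1) → ∃ d : ι → ℝ,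
        (∀ i, 0 ≤ d i ∧ d i ≤ 1) ∧ ∀ φ : α → ℝ, BddMeas φ →
          ∫ p, φ p.1 * ψ p.2 ∂(γ : Measure (α × β)) = ∫ x, φ x * d (c₁ x) ∂μ) ∧
      (∀ φ : α → ℝ, BddMeas φ → (∀ x, 0 ≤ φ x ∧ φ x ≤ 1) → ∃ d : ι → ℝ,
        (∀ i, 0 ≤ d i ∧ d i ≤ 1) ∧ ∀ ψ : β → ℝ, BddMeas ψ →
          ∫ p, φ p.1 * ψ p.2 ∂(γ : Measure (α × β)) = ∫ y, ψ y * d (c₂ y) ∂ν) ∧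
      ∫ p, (if c₁ p.1 = c₂ p.2 then (0 : ℝ) else 1) ∂(γ : Measure (α × β)) ≤
        ∑ i, |μ.real (c₁ ⁻¹' {i}) - ν.real (c₂ ⁻¹' {i})| := by
  set p : ι → ℝ := fun i => μ.real (c₁ ⁻¹' {i}) with hp
  set q : ι → ℝ := fun i => ν.real (c₂ ⁻¹' {i}) with hq
  have hp1 : ∑ i, p i = 1 := by
    have := integral_comp_label (μ := μ) h₁ (fun _ => 1)
    simpa using this.symm
  have hq1 : ∑ i, q i = 1 := by
    have := integral_comp_label (μ := ν) h₂ (fun _ => 1)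
    simpa using this.symm
  obtain ⟨π, hπ0, hπr, hπc, hπd⟩ := exists_matrix_coupling (p := p) (q := q)
    (fun i => measureReal_nonneg) (fun i => measureReal_nonneg) (hp1.trans hq1.symm)
  have hπp : ∀ i j, p i = 0 → π i j = 0 := fun i j h =>
    (Finset.sum_eq_zero_iff_of_nonneg fun j _ => hπ0 i j).1 ((hπr i).trans h) j (Finset.mem_univ j)
  have hπq : ∀ i j, q j = 0 → π i j = 0 := fun i j h =>
    (Finset.sum_eq_zero_iff_of_nonneg fun i _ => hπ0 i j).1 ((hπc j).trans h) i (Finset.mem_univ i)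
  -- On null cells the quotient is 0 by convention; the marginal identities fail there, but only on
  -- a null set.
  set ρ : ι → ι → ℝ := fun i j => π i j / (p i * q j) with hρ
  have hρ0 : ∀ i j, 0 ≤ ρ i j := fun i j =>
    div_nonneg (hπ0 i j) (mul_nonneg measureReal_nonneg measureReal_nonneg)
  have hρq : ∀ i, ∑ j, q j * ρ i j = if p i = 0 then 0 else 1 := by
    intro i
    split_ifs with h
    · exact Finset.sum_eq_zero fun j _ => by simp [hρ, h]
    · calc ∑ j, q j * ρ i j = ∑ j, π i j / p i := by
            refine Finset.sum_congr rfl fun j _ => ?_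
            by_cases hj : q j = 0
            · simp [hj, hπq i j hj]
            · simp only [hρ]; field_simp
        _ = 1 := by rw [← Finset.sum_div, hπr, div_self h]
  have hρp : ∀ j, ∑ i, p i * ρ i j = if q j = 0 then 0 else 1 := by
    intro j
    split_ifs with h
    · exact Finset.sum_eq_zero fun i _ => by simp [hρ, h]
    · calc ∑ i, p i * ρ i j = ∑ i, π i j / q j := by
            refine Finset.sum_congr rfl fun i _ => ?_
            by_cases hi : p i = 0
            · simp [hi, hπp i j hi]
            · simp only [hρ]; field_simp
        _ = 1 := by rw [← Finset.sum_div, hπc, div_self h]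
  have hρi : ∀ i, ∫ y, ρ i (c₂ y) ∂ν = if p i = 0 then 0 else 1 := fun i =>
    (integral_comp_label h₂ (ρ i)).trans (hρq i)
  have hρj : ∀ j, ∫ x, ρ (c₁ x) j ∂μ = if q j = 0 then 0 else 1 := fun j =>
    (integral_comp_label h₁ fun i => ρ i j).trans (hρp j)
  have hpae : ∀ᵐ x ∂μ, p (c₁ x) ≠ 0 := by
    have : ∀ i, ∀ᵐ x ∂μ, p i = 0 → c₁ x ≠ i := fun i => by
      by_cases h : p i = 0
      · have h0 : μ (c₁ ⁻¹' {i}) = 0 := (measureReal_eq_zero_iff (measure_ne_top μ _)).1 h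
        filter_upwards [measure_eq_zero_iff_ae_notMem.1 h0] with x hx _ using hx
      · simp [h]
    filter_upwards [ae_all_iff.2 this] with x hx h using hx _ h rfl
  have hqae : ∀ᵐ y ∂ν, q (c₂ y) ≠ 0 := by
    have : ∀ i, ∀ᵐ x ∂ν, q i = 0 → c₂ x ≠ i := fun i => by
      by_cases h : q i = 0
      · have h0 : ν (c₂ ⁻¹' {i}) = 0 := (measureReal_eq_zero_iff (measure_ne_top ν _)).1 h
        filter_upwards [measure_eq_zero_iff_ae_notMem.1 h0] with x hx _ using hx
      · simp [h]
    filter_upwards [ae_all_iff.2 this] with x hx h using hx _ h rfl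
  have hkb : BddMeas (fun z : α × β => ρ (c₁ z.1) (c₂ z.2)) :=
    bddMeas_comp_label (c := fun z : α × β => (c₁ z.1, c₂ z.2))
      ((h₁.comp measurable_fst).prodMk (h₂.comp measurable_snd)) fun ij : ι × ι => ρ ij.1 ij.2
  set k : α × β → ℝ≥0∞ := fun z => ENNReal.ofReal (ρ (c₁ z.1) (c₂ z.2)) with hk
  have hkm : Measurable k := hkb.meas.ennreal_ofReal
  set γ : Measure (α × β) := (μ.prod ν).withDensity k with hγ
  have hint : ∀ F : α × β → ℝ, ∫ z, F z ∂γ = ∫ z, ρ (c₁ z.1) (c₂ z.2) * F z ∂(μ.prod ν) := by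
    intro F
    rw [hγ, integral_withDensity_eq_integral_toReal_smul hkm
      (Eventually.of_forall fun _ => ENNReal.ofReal_lt_top)]
    refine integral_congr_ae (Eventually.of_forall fun z => ?_)
    simp only [hk, smul_eq_mul, ENNReal.toReal_ofReal (hρ0 _ _)]
  have hfst : γ.map Prod.fst = μ := by
    ext A hA
    rw [Measure.map_apply measurable_fst hA, hγ, withDensity_apply _ (measurable_fst hA),
      ← Set.prod_univ, ← Measure.prod_restrict, Measure.restrict_univ,
      lintegral_prod _ hkm.aemeasurable]
    have : ∀ᵐ x ∂μ.restrict A, ∫⁻ y, k (x, y) ∂ν = 1 := by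
      refine ae_restrict_of_ae ?_
      filter_upwards [hpae] with x hx
      have hb : BddMeas (fun y => ρ (c₁ x) (c₂ y)) := bddMeas_comp_label h₂ _
      simp only [hk]
      rw [← ofReal_integral_eq_lintegral_ofReal (hb.integrable ν)
        (Eventually.of_forall fun y => hρ0 _ _), hρi, if_neg hx, ENNReal.ofReal_one]
    rw [lintegral_congr_ae this]
    simp
  have hsnd : γ.map Prod.snd = ν := by
    ext A hA
    rw [Measure.map_apply measurable_snd hA, hγ, withDensity_apply _ (measurable_snd hA),
      ← Set.univ_prod, ← Measure.prod_restrict, Measure.restrict_univ,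
      lintegral_prod_symm _ hkm.aemeasurable]
    have : ∀ᵐ y ∂ν.restrict A, ∫⁻ x, k (x, y) ∂μ = 1 := by
      refine ae_restrict_of_ae ?_
      filter_upwards [hqae] with y hy
      have hb : BddMeas (fun x => ρ (c₁ x) (c₂ y)) := bddMeas_comp_label h₁ fun i => ρ i (c₂ y)
      simp only [hk]
      rw [← ofReal_integral_eq_lintegral_ofReal (hb.integrable μ)
        (Eventually.of_forall fun y => hρ0 _ _), hρj, if_neg hy, ENNReal.ofReal_one]
    rw [lintegral_congr_ae this]
    simp
  have hprob : IsProbabilityMeasure γ := by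
    have h := Measure.isProbabilityMeasure_map_iff (μ := γ) (f := Prod.fst)
      measurable_fst.aemeasurable
    rw [← h, hfst]
    infer_instance
  refine ⟨⟨γ, hprob⟩, ⟨hfst, hsnd⟩, fun ψ hψ hψ1 => ?_, fun φ hφ hφ1 => ?_, ?_⟩
  · have hb : ∀ i, BddMeas (fun y => ρ i (c₂ y)) := fun i => bddMeas_comp_label h₂ _
    refine ⟨fun i => ∫ y, ρ i (c₂ y) * ψ y ∂ν, fun i => ⟨integral_nonneg fun y =>
      mul_nonneg (hρ0 _ _) (hψ1 y).1, ?_⟩, fun φ hφ => ?_⟩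
    · refine (integral_mono (((hb i).mul hψ).integrable ν) ((hb i).integrable ν) fun y =>
        mul_le_of_le_one_right (hρ0 _ _) (hψ1 y).2).trans ?_
      rw [hρi]
      split_ifs <;> norm_num
    · change ∫ z, φ z.1 * ψ z.2 ∂γ = _
      rw [hint, integral_prod _ ((hkb.mul ((hφ.comp measurable_fst).mul
        (hψ.comp measurable_snd))).integrable _)]
      refine integral_congr_ae (Eventually.of_forall fun x => ?_)
      simp only
      rw [← integral_const_mul]
      exact integral_congr_ae (Eventually.of_forall fun y => by ring)
  · have hb : ∀ j, BddMeas (fun x => ρ (c₁ x) j) := fun j => bddMeas_comp_label h₁ fun i => ρ i j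
    refine ⟨fun j => ∫ x, ρ (c₁ x) j * φ x ∂μ, fun i => ⟨integral_nonneg fun y =>
      mul_nonneg (hρ0 _ _) (hφ1 y).1, ?_⟩, fun ψ hψ => ?_⟩
    · refine (integral_mono (((hb i).mul hφ).integrable μ) ((hb i).integrable μ) fun y =>
        mul_le_of_le_one_right (hρ0 _ _) (hφ1 y).2).trans ?_
      rw [hρj]
      split_ifs <;> norm_num
    · change ∫ z, φ z.1 * ψ z.2 ∂γ = _
      rw [hint, integral_prod_symm _ ((hkb.mul ((hφ.comp measurable_fst).mul
        (hψ.comp measurable_snd))).integrable _)]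
      refine integral_congr_ae (Eventually.of_forall fun y => ?_)
      simp only
      rw [← integral_const_mul]
      exact integral_congr_ae (Eventually.of_forall fun x => by ring)
  · change ∫ z, (if c₁ z.1 = c₂ z.2 then (0 : ℝ) else 1) ∂γ ≤ _
    have hb : BddMeas (fun z : α × β => ρ (c₁ z.1) (c₂ z.2) *
        (if c₁ z.1 = c₂ z.2 then (0 : ℝ) else 1)) :=
      bddMeas_comp_label (c := fun z : α × β => (c₁ z.1, c₂ z.2))
        ((h₁.comp measurable_fst).prodMk (h₂.comp measurable_snd))
        fun ij : ι × ι => ρ ij.1 ij.2 * (if ij.1 = ij.2 then (0 : ℝ) else 1)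
    rw [hint, integral_prod _ (hb.integrable _)]
    simp only [fun x => integral_comp_label (μ := ν) h₂
      (fun j => ρ (c₁ x) j * (if c₁ x = j then (0 : ℝ) else 1))]
    rw [integral_comp_label (μ := μ) h₁ (fun i => ∑ j, ν.real (c₂ ⁻¹' {j}) *
      (ρ i j * (if i = j then (0 : ℝ) else 1)))]
    refine le_trans (Finset.sum_le_sum fun i _ => ?_) hπd
    rw [Finset.mul_sum]
    refine Finset.sum_le_sum fun j _ => ?_
    change p i * (q j * (ρ i j * _)) ≤ _
    split_ifs
    · simp
    · rw [mul_one]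
      by_cases hi : p i = 0
      · simp [hi, hπ0]
      · by_cases hj : q j = 0
        · simp [hj, hπ0]
        · refine le_of_eq ?_
          simp only [hρ]; field_simp

end BlockCoupling

/-! ### Kernels of finite rank -/

section StepKernels

variable {N κ α : Type*} [MeasurableSpace α] {μ : Measure α} [IsProbabilityMeasure μ]
  {v : N → κ → α × α → ℝ} [TopologicalSpace N] {a : N}

/-- The near-minimality inequality says that a quadratic polynomial in t is nonnegative; its
discriminant gives the claim. -/
theorem sq_integral_mul_le_of_near_minimizer {u s w : α → ℝ} (hu : BddMeas u) (hs : BddMeas s)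
    (hw : BddMeas w) {ε : ℝ}
    (h : ∀ t : ℝ, ∫ x, (u x - s x) ^ 2 ∂μ ≤ ∫ x, (u x - (s x + t * w x)) ^ 2 ∂μ + ε ^ 2) :
    (∫ x, (u x - s x) * w x ∂μ) ^ 2 ≤ ε ^ 2 * ∫ x, w x ^ 2 ∂μ := by
  have hd : BddMeas (fun x => u x - s x) := hu.sub hs
  have hd2 : BddMeas (fun x => (u x - s x) ^ 2) := by simpa only [sq] using hd.mul hd
  have hw2 : BddMeas (fun x => w x ^ 2) := by simpa only [sq] using hw.mul hw
  have key : ∀ t : ℝ, 0 ≤ (∫ x, w x ^ 2 ∂μ) * (t * t) +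
      (-2 * ∫ x, (u x - s x) * w x ∂μ) * t + ε ^ 2 := by
    intro t
    have e : ∫ x, (u x - (s x + t * w x)) ^ 2 ∂μ = ∫ x, (u x - s x) ^ 2 ∂μ -
        2 * t * ∫ x, (u x - s x) * w x ∂μ + t ^ 2 * ∫ x, w x ^ 2 ∂μ := by
      rw [← integral_const_mul, ← integral_const_mul, ← integral_sub (hd2.integrable μ)
        (((BddMeas.const _).mul (hd.mul hw)).integrable μ), ← integral_add
        ((hd2.sub ((BddMeas.const _).mul (hd.mul hw))).integrable μ)
        (((BddMeas.const _).mul hw2).integrable μ)]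
      exact integral_congr_ae (Eventually.of_forall fun x => by ring)
    have := h t
    rw [e] at this
    nlinarith
  have hdis := discrim_le_zero key
  rw [discrim] at hdis
  nlinarith

/-- Families of kernels of finite rank, made of approximable families of functions. -/
def stepKernels (μ : Measure α) (v : N → κ → α × α → ℝ) (a : N) :
    Submodule ℝ (N → α × α → ℝ) :=
  Submodule.span ℝ {K | ∃ g h, TreeApprox μ v a g ∧ TreeApprox μ v a h ∧
    K = fun n p => g n p.1 * h n p.2}

omit [IsProbabilityMeasure μ] in
theorem stepKernels_bddFamily {s : N → α × α → ℝ} (hs : s ∈ stepKernels μ v a) : BddFamily s := by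
  induction hs using Submodule.span_induction with
  | mem s h =>
    obtain ⟨g, h, hg, hh, rfl⟩ := h
    exact (hg.1.comp measurable_fst).mul (hh.1.comp measurable_snd)
  | zero => exact BddFamily.const 0
  | add s s' _ _ i i' => exact i.add i'
  | smul c s _ i => exact i.const_mul c

omit [IsProbabilityMeasure μ] in
theorem stepKernels_swap {s : N → α × α → ℝ} (hs : s ∈ stepKernels μ v a) :
    (fun n => s n ∘ Prod.swap) ∈ stepKernels μ v a := by
  induction hs using Submodule.span_induction with
  | mem s h =>
    obtain ⟨g, h, hg, hh, rfl⟩ := h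
    refine Submodule.subset_span ⟨h, g, hh, hg, ?_⟩
    ext n p
    simp [mul_comm]
  | zero => exact (stepKernels μ v a).zero_mem
  | add s s' _ _ i i' => exact (stepKernels μ v a).add_mem i i'
  | smul c s _ i => exact (stepKernels μ v a).smul_mem c i

variable (hv : ∀ k, BddFamily fun n => v n k)
  (hconv : ∀ t : LabelledTree κ, ContinuousAt (fun n => ∫ x, LabelledTree.eval μ (v n) t x ∂μ) a)

include hv hconv

omit hconv in
theorem TreeApprox.continuousAt_mul {c : N → ℝ} (hc : ContinuousAt c a) {M : ℝ}
    (hM : ∀ n, |c n| ≤ M) {Φ : N → α → ℝ} (h : TreeApprox μ v a Φ) :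
    TreeApprox μ v a fun n x => c n * Φ n x := by
  have hcf : BddFamily (fun n (_ : α) => c n) := ⟨fun n => measurable_const, M, fun n _ => hM n⟩
  refine TreeApprox.mul hv (TreeApprox.of_approx hv hcf fun ε hε =>
    ⟨_, TreeApprox.const hv (c a), ?_⟩) h
  filter_upwards [Metric.continuousAt_iff'.1 hc ε hε] with n hn
  exact integral_abs_sub_le_of_forall fun x => hn.le

/-- A rank-one kernel maps Φ to g times the scalar ∫ hΦ. This scalar depends on n, but continuously
at a. -/
theorem TreeApprox.kernelOp_stepKernels {s : N → α × α → ℝ} (hs : s ∈ stepKernels μ v a)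
    {Φ : N → α → ℝ} (hΦ : TreeApprox μ v a Φ) :
    TreeApprox μ v a fun n => _root_.kernelOp μ (s n) (Φ n) := by
  induction hs using Submodule.span_induction with
  | mem s h =>
    obtain ⟨g, h, hg, hh, rfl⟩ := h
    have hhΦ := hh.mul hv hΦ
    obtain ⟨M, hM⟩ := hhΦ.1.bdd
    convert TreeApprox.continuousAt_mul hv (TreeApprox.continuousAt_integral hv hconv hhΦ)
      (fun n => abs_integral_le_of_abs_le (hM n)) hg using 3 with n x
    rw [← integral_mul_const]
    exact integral_congr_ae (Eventually.of_forall fun y => by ring)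
  | zero =>
    have h0 : (fun n => _root_.kernelOp μ ((0 : N → α × α → ℝ) n) (Φ n)) = fun _ _ => 0 := by
      ext n x
      simp [_root_.kernelOp]
    rw [h0]
    exact TreeApprox.const hv 0
  | add s s' h h' i i' =>
    convert i.add hv i' using 3 with n x
    exact kernelOp_kernel_add ((stepKernels_bddFamily h).bddMeas n)
      ((stepKernels_bddFamily h').bddMeas n) (hΦ.1.bddMeas n) x
  | smul c s h i =>
    convert i.const_mul hv c using 3 with n x
    exact kernelOp_kernel_const_mul _ _ c x

omit hconv in
-- Choose s within ε² of the infimum of the squared L² distance at a. Every multiple of φ ⊗ ψ is an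
-- admissible perturbation of s, so the remainder is nearly orthogonal to φ ⊗ ψ.
theorem exists_stepKernels_near (k : κ) {ε : ℝ} (hε : 0 < ε) :
    ∃ s ∈ stepKernels μ v a, ∀ φ ψ : N → α → ℝ, TreeApprox μ v a φ → TreeApprox μ v a ψ →
      (∫ x, φ a x * kernelOp μ (fun p => v a k p - s a p) (ψ a) x ∂μ) ^ 2 ≤
        ε ^ 2 * ((∫ x, φ a x ^ 2 ∂μ) * ∫ x, ψ a x ^ 2 ∂μ) := by
  set E : (N → α × α → ℝ) → ℝ := fun s => ∫ p, (v a k p - s a p) ^ 2 ∂(μ.prod μ) with hE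
  have hbdd : BddBelow (E '' stepKernels μ v a) :=
    ⟨0, by rintro _ ⟨s, _, rfl⟩; exact integral_nonneg fun p => sq_nonneg _⟩
  have hne : (E '' stepKernels μ v a).Nonempty := ⟨_, 0, (stepKernels μ v a).zero_mem, rfl⟩
  obtain ⟨_, ⟨s, hs, rfl⟩, hlt⟩ := exists_lt_of_csInf_lt hne
    (show sInf (E '' stepKernels μ v a) < sInf (E '' stepKernels μ v a) + ε ^ 2 by
      have := pow_pos hε 2; linarith)
  refine ⟨s, hs, fun φ ψ hφ hψ => ?_⟩
  have bs := (stepKernels_bddFamily hs).bddMeas a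
  have bv := (hv k).bddMeas a
  have bφ := hφ.1.bddMeas a
  have bψ := hψ.1.bddMeas a
  have hw : (fun n (p : α × α) => φ n p.1 * ψ n p.2) ∈ stepKernels μ v a :=
    Submodule.subset_span ⟨φ, ψ, hφ, hψ, rfl⟩
  have bw := (stepKernels_bddFamily hw).bddMeas a
  have h := sq_integral_mul_le_of_near_minimizer (μ := μ.prod μ) bv bs bw (ε := ε) fun t => by
    have hmem := (stepKernels μ v a).add_mem hs ((stepKernels μ v a).smul_mem t hw)
    have h1 := csInf_le hbdd ⟨_, hmem, rfl⟩
    have h2 : E s ≤ E (s + t • fun n (p : α × α) => φ n p.1 * ψ n p.2) + ε ^ 2 := by linarith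
    exact h2
  rw [← integral_prod_mul_mul_eq (bv.sub bs) bφ bψ]
  have e1 : ∫ p, (φ a p.1 * ψ a p.2) ^ 2 ∂(μ.prod μ) =
      (∫ x, φ a x ^ 2 ∂μ) * ∫ x, ψ a x ^ 2 ∂μ := by
    rw [← integral_prod_mul]
    exact integral_congr_ae (Eventually.of_forall fun p => mul_pow _ _ _)
  rw [e1] at h
  simpa only [mul_comm (φ a _ * ψ a _)] using h

/-- The image of Φ under the remainder is again approximable, hence an admissible φ; one factor of
its squared norm then cancels. -/
theorem integral_sq_kernelOp_le {k : κ} {ε : ℝ} {s : N → α × α → ℝ} (hs : s ∈ stepKernels μ v a)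
    (hnear : ∀ φ ψ : N → α → ℝ, TreeApprox μ v a φ → TreeApprox μ v a ψ →
      (∫ x, φ a x * kernelOp μ (fun p => v a k p - s a p) (ψ a) x ∂μ) ^ 2 ≤
        ε ^ 2 * ((∫ x, φ a x ^ 2 ∂μ) * ∫ x, ψ a x ^ 2 ∂μ))
    {Φ : N → α → ℝ} (hΦ : TreeApprox μ v a Φ) :
    ∫ x, kernelOp μ (fun p => v a k p - s a p) (Φ a) x ^ 2 ∂μ ≤ ε ^ 2 * ∫ x, Φ a x ^ 2 ∂μ := by
  have hG := (TreeApprox.kernelOp hv k hΦ).sub hv (TreeApprox.kernelOp_stepKernels hv hconv hs hΦ)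
  have h := hnear _ Φ hG hΦ
  simp only [← kernelOp_kernel_sub ((hv k).bddMeas a) ((stepKernels_bddFamily hs).bddMeas a)
    (hΦ.1.bddMeas a), ← sq] at h
  set A := ∫ x, kernelOp μ (fun p => v a k p - s a p) (Φ a) x ^ 2 ∂μ
  have hA : 0 ≤ A := integral_nonneg fun x => sq_nonneg _
  have hB : 0 ≤ ∫ x, Φ a x ^ 2 ∂μ := integral_nonneg fun x => sq_nonneg _
  rcases hA.eq_or_lt with h0 | h0
  · rw [← h0]; positivity
  · refine le_of_mul_le_mul_left ?_ h0
    calc A * A = A ^ 2 := (sq A).symm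
      _ ≤ _ := h
      _ = _ := by ring

theorem integral_sq_kernelOp_swap_le {k k' : κ} (hk : ∀ n, v n k' = v n k ∘ Prod.swap) {ε : ℝ}
    {s : N → α × α → ℝ} (hs : s ∈ stepKernels μ v a)
    (hnear : ∀ φ ψ : N → α → ℝ, TreeApprox μ v a φ → TreeApprox μ v a ψ →
      (∫ x, φ a x * kernelOp μ (fun p => v a k p - s a p) (ψ a) x ∂μ) ^ 2 ≤
        ε ^ 2 * ((∫ x, φ a x ^ 2 ∂μ) * ∫ x, ψ a x ^ 2 ∂μ))
    {Φ : N → α → ℝ} (hΦ : TreeApprox μ v a Φ) :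
    ∫ x, kernelOp μ ((fun p => v a k p - s a p) ∘ Prod.swap) (Φ a) x ^ 2 ∂μ ≤
      ε ^ 2 * ∫ x, Φ a x ^ 2 ∂μ := by
  have key := integral_sq_kernelOp_le hv hconv (k := k') (stepKernels_swap hs)
    (ε := ε) (fun φ ψ hφ hψ => ?_) hΦ
  · rw [hk] at key
    exact key
  · have h := hnear ψ φ hψ hφ
    have bd : BddMeas (fun p => v a k p - s a p) :=
      ((hv k).bddMeas a).sub ((stepKernels_bddFamily hs).bddMeas a)
    rw [integral_mul_kernelOp bd (hψ.1.bddMeas a) (hφ.1.bddMeas a)] at h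
    rw [hk, mul_comm (∫ x, φ a x ^ 2 ∂μ)]
    simp only [mul_comm (φ a _)]
    exact h

end StepKernels

/-! ### The defect of kernels of finite rank -/

section Defect

variable {α β : Type*} [MeasurableSpace α] [MeasurableSpace β]
  {μ : Measure α} {ν : Measure β} [IsProbabilityMeasure μ] [IsProbabilityMeasure ν]

theorem defect_integrable {γ : Measure (α × β)} [IsFiniteMeasure γ] {u₁ : α × α → ℝ}
    {u₂ : β × β → ℝ} (h₁ : BddMeas u₁) (h₂ : BddMeas u₂) {φ : α → ℝ} {ψ : β → ℝ}
    (hφ : BddMeas φ) (hψ : BddMeas ψ) :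
    Integrable (fun p : α × β => ψ p.2 * kernelOp μ (u₁ ∘ Prod.swap) φ p.1 -
      φ p.1 * kernelOp ν u₂ ψ p.2) γ :=
  (((hψ.comp measurable_snd).mul (((h₁.comp measurable_swap).kernelOp hφ).comp
    measurable_fst)).sub ((hφ.comp measurable_fst).mul
      ((h₂.kernelOp hψ).comp measurable_snd))).integrable γ

theorem defect_add {γ : Measure (α × β)} [IsFiniteMeasure γ] {u₁ u₁' : α × α → ℝ}
    {u₂ u₂' : β × β → ℝ} (h₁ : BddMeas u₁) (h₂ : BddMeas u₂) (h₁' : BddMeas u₁')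
    (h₂' : BddMeas u₂') {φ : α → ℝ} {ψ : β → ℝ} (hφ : BddMeas φ) (hψ : BddMeas ψ) :
    defect μ ν γ (fun p => u₁ p + u₁' p) (fun p => u₂ p + u₂' p) φ ψ =
      defect μ ν γ u₁ u₂ φ ψ + defect μ ν γ u₁' u₂' φ ψ := by
  rw [defect, defect, defect, ← integral_add (defect_integrable h₁ h₂ hφ hψ)
    (defect_integrable h₁' h₂' hφ hψ)]
  refine integral_congr_ae (Eventually.of_forall fun p => ?_)
  have e1 := kernelOp_kernel_add (μ := μ) (h₁.comp measurable_swap) (h₁'.comp measurable_swap) hφ p.1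
  have e2 := kernelOp_kernel_add (μ := ν) h₂ h₂' hψ p.2
  change ψ p.2 * kernelOp μ (fun q => u₁ q.swap + u₁' q.swap) φ p.1 - _ = _
  simp only
  rw [e1, e2]
  simp only [Function.comp_def]
  ring

theorem defect_const_mul (γ : Measure (α × β)) (u₁ : α × α → ℝ) (u₂ : β × β → ℝ) (c : ℝ)
    (φ : α → ℝ) (ψ : β → ℝ) :
    defect μ ν γ (fun p => c * u₁ p) (fun p => c * u₂ p) φ ψ = c * defect μ ν γ u₁ u₂ φ ψ := by
  rw [defect, defect, ← integral_const_mul]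
  refine integral_congr_ae (Eventually.of_forall fun p => ?_)
  have e1 := kernelOp_kernel_const_mul (μ := μ) (u₁ ∘ Prod.swap) φ c p.1
  have e2 := kernelOp_kernel_const_mul (μ := ν) u₂ ψ c p.2
  change ψ p.2 * kernelOp μ (fun q => c * (u₁ ∘ Prod.swap) q) φ p.1 - _ = _
  simp only
  rw [e1, e2]
  ring

theorem abs_integral_mul_sub_le {γ : Measure α} [IsProbabilityMeasure γ] {f g h : α → ℝ}
    (hf : BddMeas f) (hg : BddMeas g) (hh : BddMeas h) (h1 : ∀ x, |h x| ≤ 1) :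
    |∫ x, h x * f x ∂γ - ∫ x, h x * g x ∂γ| ≤ ∫ x, |f x - g x| ∂γ := by
  rw [← integral_sub ((hh.mul hf).integrable γ) ((hh.mul hg).integrable γ)]
  simpa using abs_integral_le_integral_abs.trans (integral_abs_mul_sub_le (M := 1) hf hg hh h1)

/-- For rank-one kernels the defect factors as PQ - P'Q', where P, P' pair φ with g₁, g₂ and Q, Q'
pair ψ with h₁, h₂, all as integrals against γ. -/
theorem abs_defect_rank_one_le {γ : ProbabilityMeasure (α × β)} (hγ : γ ∈ couplings μ ν)
    {g₁ h₁ : α → ℝ} {g₂ h₂ : β → ℝ} (bg₁ : BddMeas g₁) (bh₁ : BddMeas h₁) (bg₂ : BddMeas g₂)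
    (bh₂ : BddMeas h₂) {M η : ℝ} (hM : ∀ x, |g₁ x| ≤ M) (hM' : ∀ y, |h₂ y| ≤ M)
    (hg : ∫ p, |g₁ p.1 - g₂ p.2| ∂(γ : Measure (α × β)) ≤ η)
    (hh : ∫ p, |h₁ p.1 - h₂ p.2| ∂(γ : Measure (α × β)) ≤ η)
    {φ : α → ℝ} {ψ : β → ℝ} (hφ : BddMeas φ) (hψ : BddMeas ψ) (hφ1 : ∀ x, |φ x| ≤ 1)
    (hψ1 : ∀ y, |ψ y| ≤ 1) :
    |defect μ ν γ (fun p => g₁ p.1 * h₁ p.2) (fun p => g₂ p.1 * h₂ p.2) φ ψ| ≤ 2 * M * η := by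
  have X {f : α → ℝ} (hf : BddMeas f) : BddMeas (fun p : α × β => f p.1) := hf.comp measurable_fst
  have Y {f : β → ℝ} (hf : BddMeas f) : BddMeas (fun p : α × β => f p.2) := hf.comp measurable_snd
  set P := ∫ p, φ p.1 * g₁ p.1 ∂(γ : Measure (α × β)) with hP
  set P' := ∫ p, φ p.1 * g₂ p.2 ∂(γ : Measure (α × β)) with hP'
  set Q := ∫ p, ψ p.2 * h₁ p.1 ∂(γ : Measure (α × β)) with hQ
  set Q' := ∫ p, ψ p.2 * h₂ p.2 ∂(γ : Measure (α × β)) with hQ'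
  have e1 : ∀ x, kernelOp μ ((fun p : α × α => g₁ p.1 * h₁ p.2) ∘ Prod.swap) φ x = P * h₁ x := by
    intro x
    rw [hP, integral_fst_of_map_eq hγ.1 (hφ.mul bg₁).meas, kernelOp, ← integral_mul_const]
    refine integral_congr_ae (Eventually.of_forall fun y => ?_)
    simp only [Function.comp, Prod.swap_prod_mk]
    ring
  have e2 : ∀ y, kernelOp ν (fun p : β × β => g₂ p.1 * h₂ p.2) ψ y = Q' * g₂ y := by
    intro y
    rw [hQ', integral_snd_of_map_eq hγ.2 (hψ.mul bh₂).meas, kernelOp, ← integral_mul_const]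
    exact integral_congr_ae (Eventually.of_forall fun z => by ring)
  have e3 : defect μ ν γ (fun p => g₁ p.1 * h₁ p.2) (fun p => g₂ p.1 * h₂ p.2) φ ψ =
      P * Q - Q' * P' := by
    rw [defect]
    simp only [e1, e2]
    rw [hQ, hP', ← integral_const_mul, ← integral_const_mul, ← integral_sub
      (((BddMeas.const _).mul ((Y hψ).mul (X bh₁))).integrable _)
      (((BddMeas.const _).mul ((X hφ).mul (Y bg₂))).integrable _)]
    exact integral_congr_ae (Eventually.of_forall fun p => by ring)
  have bound {f : α × β → ℝ} {θ : α × β → ℝ} (hθ : ∀ p, |θ p| ≤ 1) (hf : ∀ p, |f p| ≤ M) :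
      |∫ p, θ p * f p ∂(γ : Measure (α × β))| ≤ M :=
    abs_integral_le_of_abs_le fun p => by
      rw [abs_mul]
      exact (mul_le_of_le_one_left (abs_nonneg _) (hθ p)).trans (hf p)
  have hPM : |P| ≤ M := bound (fun p => hφ1 _) fun p => hM _
  have hQM : |Q'| ≤ M := bound (fun p => hψ1 _) fun p => hM' _
  have hPP : |P - P'| ≤ η :=
    (abs_integral_mul_sub_le (X bg₁) (Y bg₂) (X hφ) fun p => hφ1 _).trans hg
  have hQQ : |Q - Q'| ≤ η :=
    (abs_integral_mul_sub_le (X bh₁) (Y bh₂) (Y hψ) fun p => hψ1 _).trans hh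
  have hM0 : 0 ≤ M := (abs_nonneg _).trans hPM
  calc |defect μ ν γ (fun p => g₁ p.1 * h₁ p.2) (fun p => g₂ p.1 * h₂ p.2) φ ψ|
      = |P * (Q - Q') + Q' * (P - P')| := by rw [e3]; ring_nf
    _ ≤ |P| * |Q - Q'| + |Q'| * |P - P'| := by
        rw [← abs_mul, ← abs_mul]; exact abs_add_le _ _
    _ ≤ M * η + M * η := by gcongr
    _ = 2 * M * η := by ring

end Defect

section StepDefect

variable {N κ α : Type*} [MeasurableSpace α] {μ : Measure α} [IsProbabilityMeasure μ]
  {v : N → κ → α × α → ℝ} [TopologicalSpace N] {a : N}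

/-- The finitely many factors of s form the list F. The constant A depends neither on n nor on the
coupling, so the coupling can be chosen after the required closeness is known. -/
theorem stepKernels_defect_le {s : N → α × α → ℝ} (hs : s ∈ stepKernels μ v a) :
    ∃ (L : Type) (_ : Fintype L) (F : L → N → α → ℝ) (A : ℝ), (∀ l, TreeApprox μ v a (F l)) ∧
      0 ≤ A ∧ ∀ n, ∀ γ ∈ couplings μ μ, ∀ η : ℝ,
        (∀ l, ∫ p, |F l n p.1 - F l a p.2| ∂(γ : Measure (α × α)) ≤ η) → 0 ≤ η →
        ∀ φ ψ : α → ℝ, BddMeas φ → BddMeas ψ → (∀ x, |φ x| ≤ 1) → (∀ y, |ψ y| ≤ 1) →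
          |defect μ μ γ (s n) (s a) φ ψ| ≤ A * η := by
  induction hs using Submodule.span_induction with
  | mem s h =>
    obtain ⟨g, h, hg, hh, rfl⟩ := h
    obtain ⟨M, hM0, hM⟩ := hg.1.exists_pos
    obtain ⟨M', hM0', hM'⟩ := hh.1.exists_pos
    refine ⟨Bool, inferInstance, fun b => if b then g else h, 2 * (M + M'), ?_, by positivity, ?_⟩
    · rintro (_ | _)
      · exact hh
      · exact hg
    · intro n γ hγ η hη _ φ ψ hφ hψ hφ1 hψ1
      exact abs_defect_rank_one_le hγ (hg.1.bddMeas n) (hh.1.bddMeas n) (hg.1.bddMeas a)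
        (hh.1.bddMeas a) (fun x => (hM n x).trans (by linarith))
        (fun x => (hM' a x).trans (by linarith)) (hη true) (hη false) hφ hψ hφ1 hψ1
  | zero =>
    refine ⟨Empty, inferInstance, fun l => l.elim, 0, fun l => l.elim, le_rfl, ?_⟩
    intro n γ hγ η _ _ φ ψ _ _ _ _
    simp [defect, kernelOp]
  | add s s' hs hs' i i' =>
    obtain ⟨L, _, F, A, hF, hA, h⟩ := i
    obtain ⟨L', _, F', A', hF', hA', h'⟩ := i'
    refine ⟨L ⊕ L', inferInstance, Sum.elim F F', A + A', ?_, by positivity, ?_⟩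
    · rintro (l | l)
      · exact hF l
      · exact hF' l
    · intro n γ hγ η hη hη0 φ ψ hφ hψ hφ1 hψ1
      have bs := stepKernels_bddFamily hs
      have bs' := stepKernels_bddFamily hs'
      have e := defect_add (μ := μ) (ν := μ) (γ := (γ : Measure (α × α))) (bs.bddMeas n)
        (bs.bddMeas a) (bs'.bddMeas n) (bs'.bddMeas a) hφ hψ
      change |defect μ μ γ (fun p => s n p + s' n p) (fun p => s a p + s' a p) φ ψ| ≤ _
      rw [e, add_mul]
      exact (abs_add_le _ _).trans (add_le_add
        (h n γ hγ η (fun l => hη (Sum.inl l)) hη0 φ ψ hφ hψ hφ1 hψ1)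
        (h' n γ hγ η (fun l => hη (Sum.inr l)) hη0 φ ψ hφ hψ hφ1 hψ1))
  | smul c s hs i =>
    obtain ⟨L, _, F, A, hF, hA, h⟩ := i
    refine ⟨L, inferInstance, F, |c| * A, hF, by positivity, ?_⟩
    intro n γ hγ η hη hη0 φ ψ hφ hψ hφ1 hψ1
    have e := defect_const_mul (μ := μ) (ν := μ) (γ : Measure (α × α)) (s n) (s a) c φ ψ
    change |defect μ μ γ (fun p => c * s n p) (fun p => c * s a p) φ ψ| ≤ _
    rw [e, abs_mul, mul_assoc]
    exact mul_le_mul_of_nonneg_left (h n γ hγ η hη hη0 φ ψ hφ hψ hφ1 hψ1) (abs_nonneg c)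

end StepDefect

/-! ### Inverse counting for finitely many real-valued kernels -/

section InverseCounting

theorem abs_integral_mul_le_of_integral_sq_le {α : Type*} [MeasurableSpace α] {μ : Measure α}
    [IsProbabilityMeasure μ] {f h : α → ℝ} (hf : BddMeas f) (hh : BddMeas h)
    (hf1 : ∀ x, |f x| ≤ 1) {b : ℝ} (hb : 0 ≤ b) (h2 : ∫ x, h x ^ 2 ∂μ ≤ b ^ 2) :
    |∫ x, f x * h x ∂μ| ≤ b := by
  have h3 : |∫ x, f x * h x ∂μ| ≤ ∫ x, |h x| ∂μ := by
    refine abs_integral_le_integral_abs.trans (integral_mono ((hf.mul hh).abs.integrable μ)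
      (hh.abs.integrable μ) fun x => ?_)
    simp only [abs_mul]
    exact mul_le_of_le_one_left (abs_nonneg _) (hf1 x)
  exact h3.trans (abs_le_of_sq_le_sq' ((integral_abs_sq_le hh).trans h2) hb).2

variable {α β ι : Type*} [MeasurableSpace α] [MeasurableSpace β] [Fintype ι] [MeasurableSpace ι]
  [MeasurableSingletonClass ι] {μ : Measure α} {ν : Measure β} [IsProbabilityMeasure μ]
  [IsProbabilityMeasure ν]

/-- In each term of the defect one test function is replaced by its conditional average d ∘ c, and
the operator is moved onto it by adjunction. Small L² norms of the operators on functions of the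
label therefore suffice, for u₁ and for the transpose of u₂. -/
theorem abs_defect_le_of_block {γ : ProbabilityMeasure (α × β)} {c₁ : α → ι}
    {c₂ : β → ι} (h₁ : Measurable c₁) (h₂ : Measurable c₂)
    (hγ₁ : ∀ ψ : β → ℝ, BddMeas ψ → (∀ y, 0 ≤ ψ y ∧ ψ y ≤ 1) → ∃ d : ι → ℝ,
        (∀ i, 0 ≤ d i ∧ d i ≤ 1) ∧ ∀ φ : α → ℝ, BddMeas φ →
          ∫ p, φ p.1 * ψ p.2 ∂(γ : Measure (α × β)) = ∫ x, φ x * d (c₁ x) ∂μ)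
    (hγ₂ : ∀ φ : α → ℝ, BddMeas φ → (∀ x, 0 ≤ φ x ∧ φ x ≤ 1) → ∃ d : ι → ℝ,
        (∀ i, 0 ≤ d i ∧ d i ≤ 1) ∧ ∀ ψ : β → ℝ, BddMeas ψ →
          ∫ p, φ p.1 * ψ p.2 ∂(γ : Measure (α × β)) = ∫ y, ψ y * d (c₂ y) ∂ν)
    {u₁ : α × α → ℝ} {u₂ : β × β → ℝ} (b₁ : BddMeas u₁) (b₂ : BddMeas u₂) {b : ℝ} (hb : 0 ≤ b)
    (hu₁ : ∀ d : ι → ℝ, (∀ i, 0 ≤ d i ∧ d i ≤ 1) →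
      ∫ x, kernelOp μ u₁ (fun x => d (c₁ x)) x ^ 2 ∂μ ≤ b ^ 2)
    (hu₂ : ∀ d : ι → ℝ, (∀ i, 0 ≤ d i ∧ d i ≤ 1) →
      ∫ y, kernelOp ν (u₂ ∘ Prod.swap) (fun y => d (c₂ y)) y ^ 2 ∂ν ≤ b ^ 2)
    {φ : α → ℝ} {ψ : β → ℝ} (hφ : BddMeas φ) (hψ : BddMeas ψ) (hφ1 : ∀ x, 0 ≤ φ x ∧ φ x ≤ 1)
    (hψ1 : ∀ y, 0 ≤ ψ y ∧ ψ y ≤ 1) :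
    |defect μ ν γ u₁ u₂ φ ψ| ≤ b + b := by
  obtain ⟨d, hd, hd'⟩ := hγ₁ ψ hψ hψ1
  obtain ⟨d', hdd, hdd'⟩ := hγ₂ φ hφ hφ1
  have bs₁ : BddMeas (u₁ ∘ Prod.swap) := b₁.comp measurable_swap
  have e1 := hd' _ (bs₁.kernelOp (μ := μ) hφ)
  have e2 := hdd' _ (b₂.kernelOp (μ := ν) hψ)
  have bd : BddMeas (fun x => d (c₁ x)) := bddMeas_comp_label h₁ d
  have bdd : BddMeas (fun x => d' (c₂ x)) := bddMeas_comp_label h₂ d'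
  rw [← integral_mul_kernelOp b₁ hφ bd] at e1
  have e3 : ∫ y, kernelOp ν u₂ ψ y * d' (c₂ y) ∂ν =
      ∫ y, ψ y * kernelOp ν (u₂ ∘ Prod.swap) (fun y => d' (c₂ y)) y ∂ν := by
    have := integral_mul_kernelOp (μ := ν) (ν := ν) b₂ bdd hψ
    simpa only [mul_comm] using this
  rw [e3] at e2
  have e : defect μ ν γ u₁ u₂ φ ψ = ∫ x, φ x * kernelOp μ u₁ (fun x => d (c₁ x)) x ∂μ -
      ∫ y, ψ y * kernelOp ν (u₂ ∘ Prod.swap) (fun y => d' (c₂ y)) y ∂ν := by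
    rw [← e1, ← e2, defect, ← integral_sub
      ((((bs₁.kernelOp hφ).comp measurable_fst).mul (hψ.comp measurable_snd)).integrable _)
      (((hφ.comp measurable_fst).mul ((b₂.kernelOp hψ).comp measurable_snd)).integrable _)]
    exact integral_congr_ae (Eventually.of_forall fun p => by simp only [mul_comm])
  rw [e]
  refine (abs_sub _ _).trans (add_le_add ?_ ?_)
  · exact abs_integral_mul_le_of_integral_sq_le hφ (b₁.kernelOp bd)
      (fun x => abs_le.2 ⟨by linarith [(hφ1 x).1], (hφ1 x).2⟩) hb (hu₁ d hd)
  · exact abs_integral_mul_le_of_integral_sq_le hψ ((b₂.comp measurable_swap).kernelOp bdd)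
      (fun x => abs_le.2 ⟨by linarith [(hψ1 x).1], (hψ1 x).2⟩) hb (hu₂ d' hdd)

open Classical in
theorem integral_abs_sub_le_of_label {γ : Measure (α × β)} [IsProbabilityMeasure γ] {c₁ : α → ι}
    {c₂ : β → ι} (h₁ : Measurable c₁) (h₂ : Measurable c₂) {f : α → ℝ} {g : β → ℝ}
    (hf : BddMeas f) (hg : BddMeas g) {M δ : ℝ} (hfM : ∀ x, |f x| ≤ M) (hgM : ∀ y, |g y| ≤ M)
    (hδ : 0 ≤ δ) (h : ∀ x y, c₁ x = c₂ y → |f x - g y| ≤ δ) :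
    ∫ p, |f p.1 - g p.2| ∂γ ≤
      δ + 2 * M * ∫ p, (if c₁ p.1 = c₂ p.2 then (0 : ℝ) else 1) ∂γ := by
  have hm : BddMeas (fun p : α × β => if c₁ p.1 = c₂ p.2 then (0 : ℝ) else 1) :=
    ⟨Measurable.ite (measurableSet_eq_fun (h₁.comp measurable_fst) (h₂.comp measurable_snd))
      measurable_const measurable_const, 1, fun p => by split_ifs <;> simp⟩
  have hfg : BddMeas (fun p : α × β => |f p.1 - g p.2|) :=
    ((hf.comp measurable_fst).sub (hg.comp measurable_snd)).abs
  have hr := (BddMeas.const (2 * M)).mul hm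
  calc ∫ p, |f p.1 - g p.2| ∂γ
      ≤ ∫ p : α × β, (δ + 2 * M * (if c₁ p.1 = c₂ p.2 then (0 : ℝ) else 1)) ∂γ := by
        refine integral_mono (hfg.integrable γ) (((BddMeas.const δ).add hr).integrable γ)
          fun p => ?_
        by_cases hp : c₁ p.1 = c₂ p.2
        · simpa [hp] using h _ _ hp
        · have h3 := (abs_sub (f p.1) (g p.2)).trans (add_le_add (hfM p.1) (hgM p.2))
          simp only [hp, if_false]
          linarith
    _ = _ := by
        rw [integral_add (integrable_const _) (hr.integrable γ), integral_const_mul]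
        simp

end InverseCounting

/-! ### Continuity at the limit index for functions of the label -/

section Labels

variable {N κ α ι : Type*} [MeasurableSpace α] {μ : Measure α} [IsProbabilityMeasure μ]
  {v : N → κ → α × α → ℝ} [TopologicalSpace N] {a : N} [Fintype ι] [DecidableEq ι]
  [MeasurableSpace ι] [MeasurableSingletonClass ι]
  (hv : ∀ k, BddFamily fun n => v n k)
  (hconv : ∀ t : LabelledTree κ, ContinuousAt (fun n => ∫ x, LabelledTree.eval μ (v n) t x ∂μ) a)
  {c : N → α → ι} (hc : ∀ n, Measurable (c n))
  (hcA : ∀ i, TreeApprox μ v a fun n x => if c n x = i then 1 else 0)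

include hv

theorem TreeApprox.comp_label (hcA : ∀ i, TreeApprox μ v a fun n x => if c n x = i then 1 else 0)
    (d : ι → ℝ) : TreeApprox μ v a fun n x => d (c n x) := by
  convert TreeApprox.sum hv Finset.univ fun i => (hcA i).const_mul hv (d i) using 3 with n x
  simp

include hconv hc hcA

theorem eventually_sum_abs_measure_label_sub_le {δ : ℝ} (hδ : 0 < δ) :
    ∀ᶠ n in 𝓝 a, ∑ i, |μ.real (c n ⁻¹' {i}) - μ.real (c a ⁻¹' {i})| ≤ δ := by
  have hcont : ContinuousAt
      (fun n => ∑ i, |μ.real (c n ⁻¹' {i}) - μ.real (c a ⁻¹' {i})|) a := by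
    have h : ∀ i, ContinuousAt (fun n => μ.real (c n ⁻¹' {i})) a := fun i => by
      have e : ∀ n, ∫ x, (if c n x = i then (1 : ℝ) else 0) ∂μ = μ.real (c n ⁻¹' {i}) := fun n => by
        rw [integral_comp_label (hc n) (fun j => if j = i then (1 : ℝ) else 0)]
        simp
      simpa only [e] using TreeApprox.continuousAt_integral hv hconv (hcA i)
    exact tendsto_finsetSum _ fun i _ => ((h i).sub continuousAt_const).abs
  have := hcont.eventually_lt (continuousAt_const (y := δ)) (by simpa using hδ)
  exact this.mono fun n hn => hn.le

/-- The left side is a quadratic form in d with coefficients ∫ Gᵢ Gⱼ, finitely many quantities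
continuous at a. As the entries of d lie in [0, 1], the bound known at a carries over uniformly in
d, at the cost of a further ε². -/
theorem eventually_integral_sq_kernelOp_label_le {k : κ} {ε : ℝ} (hε : 0 < ε)
    {s : N → α × α → ℝ} (hs : s ∈ stepKernels μ v a)
    (hnear : ∀ φ ψ : N → α → ℝ, TreeApprox μ v a φ → TreeApprox μ v a ψ →
      (∫ x, φ a x * kernelOp μ (fun p => v a k p - s a p) (ψ a) x ∂μ) ^ 2 ≤
        ε ^ 2 * ((∫ x, φ a x ^ 2 ∂μ) * ∫ x, ψ a x ^ 2 ∂μ)) :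
    ∀ᶠ n in 𝓝 a, ∀ d : ι → ℝ, (∀ i, 0 ≤ d i ∧ d i ≤ 1) →
      ∫ x, kernelOp μ (fun p => v n k p - s n p) (fun x => d (c n x)) x ^ 2 ∂μ ≤ (2 * ε) ^ 2 := by
  set D : N → α × α → ℝ := fun n p => v n k p - s n p with hD
  have bD : ∀ n, BddMeas (D n) := fun n =>
    ((hv k).bddMeas n).sub ((stepKernels_bddFamily hs).bddMeas n)
  set G : ι → N → α → ℝ := fun i n => kernelOp μ (D n) (fun x => if c n x = i then 1 else 0)
    with hG
  have bI : ∀ n i, BddMeas (fun x => if c n x = i then (1 : ℝ) else 0) := fun n i =>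
    (hcA i).1.bddMeas n
  have hGA : ∀ i, TreeApprox μ v a (G i) := fun i => by
    convert (TreeApprox.kernelOp hv k (hcA i)).sub hv
      (TreeApprox.kernelOp_stepKernels hv hconv hs (hcA i)) using 3 with n x
    exact kernelOp_kernel_sub ((hv k).bddMeas n) ((stepKernels_bddFamily hs).bddMeas n) (bI n i) x
  have bG : ∀ n i, BddMeas (G i n) := fun n i => (hGA i).1.bddMeas n
  have hop : ∀ n (d : ι → ℝ) x, kernelOp μ (D n) (fun x => d (c n x)) x = ∑ i, d i * G i n x := by
    intro n d x
    have e : (fun x => d (c n x)) = fun x => ∑ i, d i * (if c n x = i then (1 : ℝ) else 0) := by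
      ext x
      simp
    rw [e, kernelOp_finset_sum _ (bD n) fun i => (BddMeas.const (d i)).mul (bI n i)]
    simp only [kernelOp_const_mul, hG]
  have hsq : ∀ n (d : ι → ℝ), ∫ x, kernelOp μ (D n) (fun x => d (c n x)) x ^ 2 ∂μ =
      ∑ i, ∑ j, d i * d j * ∫ x, G i n x * G j n x ∂μ := by
    intro n d
    simp only [hop, sq, Finset.sum_mul_sum, ← integral_const_mul]
    have b : ∀ i j, BddMeas (fun x => d i * d j * (G i n x * G j n x)) := fun i j =>
      (BddMeas.const _).mul ((bG n i).mul (bG n j))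
    rw [integral_congr_ae (Eventually.of_forall fun x => Finset.sum_congr rfl fun i _ =>
      Finset.sum_congr rfl fun j _ => mul_mul_mul_comm (d i) (G i n x) (d j) (G j n x)),
      integral_finsetSum _ fun i _ => (BddMeas.sum _ fun j _ => b i j).integrable μ]
    exact Finset.sum_congr rfl fun i _ => integral_finsetSum _ fun j _ => (b i j).integrable μ
  have hcont : ContinuousAt (fun n => ∑ i, ∑ j, |∫ x, G i n x * G j n x ∂μ -
      ∫ x, G i a x * G j a x ∂μ|) a :=
    tendsto_finsetSum _ fun i _ => tendsto_finsetSum _ fun j _ =>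
      ((TreeApprox.continuousAt_integral hv hconv ((hGA i).mul hv (hGA j))).sub
        continuousAt_const).abs
  have hlt := hcont.eventually_lt (continuousAt_const (y := ε ^ 2)) (by simpa using pow_pos hε 2)
  filter_upwards [hlt] with n hn d hd
  have ha : ∫ x, kernelOp μ (D a) (fun x => d (c a x)) x ^ 2 ∂μ ≤ ε ^ 2 := by
    refine (integral_sq_kernelOp_le hv hconv hs hnear (TreeApprox.comp_label hv hcA d)).trans ?_
    have : ∫ x, d (c a x) ^ 2 ∂μ ≤ 1 := by
      refine (le_abs_self _).trans (abs_integral_le_of_abs_le fun x => ?_)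
      rw [abs_pow, abs_of_nonneg (hd _).1]
      exact pow_le_one₀ (hd _).1 (hd _).2
    have h2 := pow_pos hε 2
    nlinarith
  have hdiff : ∫ x, kernelOp μ (D n) (fun x => d (c n x)) x ^ 2 ∂μ -
      ∫ x, kernelOp μ (D a) (fun x => d (c a x)) x ^ 2 ∂μ ≤ ∑ i, ∑ j, |∫ x, G i n x * G j n x ∂μ -
      ∫ x, G i a x * G j a x ∂μ| := by
    rw [hsq, hsq, ← Finset.sum_sub_distrib]
    refine Finset.sum_le_sum fun i _ => ?_
    rw [← Finset.sum_sub_distrib]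
    refine Finset.sum_le_sum fun j _ => ?_
    rw [← mul_sub]
    have h1 : 0 ≤ d i * d j := mul_nonneg (hd i).1 (hd j).1
    have h2 : d i * d j ≤ 1 := mul_le_one₀ (hd i).2 (hd j).1 (hd j).2
    refine (le_abs_self _).trans ?_
    rw [abs_mul, abs_of_nonneg h1]
    exact mul_le_of_le_one_left (abs_nonneg _) h2
  have h2 := pow_pos hε 2
  nlinarith

end Labels

/-! ### One coupling for a finite family of scalar kernels -/

section InverseCountingFamily

variable {N κ α : Type*} [MeasurableSpace α] {μ : Measure α} [IsProbabilityMeasure μ]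
  {v : N → κ → α × α → ℝ} [TopologicalSpace N] {a : N} [Fintype κ]

/-- If all tree densities of a finite family of kernels, which is closed under transposition, are
continuous at `a`, then the kernels are close to those at `a` in the sense of a common coupling. -/
theorem eventually_exists_coupling_abs_defect_le
    (hv : ∀ k, BddFamily fun n => v n k)
    (hconv : ∀ t : LabelledTree κ, ContinuousAt (fun n => ∫ x, LabelledTree.eval μ (v n) t x ∂μ) a)
    {τ : κ → κ} (hτ : ∀ n k, v n (τ k) = v n k ∘ Prod.swap) {ε : ℝ} (hε : 0 < ε) :
    ∀ᶠ n in 𝓝 a, ∃ γ ∈ couplings μ μ, ∀ k, ∀ S, MeasurableSet S → ∀ T, MeasurableSet T →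
      |defect μ μ γ (v n k) (v a k) (S.indicator fun _ => 1) (T.indicator fun _ => 1)| ≤ ε := by
  classical
  choose s hs hnear using fun k => exists_stepKernels_near (μ := μ) (a := a) hv k
    (show 0 < ε / 8 by positivity)
  choose L hL F A hF hA hdef using fun k => stepKernels_defect_le (hs k)
  set A' := ∑ k, A k with hA'
  have hAA : ∀ k, A k ≤ A' := fun k => Finset.single_le_sum (fun k _ => hA k) (Finset.mem_univ k)
  have hA0 : 0 ≤ A' := Finset.sum_nonneg fun k _ => hA k
  set η := ε / (2 * (A' + 1)) with hη
  have hη0 : 0 < η := by positivity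
  choose M hM0 hM using fun l : Σ k, L k => (hF l.1 l.2).1.exists_pos
  set M' := ∑ l, M l + 1 with hM'
  have hMM : ∀ l, M l ≤ M' := fun l =>
    (Finset.single_le_sum (fun l _ => (hM0 l).le) (Finset.mem_univ l)).trans (by linarith)
  have hM0' : 0 < M' := by
    have : 0 ≤ ∑ l, M l := Finset.sum_nonneg fun l _ => (hM0 l).le
    linarith
  obtain ⟨m, c, hc, hcA, hcF⟩ := TreeApprox.exists_label hv hconv (F := fun l : Σ k, L k => F l.1 l.2)
    (fun l => hF l.1 l.2) (half_pos hη0)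
  -- Mismatched labels cost at most 2M' times this mass, that is η/2; equal labels cost the other
  -- η/2.
  have hev := eventually_sum_abs_measure_label_sub_le hv hconv hc hcA
    (δ := η / (4 * M')) (by positivity)
  have hev' := eventually_all.2 fun k =>
    eventually_integral_sq_kernelOp_label_le hv hconv hc hcA (by positivity) (hs k) (hnear k)
  filter_upwards [hev, hev'] with n hn hn'
  obtain ⟨γ, hγ, hγ1, hγ2, hγ3⟩ := exists_block_coupling (μ := μ) (ν := μ) (hc n) (hc a)
  refine ⟨γ, hγ, fun k S hS T hT => ?_⟩
  have bS := BddMeas.indicator_one hS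
  have bT := BddMeas.indicator_one hT
  have h01 : ∀ (S : Set α) x, 0 ≤ S.indicator (fun _ => (1 : ℝ)) x ∧
      S.indicator (fun _ => (1 : ℝ)) x ≤ 1 := fun S x => by
    by_cases h : x ∈ S <;> simp [h]
  have bv := fun n => (hv k).bddMeas n
  have bs := fun n => (stepKernels_bddFamily (hs k)).bddMeas n
  have bD := fun n => (bv n).sub (bs n)
  have e := defect_add (μ := μ) (ν := μ) (γ := (γ : Measure (α × α))) (bs n) (bs a) (bD n) (bD a)
    bS bT
  simp only [add_sub_cancel] at e
  rw [e]
  have d1 : |defect μ μ γ (s k n) (s k a) (S.indicator fun _ => 1) (T.indicator fun _ => 1)| ≤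
      A k * η := by
    refine hdef k n γ hγ η (fun l => ?_) hη0.le _ _ bS bT (abs_indicator_one_le S)
      (abs_indicator_one_le T)
    refine (integral_abs_sub_le_of_label (hc n) (hc a) ((hF k l).1.bddMeas n)
      ((hF k l).1.bddMeas a) (fun x => (hM ⟨k, l⟩ n x).trans (hMM _))
      (fun x => (hM ⟨k, l⟩ a x).trans (hMM _)) (half_pos hη0).le
      fun x y hxy => hcF ⟨k, l⟩ n a x y hxy).trans ?_
    calc _ ≤ η / 2 + 2 * M' * (η / (4 * M')) := by
          gcongr
          refine le_trans ?_ (hγ3.trans hn)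
          convert le_refl _
      _ = η := by field_simp; ring
  have d2 : |defect μ μ γ (fun p => v n k p - s k n p) (fun p => v a k p - s k a p)
      (S.indicator fun _ => 1) (T.indicator fun _ => 1)| ≤ 2 * (ε / 8) + 2 * (ε / 8) := by
    -- The transposed remainder occurs only at the index a, where `integral_sq_kernelOp_swap_le`
    -- applies directly.
    refine abs_defect_le_of_block (hc n) (hc a) hγ1 hγ2 (bD n) (bD a) (by positivity)
      (hn' k) (fun d hd => ?_) bS bT (h01 S) (h01 T)
    refine (integral_sq_kernelOp_swap_le hv hconv (fun n => hτ n k) (hs k) (hnear k)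
      (TreeApprox.comp_label hv hcA d)).trans ?_
    have : ∫ x, d (c a x) ^ 2 ∂μ ≤ 1 := by
      refine (le_abs_self _).trans (abs_integral_le_of_abs_le fun x => ?_)
      rw [abs_pow, abs_of_nonneg (hd _).1]
      exact pow_le_one₀ (hd _).1 (hd _).2
    have h2 := pow_pos hε 2
    nlinarith
  have d3 : A k * η ≤ ε / 2 := by
    calc A k * η ≤ (A' + 1) * η := by gcongr; linarith [hAA k]
      _ = ε / 2 := by rw [hη]; field_simp
  exact (abs_add_le _ _).trans (by linarith)

end InverseCountingFamily

/-! ### Inverse counting for kernels with values in a compact set -/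

section HilbertDefect

variable {α β : Type*} [MeasurableSpace α] [MeasurableSpace β]
  {μ : Measure α} {ν : Measure β} [IsProbabilityMeasure μ] [IsProbabilityMeasure ν]

theorem defect_finset_sum {κ : Type*} (s : Finset κ) {γ : Measure (α × β)} [IsFiniteMeasure γ]
    {u₁ : κ → α × α → ℝ} {u₂ : κ → β × β → ℝ} (h₁ : ∀ k, BddMeas (u₁ k))
    (h₂ : ∀ k, BddMeas (u₂ k)) {φ : α → ℝ} {ψ : β → ℝ} (hφ : BddMeas φ) (hψ : BddMeas ψ) :
    defect μ ν γ (fun p => ∑ k ∈ s, u₁ k p) (fun p => ∑ k ∈ s, u₂ k p) φ ψ =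
      ∑ k ∈ s, defect μ ν γ (u₁ k) (u₂ k) φ ψ := by
  classical
  induction s using Finset.induction_on with
  | empty => simp [defect, kernelOp]
  | insert k s hk ih =>
    simp only [Finset.sum_insert hk]
    rw [defect_add (h₁ k) (h₂ k) (BddMeas.sum s fun k _ => h₁ k) (BddMeas.sum s fun k _ => h₂ k)
      hφ hψ, ih]

theorem abs_defect_le_of_abs_le {γ : Measure (α × β)} [IsProbabilityMeasure γ]
    {u₁ : α × α → ℝ} {u₂ : β × β → ℝ} {ε : ℝ} (h₁ : ∀ p, |u₁ p| ≤ ε) (h₂ : ∀ p, |u₂ p| ≤ ε)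
    {φ : α → ℝ} {ψ : β → ℝ} (hφ : ∀ x, |φ x| ≤ 1) (hψ : ∀ y, |ψ y| ≤ 1) :
    |defect μ ν γ u₁ u₂ φ ψ| ≤ ε + ε := by
  refine abs_integral_le_of_abs_le fun p => (abs_sub _ _).trans (add_le_add ?_ ?_)
  · rw [abs_mul]
    refine (mul_le_of_le_one_left (abs_nonneg _) (hψ _)).trans ?_
    simpa using abs_kernelOp_le (μ := μ) (u := u₁ ∘ Prod.swap) (fun q => h₁ q.swap) hφ p.1
  · rw [abs_mul]
    refine (mul_le_of_le_one_left (abs_nonneg _) (hφ _)).trans ?_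
    simpa using abs_kernelOp_le (μ := ν) h₂ hψ p.2

variable {H : Type*} [NormedAddCommGroup H] [InnerProductSpace ℝ H]

/-- Expand ⟨e, w⟩ in the directions b k, with coefficients of modulus at most 1 and a uniformly
small remainder. One coupling that is good for finitely many directions is thus good for the whole
unit ball. -/
theorem abs_defect_inner_le {κ : Type*} [Fintype κ] {γ : Measure (α × β)} [IsProbabilityMeasure γ]
    {w₁ : α × α → H} {w₂ : β × β → H} (h₁ : StronglyMeasurable w₁) (h₂ : StronglyMeasurable w₂)
    {C : ℝ} (hC₁ : ∀ p, ‖w₁ p‖ ≤ C) (hC₂ : ∀ p, ‖w₂ p‖ ≤ C) {b : κ → H} (hb : ∀ k, ‖b k‖ ≤ 1)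
    {ε η : ℝ} (ha₁ : ∀ p, ‖w₁ p - ∑ k, (inner ℝ (b k) (w₁ p) : ℝ) • b k‖ ≤ ε)
    (ha₂ : ∀ p, ‖w₂ p - ∑ k, (inner ℝ (b k) (w₂ p) : ℝ) • b k‖ ≤ ε)
    {φ : α → ℝ} {ψ : β → ℝ} (hφ : BddMeas φ) (hψ : BddMeas ψ) (hφ1 : ∀ x, |φ x| ≤ 1)
    (hψ1 : ∀ y, |ψ y| ≤ 1)
    (h : ∀ k, |defect μ ν γ (fun p => inner ℝ (b k) (w₁ p)) (fun p => inner ℝ (b k) (w₂ p)) φ ψ| ≤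
      η) {e : H} (he : ‖e‖ ≤ 1) :
    |defect μ ν γ (fun p => inner ℝ e (w₁ p)) (fun p => inner ℝ e (w₂ p)) φ ψ| ≤
      Fintype.card κ * η + (ε + ε) := by
  have B₁ := BddMeas.inner h₁ hC₁
  have B₂ := BddMeas.inner h₂ hC₂
  have C₁ := fun k => (BddMeas.const (inner ℝ e (b k))).mul (B₁ (b k))
  have C₂ := fun k => (BddMeas.const (inner ℝ e (b k))).mul (B₂ (b k))
  have S₁ := BddMeas.sum Finset.univ fun k _ => C₁ k
  have S₂ := BddMeas.sum Finset.univ fun k _ => C₂ k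
  have rem : ∀ x : H, inner ℝ e x - ∑ k, (inner ℝ e (b k) * inner ℝ (b k) x : ℝ) =
      inner ℝ e (x - ∑ k, (inner ℝ (b k) x : ℝ) • b k) := fun x => by
    simp only [inner_sub_right, inner_sum, inner_smul_right, mul_comm]
  have rem_le : ∀ x : H, ‖x - ∑ k, (inner ℝ (b k) x : ℝ) • b k‖ ≤ ε →
      |inner ℝ e x - ∑ k, (inner ℝ e (b k) * inner ℝ (b k) x : ℝ)| ≤ ε := fun x hx => by
    rw [rem]
    exact (abs_real_inner_le_norm _ _).trans
      ((mul_le_of_le_one_left (norm_nonneg _) he).trans hx)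
  have e1 := defect_add (μ := μ) (ν := ν) (γ := γ) S₁ S₂ ((B₁ e).sub S₁) ((B₂ e).sub S₂) hφ hψ
  simp only [add_sub_cancel] at e1
  rw [e1, defect_finset_sum _ C₁ C₂ hφ hψ]
  refine (abs_add_le _ _).trans (add_le_add ?_ (abs_defect_le_of_abs_le
    (fun p => rem_le _ (ha₁ p)) (fun p => rem_le _ (ha₂ p)) hφ1 hψ1))
  refine (Finset.abs_sum_le_sum_abs _ _).trans ?_
  refine (Finset.sum_le_card_nsmul _ _ η fun k _ => ?_).trans_eq (by simp)
  rw [defect_const_mul, abs_mul]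
  refine (mul_le_of_le_one_left (abs_nonneg _) ?_).trans (h k)
  exact (abs_real_inner_le_norm _ _).trans (mul_le_one₀ he (norm_nonneg _) (hb k))

end HilbertDefect

section HilbertInverse

variable {N α H : Type*} [TopologicalSpace N] {a : N} [MeasurableSpace α] {μ : Measure α}
  [IsProbabilityMeasure μ] [NormedAddCommGroup H] [InnerProductSpace ℝ H]

/-- The adjoined zero vector changes no sum; it keeps the index type nonempty, as edge labels and
division by its cardinality require. -/
theorem exists_finite_approx {K : Set H} (hK : IsCompact K) {ε : ℝ} (hε : 0 < ε) :
    ∃ (m : ℕ) (b : Option (Fin m) → H), (∀ k, ‖b k‖ ≤ 1) ∧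
      ∀ x ∈ K, ‖x - ∑ k, (inner ℝ (b k) x : ℝ) • b k‖ ≤ ε := by
  obtain ⟨m, e, he, h⟩ := exists_orthonormal_approx hK hε
  refine ⟨m, fun k => k.elim 0 e, ?_, fun x hx => ?_⟩
  · rintro (_ | k)
    · simp
    · exact (he.1 k).le
  · simpa [Fintype.sum_option] using h x hx

variable [SecondCountableTopology H] {w : N → α × α → H} (hw : ∀ n, StronglyMeasurable (w n))

include hw

theorem continuousAt_integral_eval {C : ℝ} (hC : ∀ n p, ‖w n p‖ ≤ C)
    (h : ∀ (V : Type) [Fintype V] (F : OrientedGraph V), F.IsTree →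
      Tendsto (fun n => F.homDensity μ (w n)) (𝓝 a) (𝓝 (F.homDensity μ (w a))))
    {κ : Type*} [Nonempty κ] (b : κ → H) (t : LabelledTree (κ × Bool)) :
    ContinuousAt (fun n => ∫ x, LabelledTree.eval μ
      (LabelledTree.withTranspose fun k p => inner ℝ (b k) (w n p)) t x ∂μ) a := by
  obtain ⟨V, _, F, r, c, hF, hreal⟩ := LabelledTree.exists_realization (α := α) t
  have e : ∀ n, ∫ x, LabelledTree.eval μ
      (LabelledTree.withTranspose fun k p => inner ℝ (b k) (w n p)) t x ∂μ =
      inner ℝ (HilbertTensorPower.pure fun e : F.edges => b (c e)) (F.homDensity μ (w n)) := by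
    intro n
    have h1 := hreal μ (fun k p => inner ℝ (b k) (w n p))
      (fun k => BddMeas.inner (hw n) (hC n) (b k)) (fun _ => 1) (BddMeas.const 1)
    simp only [one_mul] at h1
    rw [← h1, F.inner_pure_homDensity (hw n) (hC n)]
    refine integral_congr_ae (Eventually.of_forall fun ξ => ?_)
    exact (Finset.prod_coe_sort F.edges
      fun e => (inner ℝ (b (c e)) (w n (ξ e.1, ξ e.2)) : ℝ)).symm
  simp only [ContinuousAt, e]
  exact tendsto_const_nhds.inner (h V F hF)

theorem tendsto_couplingDist_of_tendsto_homDensity [CompleteSpace H] [StandardBorelSpace α]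
    [Nonempty α] {K : Set H} (hK : IsCompact K) (hwK : ∀ n p, w n p ∈ K)
    (h : ∀ (V : Type) [Fintype V] (F : OrientedGraph V), F.IsTree →
      Tendsto (fun n => F.homDensity μ (w n)) (𝓝 a) (𝓝 (F.homDensity μ (w a)))) :
    Tendsto (fun n => couplingDist μ μ (w n) (w a)) (𝓝 a) (𝓝 0) := by
  obtain ⟨C, hC0, hKC⟩ := hK.isBounded.exists_pos_norm_le
  have hC : ∀ n p, ‖w n p‖ ≤ C := fun n p => hKC _ (hwK n p)
  have key : ∀ ε > 0, ∀ᶠ n in 𝓝 a, couplingDist μ μ (w n) (w a) ≤ ENNReal.ofReal (6 * ε) := by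
    intro ε hε
    obtain ⟨m, b, hb, hbK⟩ := exists_finite_approx hK hε
    set v : N → Option (Fin m) × Bool → α × α → ℝ := fun n =>
      LabelledTree.withTranspose fun k p => inner ℝ (b k) (w n p) with hvdef
    have hv : ∀ k, BddFamily fun n => v n k := fun k =>
      ⟨fun n => (LabelledTree.withTranspose_bddMeas
        (fun k => BddMeas.inner (hw n) (hC n) (b k)) k).meas, 1 * C, fun n p => by
        have hle : ∀ p, |(inner ℝ (b k.1) (w n p) : ℝ)| ≤ 1 * C := fun p =>
          (abs_real_inner_le_norm _ _).trans
            (mul_le_mul (hb _) (hC n p) (norm_nonneg _) zero_le_one)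
        simp only [hvdef, LabelledTree.withTranspose]
        split_ifs
        · exact hle p
        · exact hle p.swap⟩
    have hτ : ∀ n k, v n (k.1, !k.2) = v n k ∘ Prod.swap := by
      rintro n ⟨k, _ | _⟩ <;> ext p <;> simp [hvdef, LabelledTree.withTranspose]
    have hm : (0 : ℝ) < Fintype.card (Option (Fin m)) := by
      exact_mod_cast Fintype.card_pos
    have hev := eventually_exists_coupling_abs_defect_le (μ := μ) hv
      (fun t => continuousAt_integral_eval hw hC h b t) (τ := fun k => (k.1, !k.2)) hτ
      (div_pos hε hm)
    filter_upwards [hev] with n hn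
    obtain ⟨γ, hγ, hdef⟩ := hn
    -- In each orientation the directions together contribute ε, and the remainders of the two
    -- kernels ε each.
    have heq : 6 * ε = (ε + (ε + ε)) + (ε + (ε + ε)) := by ring
    rw [heq]
    refine couplingDist_le hγ (hw n) (hw a) (hC n) (hC a) (by positivity)
      fun e he S hS T hT => ?_
    have hcard : Fintype.card (Option (Fin m)) * (ε / Fintype.card (Option (Fin m))) = ε := by
      field_simp
    constructor
    · have := abs_defect_inner_le (μ := μ) (ν := μ) (γ := (γ : Measure (α × α))) (hw n) (hw a)
        (hC n) (hC a) hb (fun p => hbK _ (hwK n p)) (fun p => hbK _ (hwK a p))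
        (BddMeas.indicator_one hS) (BddMeas.indicator_one hT) (abs_indicator_one_le S)
        (abs_indicator_one_le T) (fun k => hdef (k, true) S hS T hT) he
      rw [hcard] at this
      exact (le_abs_self _).trans this
    · have := abs_defect_inner_le (μ := μ) (ν := μ) (γ := (γ : Measure (α × α)))
        ((hw n).comp_measurable measurable_swap) ((hw a).comp_measurable measurable_swap)
        (fun p => hC n _) (fun p => hC a _) hb (fun p => hbK _ (hwK n _))
        (fun p => hbK _ (hwK a _))
        (BddMeas.indicator_one hS) (BddMeas.indicator_one hT) (abs_indicator_one_le S)
        (abs_indicator_one_le T) (fun k => hdef (k, false) S hS T hT) he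
      rw [hcard] at this
      exact (le_abs_self _).trans this
  refine ENNReal.tendsto_nhds_zero.2 fun ε hε => ?_
  rcases eq_or_ne ε ∞ with rfl | hε'
  · exact Eventually.of_forall fun n => le_top
  · filter_upwards [key (ε.toReal / 6) (div_pos (ENNReal.toReal_pos hε.ne' hε') (by norm_num))]
      with n hn
    rwa [mul_div_cancel₀ _ (by norm_num : (6 : ℝ) ≠ 0), ENNReal.ofReal_toReal hε'] at hn

end HilbertInverse

/-! ### The equivalence -/

theorem exists_stronglyMeasurable_mem_of_ae {Ω H : Type*} [MeasurableSpace Ω] {P : Measure Ω}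
    [NormedAddCommGroup H] {K : Set H} (hK : IsClosed K) (h0 : 0 ∈ K) {f : Ω → H}
    (hf : AEStronglyMeasurable f P) (hfK : ∀ᵐ x ∂P, f x ∈ K) :
    ∃ g, StronglyMeasurable g ∧ (∀ x, g x ∈ K) ∧ f =ᵐ[P] g := by
  borelize H
  have hm := hf.stronglyMeasurable_mk
  refine ⟨(hf.mk f ⁻¹' K).indicator (hf.mk f), hm.indicator (hm.measurable hK.measurableSet),
    fun x => ?_, ?_⟩
  · by_cases hx : x ∈ hf.mk f ⁻¹' K
    · rw [Set.indicator_of_mem hx]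
      exact hx
    · rw [Set.indicator_of_notMem hx]
      exact h0
  · filter_upwards [hf.ae_eq_mk, hfK] with x hx hxK
    have hxm : x ∈ hf.mk f ⁻¹' K := by
      rw [hx] at hxK
      exact hxK
    rw [Set.indicator_of_mem hxm, hx]

theorem tendsto_homDensity_iff_tendsto_couplingDist {α H : Type*} [MeasurableSpace α]
    [StandardBorelSpace α] [Nonempty α] {μ : Measure α} [IsProbabilityMeasure μ]
    [NormedAddCommGroup H] [InnerProductSpace ℝ H] [CompleteSpace H] [SecondCountableTopology H]
    {w : ℕ → α × α → H} {w' : α × α → H} (hw : ∀ n, StronglyMeasurable (w n))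
    (hw' : StronglyMeasurable w') {K : Set H} (hK : IsCompact K) (hwK : ∀ n p, w n p ∈ K)
    (hwK' : ∀ p, w' p ∈ K) :
    (∀ (V : Type) [Fintype V] (T : OrientedGraph V), T.IsTree →
      Tendsto (fun n => ‖T.homDensity μ (w n) - T.homDensity μ w'‖) atTop (𝓝 0)) ↔
    Tendsto (fun n => couplingDist μ μ (w n) w') atTop (𝓝 0) := by
  refine ⟨fun h => ?_, fun h V _ T hT =>
    tendsto_homDensity_of_tendsto_couplingDist hw hw' hK hwK hwK' h T hT.isAcyclic⟩
  have hcoe : coclosedCompact ℕ = atTop := by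
    rw [coclosedCompact_eq_cocompact, cocompact_eq_atTop]
  -- The limit kernel sits at infinity, so convergence of the sequence is continuity there.
  let W : OnePoint ℕ → α × α → H := fun n => n.elim w' w
  have key := tendsto_couplingDist_of_tendsto_homDensity (μ := μ) (w := W) (a := OnePoint.infty)
    (fun n => by induction n using OnePoint.rec <;> [exact hw'; exact hw _]) hK
    (fun n => by induction n using OnePoint.rec <;> [exact hwK'; exact hwK _]) fun V _ F hF => ?_
  · have := key.comp OnePoint.tendsto_coe_infty
    rwa [hcoe] at this
  · refine OnePoint.continuousAt_infty'.2 ?_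
    rw [hcoe]
    exact tendsto_iff_norm_sub_tendsto_zero.2 (h V F hF)

end

theorem lemma2p16 {B H : Type*} [NormedAddCommGroup B] [NormedSpace ℝ B] [CompleteSpace B]
    [NormedAddCommGroup H] [InnerProductSpace ℝ H] [CompleteSpace H]
    [TopologicalSpace.SeparableSpace H]
    (j : B →L[ℝ] H) (hj : Function.Injective j) (hjc : IsCompactOperator j)
    (w : ℕ → I × I → B) (w' : I × I → B) (C : ℝ)
    (hwm : ∀ n, AEStronglyMeasurable (fun p => j (w n p)) volume)
    (hw'm : AEStronglyMeasurable (fun p => j (w' p)) volume)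
    (hwb : ∀ n, ∀ᵐ p ∂(volume : Measure (I × I)), ‖w n p‖ ≤ C)
    (hw'b : ∀ᵐ p ∂(volume : Measure (I × I)), ‖w' p‖ ≤ C) :
    (∀ (V : Type) [Fintype V] (T : OrientedGraph V), T.IsTree →
      Tendsto (fun n => ‖T.homDensity volume (fun p => j (w n p)) -
        T.homDensity volume (fun p => j (w' p))‖) atTop (𝓝 0)) ↔
    Tendsto (fun n => couplingDist volume volume (fun p => j (w n p)) (fun p => j (w' p)))
      atTop (𝓝 0) := by
  have : SecondCountableTopology H := UniformSpace.secondCountable_of_separable H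
  have hC : 0 ≤ C := by
    obtain ⟨p, hp⟩ := hw'b.exists
    exact (norm_nonneg _).trans hp
  -- The only use of the compact embedding. The set contains 0, the value used to redefine the
  -- kernels on null sets.
  set K : Set H := closure (j '' Metric.closedBall 0 C) with hKdef
  have hK : IsCompact K :=
    IsCompactOperator.isCompact_closure_image_closedBall (f := (j : B →ₗ[ℝ] H)) hjc C
  have mem : ∀ x : B, ‖x‖ ≤ C → j x ∈ K := fun x hx =>
    subset_closure ⟨x, by simpa using hx, rfl⟩
  have h0 : (0 : H) ∈ K := by simpa using mem 0 (by simpa using hC)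
  choose g hg hgK hwg using fun n => exists_stronglyMeasurable_mem_of_ae hK.isClosed h0 (hwm n)
    ((hwb n).mono fun p hp => mem _ hp)
  obtain ⟨g', hg', hgK', hwg'⟩ := exists_stronglyMeasurable_mem_of_ae hK.isClosed h0 hw'm
    (hw'b.mono fun p hp => mem _ hp)
  have e1 : ∀ (V : Type) [Fintype V] (T : OrientedGraph V) (n : ℕ),
      T.homDensity volume (fun p => j (w n p)) = T.homDensity volume (g n) := fun V _ T n =>
    T.homDensity_congr_ae (hwg n)
  have e2 : ∀ (V : Type) [Fintype V] (T : OrientedGraph V),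
      T.homDensity volume (fun p => j (w' p)) = T.homDensity volume g' := fun V _ T =>
    T.homDensity_congr_ae hwg'
  have e3 : ∀ n, couplingDist volume volume (fun p => j (w n p)) (fun p => j (w' p)) =
      couplingDist volume volume (g n) g' := fun n => couplingDist_congr_ae (hwg n) hwg'
  simp only [e1, e2, e3]
  exact tendsto_homDensity_iff_tendsto_couplingDist hg hg' hK hgK hgK'
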